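/- **Setting.** Let $X_N^{(r)}$ be one of $A^{(1)}_n\,(n\ge1)$, $B^{(1)}_n\,(n\ge3)$, $C^{(1)}_n\,(n\ge2)$, $D^{(1)}_n\,(n\ge4)$, $E^{(1)}_{6,7,8}$, $F^{(1)}_4$, $G^{(1)}_2$, $A^{(2)}_{2n}\,(n\ge1)$, $A^{(2)}_{2n-1}\,(n\ge2)$, $D^{(2)}_{n+1}\,(n\ge2)$, $E^{(2)}_6$, $D^{(3)}_4$. Let $\mathfrak g=X_N$, with Dynkin nodes $I$, Cartan matrix $A'=(A'_{ij})$ and diagram automorphism $\sigma$ of order $r$. Let $\mathfrak g_0$ be the corresponding fixed subalgebra ($\mathfrak g_0=\mathfrak g$ if $r=1$, and $B_n,C_n,B_n,F_4,G_2$ in the five twisted cases in the order above), with nodes $\{1,\dots,n\}$, the set of $\sigma$-orbits on $I$, and Cartan matrix $A=(A_{ab})$. Let $d'_i$ and $d_a$ be the coprime positive integers making $(d'_iA'_{ij})$ and $(d_aA_{ab})$ symmetric. Put $\epsilon'_i=r$ if $\sigma(i)=i$ and $\epsilon'_i=1$ otherwise; $\epsilon_i=2$ if $A'_{i\sigma(i)}<0$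 and $\epsilon_i=1$ otherwise; $\kappa_0=2$ for $A^{(2)}_{2n}$ and $\kappa_0=1$ otherwise. Identify $\{1,\dots,n\}$ with a set of orbit representatives in $I$ such that $A_{ab}<0\Leftrightarrow A'_{ab}<0$, and read $d'_a,\epsilon'_a,\epsilon_a,A'_{ab}$ accordingly. Put $\epsilon'_{ab}=\max(\epsilon'_a,\epsilon'_b)$. Let $\tilde n=n$, except that $\tilde n=n+1$ for $A^{(2)}_{2n}$, where the extra index $n+1$ is the node $\sigma(n)\in I$. Let $H=\{1,\dots,n\}\times\mathbb Z_{\ge1}$, and let $\mathcal N$ be the set of families $(N^{(a)}_m)_{(a,m)\in H}$ of non-negative integers with finitely many non-zero members. Fix $\nu,N\in\mathcal N$, let $H'=\{(a,m)\in H: N^{(a)}_m>0\}$, and set $M_a=\sum_m mN^{(a)}_m$. **Bethe equation.** For unknowns $x^{(a)}_i$ ($1\le a\le n$, $1\le i\le M_a$; for $A^{(2)}_{2n}$ put $M_{n+1}=M_n$, $x^{(n+1)}_j=-x^{(n)}_j$) the $q$-Bethe equation is $F^{(a)}_{i+}G^{(a)}_{i-}=-F^{(a)}_{i-}G^{(a)}_{i+}$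 for all $(a,i)$, where $$F^{(a)}_{i+}=\prod_{k\ge1}\bigl(x^{(a)}_iq^{k\kappa_0\epsilon'_ad'_a}-1\bigr)^{\nu^{(a)}_k},\qquad F^{(a)}_{i-}=\prod_{k\ge1}\bigl(x^{(a)}_i-q^{k\kappa_0\epsilon'_ad'_a}\bigr)^{\nu^{(a)}_k},$$ $$G^{(a)}_{i+}=\prod_{b=1}^{\tilde n}\prod_{j=1}^{M_b}\Bigl((x^{(a)}_i)^{\epsilon'_{ab}/\epsilon'_a}q^{\kappa_0\epsilon'_{ab}d'_aA'_{ab}}-(x^{(b)}_j)^{\epsilon'_{ab}/\epsilon'_b}\Bigr),$$ $$G^{(a)}_{i-}=\prod_{b=1}^{\tilde n}\prod_{j=1}^{M_b}\Bigl((x^{(a)}_i)^{\epsilon'_{ab}/\epsilon'_a}-(x^{(b)}_j)^{\epsilon'_{ab}/\epsilon'_b}q^{\kappa_0\epsilon'_{ab}d'_aA'_{ab}}\Bigr).$$ **String solutions.** Solutions are families of germs of meromorphic functions $x(q)$ around $q=0$; $\mathrm{ord}$ denotes the order at $q=0$ ($\infty$ for the zero function), $f^0$ the leading coefficient, and $\tilde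 f=q^{-\mathrm{ord} f}f$. A meromorphic solution arranged as $(x^{(a)}_{m\alpha i})$, $(a,m)\in H'$, $1\le\alpha\le N^{(a)}_m$, $1\le i\le m$, is a *string solution of pattern $N$* if $\mathrm{ord}(F^{(a)}_{m\alpha i+}G^{(a)}_{m\alpha i-})<\infty$ and $\mathrm{ord}(x^{(a)}_{m\alpha i})=(m+1-2i)\kappa_0\epsilon'_ad'_a$ always, and if the leading coefficient of $x^{(a)}_{m\alpha i}$ does not depend on $i$; its common value $z^{(a)}_{m\alpha}\ne0$ is the *string center*. Put $$\xi_{+}=\kappa_0\epsilon'_ad'_a\sum_{k}\nu^{(a)}_k\min(m+1-2i+k,0),\qquad \xi_{-}=\kappa_0\epsilon'_ad'_a\sum_k\nu^{(a)}_k\min(m+1-2i,k),$$ $$\eta_{+}=\kappa_0\sum_{b=1}^{\tilde n}\sum_{k\ge1}\sum_{\beta=1}^{N^{(b)}_k}\sum_{j=1}^k\epsilon'_{ab}\min\bigl(d'_a(m+1-2i+A'_{ab}),\,d'_b(k+1-2j)\bigr),$$ $$\eta_{-}=\kappa_0\sum_{b=1}^{\tilde n}\sum_{k\ge1}\sum_{\beta=1}^{N^{(b)}_k}\sum_{j=1}^k\epsilon'_{ab}\min\bigl(d'_a(m+1-2i),\,d'_b(k+1-2j+A'_{ba})\bigr)$$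 (with $N^{(n+1)}_k=N^{(n)}_k$ for $A^{(2)}_{2n}$). The string solution is *generic* if for all $(a,m,\alpha,i)$: $\mathrm{ord}\,F_{\pm}=\xi_{\pm}$, $\mathrm{ord}\,G_{+}=\eta_{+}+\zeta_{i}$, $\mathrm{ord}\,G_{-}=\eta_{-}+\zeta_{i+1}$, where $\zeta_i=\mathrm{ord}(\tilde x^{(a)}_{m\alpha i}-\tilde x^{(a)}_{m\alpha,i-1})$ for $2\le i\le m$ and $\zeta_1=\zeta_{m+1}=0$. **String center equation.** Let $\gamma^{(a)}_m=\sum_k\min(m,k)\nu^{(a)}_k$, $$P^{(a)}_m=\gamma^{(a)}_m-\sum_{(b,k)\in H}\frac{A_{ab}}{\epsilon_ad'_b}\min(d'_am,d'_bk)N^{(b)}_k,\qquad \hat P^{(a)}_m=\gamma^{(a)}_m-\sum_{(b,k)\in H}\frac{A'_{ab}}{d'_b}\min(d'_am,d'_bk)N^{(b)}_k,$$ $$A_{am\alpha,bk\beta}=\delta_{ab}\delta_{mk}\delta_{\alpha\beta}(P^{(a)}_m+N^{(a)}_m)+\frac{A_{ba}}{\epsilon_bd'_a}\min(d'_am,d'_bk)-\delta_{ab}\delta_{mk}.$$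 These are integers. The string center equation (SCE) of pattern $N$ is, for unknowns $z^{(a)}_{m\alpha}\in\mathbb C\setminus\{0\}$ ($(a,m)\in H'$, $1\le\alpha\le N^{(a)}_m$), $$\prod_{(b,k)\in H'}\prod_{\beta=1}^{N^{(b)}_k}(z^{(b)}_{k\beta})^{A_{am\alpha,bk\beta}}=(-1)^{\hat P^{(a)}_m+N^{(a)}_m+1}\qquad\text{for all }(a,m)\in H',\ 1\le\alpha\le N^{(a)}_m.$$ With $\langle m\rangle=\{m-1,m-3,\dots,-m+1\}$ (and $z^{(n+1)}_{k\beta}=-z^{(n)}_{k\beta}$ for $A^{(2)}_{2n}$), a solution is *generic* if for all $a\in\{1,\dots,n\}$, $b\in\{1,\dots,\tilde n\}$: $z^{(a)}_{m\alpha}\ne1$ whenever some $k\in\langle m\rangle$, $k\ge1$, has $\nu^{(a)}_k>0$; and $(z^{(a)}_{m\alpha})^{\epsilon'_{ab}/\epsilon'_a}\ne(z^{(b)}_{k\beta})^{\epsilon'_{ab}/\epsilon'_b}$ whenever $(a,m,\alpha)\ne(b,k,\beta)$ and $d'_aA'_{ab}\in\{id'_a-jd'_b: i\in\langle m\rangle,\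 j\in\langle k\rangle\}$. **Genericity inequalities.** Let $\Delta^{(a)}_j=0$, except that if $r=1$ and there is $a'$ with $d_a>d_{a'}=1$ and $A_{aa'}\ne0$, then $\Delta^{(a)}_j=-N^{(a')}_{2j}$ if $d_a=2$ and $\Delta^{(a)}_j=-(N^{(a')}_{3j-1}+2N^{(a')}_{3j}+N^{(a')}_{3j+1})$ if $d_a=3$. The condition on $N$ is $$\sum_{k=1}^{\min(i-1,m+1-i)}\Bigl\{d'_a\bigl(P^{(a)}_{m+1-2k}+N^{(a)}_{m+1-2k}\bigr)+\Delta^{(a)}_{m+1-2k}\Bigr\}>0\qquad\text{for all }(a,m)\in H',\ 2\le i\le m.\tag{G}$$ **Theorem.** Suppose that $N$ satisfies (G) and that the matrix $(A_{am\alpha,bk\beta})$ has non-zero determinant. Then the map sending a string solution $(x^{(a)}_{m\alpha i}(q))$ to its string centers $(z^{(a)}_{m\alpha})$ is a bijection from the set of generic string solutions of pattern $N$ of the $q$-Bethe equation (as families of germs of meromorphic functions around $q=0$) onto the set of generic solutions of the SCE of pattern $N$. -/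

import Mathlib

open Filter Topology

noncomputable section

namespace QBethe

/-- The affine types `X_N^{(r)}`: `A1 n` is `A_n^{(1)}`, ..., `A2even n` is `A_{2n}^{(2)}`,
`A2odd n` is `A_{2n-1}^{(2)}`, `D2 n` is `D_{n+1}^{(2)}`, `E62` is `E_6^{(2)}`, and `D43` is
`D_4^{(3)}`. -/
inductive AffineType : Type
  | A1 (n : ℕ) (hn : 1 ≤ n)
  | B1 (n : ℕ) (hn : 3 ≤ n)
  | C1 (n : ℕ) (hn : 2 ≤ n)
  | D1 (n : ℕ) (hn : 4 ≤ n)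
  | E61
  | E71
  | E81
  | F41
  | G21
  | A2even (n : ℕ) (hn : 1 ≤ n)
  | A2odd (n : ℕ) (hn : 2 ≤ n)
  | D2 (n : ℕ) (hn : 2 ≤ n)
  | E62
  | D43

/-- The raw data attached to an affine type: the simple Lie algebra `𝔤 = X_N` with its diagram
automorphism `σ` of order `r`, and the fixed subalgebra `𝔤₀` of rank `n`.
Nodes of the diagrams are numbered from `0`. -/
structure Datum : Type where
  /-- The rank of `𝔤`. -/
  bigRank : ℕ
  /-- The rank of `𝔤₀`, which is the number of `σ`-orbits. -/
  rank : ℕ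
  /-- The order of `σ`. -/
  r : ℕ
  /-- The constant `κ₀`, equal to `2` for `A_{2n}^{(2)}` and to `1` otherwise. -/
  kappa : ℕ
  /-- The Cartan matrix `A'` of `𝔤`. -/
  cartan' : Matrix (Fin bigRank) (Fin bigRank) ℤ
  /-- The coprime positive integers `d'_i` with `(d'_i A'_{ij})` symmetric. -/
  d' : Fin bigRank → ℕ
  /-- The diagram automorphism of `𝔤`. -/
  σ : Equiv.Perm (Fin bigRank)
  /-- The section `ι` of the projection onto the set of `σ`-orbits. -/
  ι : Fin rank → Fin bigRank
  /-- The Cartan matrix `A` of `𝔤₀`. -/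
  cartan : Matrix (Fin rank) (Fin rank) ℤ
  /-- The coprime positive integers `d_a` with `(d_a A_{ab})` symmetric. -/
  d : Fin rank → ℕ

/-- The datum of a nontwisted type. -/
def Datum.nontwisted (n : ℕ) (M : Matrix (Fin n) (Fin n) ℤ) (d : Fin n → ℕ) : Datum where
  bigRank := n
  rank := n
  r := 1
  kappa := 1
  cartan' := M
  d' := d
  σ := 1
  ι := id
  cartan := M
  d := d

/-- The datum of each affine type. A Cartan matrix is normalized here so that `(d_a A_{ab})` is
symmetric with `d_a` proportional to the squared length of the root `α_a`; Mathlib's matrices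
`CartanMatrix.B`, `C`, `F₄`, `G₂` follow the transposed convention. For `E_6^{(2)}` and
`D_4^{(3)}` the nodes of `𝔤₀` are numbered in the direction opposite to `F_4^{(1)}` and
`G_2^{(1)}`, so that the transposed matrix is the one of Mathlib. -/
def AffineType.datum : AffineType → Datum
  | .A1 n _ => .nontwisted n (CartanMatrix.A n) (fun _ => 1)
  | .B1 n _ => .nontwisted n (CartanMatrix.B n).transpose
      (fun a => if (a : ℕ) + 1 = n then 1 else 2)
  | .C1 n _ => .nontwisted n (CartanMatrix.C n).transpose
      (fun a => if (a : ℕ) + 1 = n then 2 else 1)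
  | .D1 n _ => .nontwisted n (CartanMatrix.D n) (fun _ => 1)
  | .E61 => .nontwisted 6 CartanMatrix.E₆ (fun _ => 1)
  | .E71 => .nontwisted 7 CartanMatrix.E₇ (fun _ => 1)
  | .E81 => .nontwisted 8 CartanMatrix.E₈ (fun _ => 1)
  | .F41 => .nontwisted 4 CartanMatrix.F₄.transpose ![2, 2, 1, 1]
  | .G21 => .nontwisted 2 CartanMatrix.G₂.transpose ![3, 1]
  | .A2even n _ =>
    { bigRank := 2 * n
      rank := n
      r := 2
      kappa := 2
      cartan' := CartanMatrix.A (2 * n)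
      d' := fun _ => 1
      σ := Fin.revPerm
      ι := Fin.castLE (by omega)
      cartan := (CartanMatrix.B n).transpose
      d := fun a => if (a : ℕ) + 1 = n then 1 else 2 }
  | .A2odd n _ =>
    { bigRank := 2 * n - 1
      rank := n
      r := 2
      kappa := 1
      cartan' := CartanMatrix.A (2 * n - 1)
      d' := fun _ => 1
      σ := Fin.revPerm
      ι := Fin.castLE (by omega)
      cartan := (CartanMatrix.C n).transpose
      d := fun a => if (a : ℕ) + 1 = n then 2 else 1 }
  | .D2 n _ =>
    { bigRank := n + 1
      rank := n
      r := 2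
      kappa := 1
      cartan' := CartanMatrix.D (n + 1)
      d' := fun _ => 1
      σ := Equiv.swap ⟨n - 1, by omega⟩ ⟨n, by omega⟩
      ι := Fin.castLE (by omega)
      cartan := (CartanMatrix.B n).transpose
      d := fun a => if (a : ℕ) + 1 = n then 1 else 2 }
  | .E62 =>
    { bigRank := 6
      rank := 4
      r := 2
      kappa := 1
      cartan' := CartanMatrix.E₆
      d' := fun _ => 1
      σ := Equiv.swap 0 5 * Equiv.swap 2 4
      ι := ![0, 2, 3, 1]
      cartan := CartanMatrix.F₄
      d := ![1, 1, 2, 2] }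
  | .D43 =>
    { bigRank := 4
      rank := 2
      r := 3
      kappa := 1
      cartan' := CartanMatrix.D 4
      d' := fun _ => 1
      σ := Equiv.swap 0 2 * Equiv.swap 2 3
      ι := Fin.castLE (by omega)
      cartan := CartanMatrix.G₂
      d := ![1, 3] }

namespace Datum

variable (X : Datum)

/-- The set `I_σ` of nodes of `𝔤₀` (the colors). -/
abbrev Node : Type := Fin X.rank

/-- `ε'_i`, which is `r` if `σ(i) = i` and `1` otherwise. -/
def epsI (i : Fin X.bigRank) : ℕ := if X.σ i = i then X.r else 1

/-- `ε'_a` for a color `a`. -/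
def eps' (a : X.Node) : ℕ := X.epsI (X.ι a)

/-- `d'_a` for a color `a`. -/
def dd (a : X.Node) : ℕ := X.d' (X.ι a)

/-- `ε_a`, which is `2` if `A'_{a σ(a)} < 0` and `1` otherwise. -/
def eps (a : X.Node) : ℕ := if X.cartan' (X.ι a) (X.σ (X.ι a)) < 0 then 2 else 1

/-- The index set `{1, …, ñ}`: the colors, together with one more element `n + 1 = σ(n)` over the
color `n` (the only one with `ε_a = 2`) in type `A_{2n}^{(2)}`. -/
abbrev ExtNode : Type := X.Node ⊕ {a : X.Node // X.eps a = 2}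

/-- The color from which the variables attached to an element of `{1, …, ñ}` are taken. -/
def base : X.ExtNode → X.Node
  | .inl a => a
  | .inr a => a.1

/-- The node of `𝔤` that an element of `{1, …, ñ}` stands for. -/
def node : X.ExtNode → Fin X.bigRank
  | .inl a => X.ι a
  | .inr a => X.σ (X.ι a.1)

/-- The sign in `x_j^{(n+1)} = - x_j^{(n)}`. -/
def sgn : X.ExtNode → ℂ
  | .inl _ => 1
  | .inr _ => -1

/-- `A'_{ab}` for `a ∈ {1, …, n}` and `b ∈ {1, …, ñ}`. -/
def A' (a : X.Node) (b : X.ExtNode) : ℤ := X.cartan' (X.ι a) (X.node b)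

/-- `ε'_{ab} = max (ε'_a, ε'_b)`. -/
def epsMax (a : X.Node) (b : X.ExtNode) : ℕ := max (X.eps' a) (X.epsI (X.node b))

/-- The exponent `ε'_{ab} / ε'_a` (an exact quotient). -/
def expL (a : X.Node) (b : X.ExtNode) : ℕ := X.epsMax a b / X.eps' a

/-- The exponent `ε'_{ab} / ε'_b` (an exact quotient). -/
def expR (a : X.Node) (b : X.ExtNode) : ℕ := X.epsMax a b / X.epsI (X.node b)

/-- The set `𝒩` of families `(N_m^{(a)})` of natural numbers, `a ∈ I_σ`, `m ≥ 1`, almost all of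
which are zero. -/
abbrev Pattern : Type := (X.Node × ℕ+) →₀ ℕ

variable {X}

/-! ### The Bethe equation -/

section Bethe

variable {J : Type} [Fintype J] (color : J → X.Node) (ν : X.Pattern) (x : J → ℂ → ℂ)

/-- `F_{i+}^{(a)}`, for a finite family of unknowns `x_t` with colors. -/
def Fplus (s : J) : ℂ → ℂ := fun q =>
  ∏ p ∈ ν.support with p.1 = color s,
    (x s q * q ^ ((p.2 : ℕ) * X.kappa * X.eps' (color s) * X.dd (color s)) - 1) ^ ν p

/-- `F_{i-}^{(a)}`. -/
def Fminus (s : J) : ℂ → ℂ := fun q =>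
  ∏ p ∈ ν.support with p.1 = color s,
    (x s q - q ^ ((p.2 : ℕ) * X.kappa * X.eps' (color s) * X.dd (color s))) ^ ν p

/-- The exponent `κ₀ ε'_{ab} d'_a A'_{ab}`. -/
def shift (a : X.Node) (b : X.ExtNode) : ℤ :=
  (X.kappa : ℤ) * X.epsMax a b * X.dd a * X.A' a b

/-- `G_{i+}^{(a)}`. -/
def Gplus (s : J) : ℂ → ℂ := fun q =>
  ∏ b : X.ExtNode, ∏ t : J with color t = X.base b,
    (x s q ^ X.expL (color s) b * q ^ shift (color s) b
      - (X.sgn b * x t q) ^ X.expR (color s) b)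

/-- `G_{i-}^{(a)}`. -/
def Gminus (s : J) : ℂ → ℂ := fun q =>
  ∏ b : X.ExtNode, ∏ t : J with color t = X.base b,
    (x s q ^ X.expL (color s) b
      - (X.sgn b * x t q) ^ X.expR (color s) b * q ^ shift (color s) b)

/-- The family `x` of functions, meromorphic around `q = 0`, solves the Bethe equation
`F_{i+} G_{i-} = - F_{i-} G_{i+}` near `q = 0`. -/
def IsBetheSolution : Prop :=
  (∀ s, MeromorphicAt (x s) 0) ∧
  ∀ s, ∀ᶠ q in 𝓝[≠] (0 : ℂ),
    Fplus color ν x s q * Gminus color x s q = -(Fminus color ν x s q * Gplus color x s q)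

end Bethe

/-! ### Strings -/

/-- The indices `(a, m, α)` of the strings of pattern `N`: `(a, m) ∈ H'(N)` and
`1 ≤ α ≤ N_m^{(a)}`. -/
abbrev Str (N : X.Pattern) : Type := Σ p : {p // p ∈ N.support}, Fin (N p.1)

/-- The color `a` of a string. -/
def Str.color {N : X.Pattern} (s : Str N) : X.Node := s.1.1.1

/-- The length `m` of a string. -/
def Str.len {N : X.Pattern} (s : Str N) : ℕ := (s.1.1.2 : ℕ)

/-- The indices `(a, m, α, i)` of the unknowns arranged into strings of pattern `N`; the element
`(s, i)` with `i : Fin m` is the `(i + 1)`-st entry of the `m`-string `s`. -/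
abbrev Root (N : X.Pattern) : Type := Σ s : Str N, Fin s.len

/-- The color of an unknown. -/
def Root.color {N : X.Pattern} (t : Root N) : X.Node := t.1.color

/-- `m + 1 - 2 i`, where `i` is counted from `1`. -/
def Root.level {N : X.Pattern} (t : Root N) : ℤ := (t.1.len : ℤ) + 1 - 2 * ((t.2 : ℕ) + 1)

/-- The first entry of a string. -/
def Str.first {N : X.Pattern} (s : Str N) : Root N := ⟨s, ⟨0, s.1.1.2.pos⟩⟩

/-- A meromorphic solution of the Bethe equation, arranged as `(x_{mαi}^{(a)})`, is a string
solution of pattern `N`. -/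
structure IsStringSolution (ν N : X.Pattern) (x : Root N → ℂ → ℂ) : Prop where
  bethe : IsBetheSolution Root.color ν x
  ord_finite : ∀ t, meromorphicOrderAt (Fplus Root.color ν x t * Gminus Root.color x t) 0 ≠ ⊤
  ord_eq : ∀ t : Root N, meromorphicOrderAt (x t) 0 =
    ((t.level * X.kappa * X.eps' t.color * X.dd t.color : ℤ) : WithTop ℤ)
  center_eq : ∀ t : Root N,
    meromorphicTrailingCoeffAt (x t) 0 = meromorphicTrailingCoeffAt (x t.1.first) 0

/-- The normalized series `f̃(q) = q^{-ord f} f(q)`. -/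
def normalized (f : ℂ → ℂ) : ℂ → ℂ :=
  fun q => q ^ (-(meromorphicOrderAt f 0).untop₀) * f q

/-- `ζ_{mαi}^{(a)}`, where `i` is counted from `1`: the order of `x̃_{mαi} - x̃_{mα,i-1}` for
`2 ≤ i ≤ m`, and zero for `i = 1` and `i = m + 1`. -/
def zetaOrd {N : X.Pattern} (x : Root N → ℂ → ℂ) (s : Str N) (i : ℕ) : WithTop ℤ :=
  if h : 2 ≤ i ∧ i ≤ s.len then
    meromorphicOrderAt
      (normalized (x ⟨s, ⟨i - 1, by omega⟩⟩) - normalized (x ⟨s, ⟨i - 2, by omega⟩⟩)) 0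
  else 0

/-- `ξ_{mαi+}^{(a)}`. -/
def xiPlus (ν : X.Pattern) {N : X.Pattern} (t : Root N) : ℤ :=
  X.kappa * X.eps' t.color * X.dd t.color *
    ∑ p ∈ ν.support with p.1 = t.color, (ν p : ℤ) * min (t.level + (p.2 : ℕ)) 0

/-- `ξ_{mαi-}^{(a)}`. -/
def xiMinus (ν : X.Pattern) {N : X.Pattern} (t : Root N) : ℤ :=
  X.kappa * X.eps' t.color * X.dd t.color *
    ∑ p ∈ ν.support with p.1 = t.color, (ν p : ℤ) * min t.level (p.2 : ℕ)

/-- `η_{mαi+}^{(a)}`. -/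
def etaPlus {N : X.Pattern} (t : Root N) : ℤ :=
  X.kappa * ∑ b : X.ExtNode, ∑ u : Root N with u.color = X.base b,
    (X.epsMax t.color b : ℤ) *
      min (X.dd t.color * (t.level + X.A' t.color b)) (X.d' (X.node b) * u.level)

/-- `η_{mαi-}^{(a)}`. -/
def etaMinus {N : X.Pattern} (t : Root N) : ℤ :=
  X.kappa * ∑ b : X.ExtNode, ∑ u : Root N with u.color = X.base b,
    (X.epsMax t.color b : ℤ) *
      min (X.dd t.color * t.level)
        (X.d' (X.node b) * (u.level + X.cartan' (X.node b) (X.ι t.color)))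

/-- A generic string solution of pattern `N`. -/
structure IsGenericStringSolution (ν N : X.Pattern) (x : Root N → ℂ → ℂ) : Prop where
  isString : IsStringSolution ν N x
  ord_Fplus : ∀ t, meromorphicOrderAt (Fplus Root.color ν x t) 0 = (xiPlus ν t : WithTop ℤ)
  ord_Fminus : ∀ t, meromorphicOrderAt (Fminus Root.color ν x t) 0 = (xiMinus ν t : WithTop ℤ)
  ord_Gplus : ∀ t : Root N, meromorphicOrderAt (Gplus Root.color x t) 0 =
    (etaPlus t : WithTop ℤ) + zetaOrd x t.1 ((t.2 : ℕ) + 1)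
  ord_Gminus : ∀ t : Root N, meromorphicOrderAt (Gminus Root.color x t) 0 =
    (etaMinus t : WithTop ℤ) + zetaOrd x t.1 ((t.2 : ℕ) + 2)

/-- The generic string solutions of pattern `N`, as families of germs at `0` of functions on a
punctured neighborhood of `0`. -/
def genericStringSolutions (ν N : X.Pattern) : Set (Root N → Germ (𝓝[≠] (0 : ℂ)) ℂ) :=
  {g | ∃ x : Root N → ℂ → ℂ, IsGenericStringSolution ν N x ∧ ∀ t, g t = (x t : Germ _ ℂ)}

/-- The leading coefficient of a germ at `0`. -/
def leadCoeff (g : Germ (𝓝[≠] (0 : ℂ)) ℂ) : ℂ :=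
  g.liftOn (fun f => meromorphicTrailingCoeffAt f 0)
    (fun _ _ h => meromorphicTrailingCoeffAt_congr_nhdsNE h)

/-- The string centers `z_{mα}^{(a)}` of a family of germs arranged into strings. -/
def centers {N : X.Pattern} (g : Root N → Germ (𝓝[≠] (0 : ℂ)) ℂ) : Str N → ℂ :=
  fun s => leadCoeff (g s.first)

/-! ### The string center equation -/

/-- `N_j^{(a)}` for a natural number `j` (zero for `j = 0`). -/
def mult (N : X.Pattern) (a : X.Node) (j : ℕ) : ℤ :=
  if h : 0 < j then (N (a, ⟨j, h⟩) : ℤ) else 0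

/-- `min (d'_a m, d'_b k)`. -/
def minLen (a : X.Node) (m : ℕ) (b : X.Node) (k : ℕ) : ℤ := min (X.dd a * m) (X.dd b * k)

/-- `γ_m^{(a)}`. -/
def gam (ν : X.Pattern) (a : X.Node) (m : ℕ) : ℤ :=
  ∑ p ∈ ν.support with p.1 = a, (min m (p.2 : ℕ) : ℤ) * ν p

/-- `P_m^{(a)}(ν, N)`; the quotient by `ε_a d'_b` is exact. -/
def vac (ν N : X.Pattern) (a : X.Node) (m : ℕ) : ℤ :=
  gam ν a m - ∑ p ∈ N.support,
    X.cartan a p.1 * minLen a m p.1 p.2 / (X.eps a * X.dd p.1) * N p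

/-- `P̂_m^{(a)}(ν, N)`; the quotient by `d'_b` is exact. -/
def vacHat (ν N : X.Pattern) (a : X.Node) (m : ℕ) : ℤ :=
  gam ν a m - ∑ p ∈ N.support,
    X.A' a (.inl p.1) * minLen a m p.1 p.2 / X.dd p.1 * N p

/-- `Δ_j^{(a)}`, which is zero unless `r = 1` and there is a (unique) `a'` with `A_{aa'} ≠ 0` and
`d_a > d_{a'} = 1`. -/
def Delta (N : X.Pattern) (a : X.Node) (j : ℕ) : ℤ :=
  if X.r = 1 then
    ∑ a' : X.Node with X.d a' < X.d a ∧ X.d a' = 1 ∧ X.cartan a a' ≠ 0,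
      if X.d a = 2 then -mult N a' (2 * j)
      else -(mult N a' (3 * j - 1) + 2 * mult N a' (3 * j) + mult N a' (3 * j + 1))
  else 0

/-- The genericity inequalities on the pattern `N`. -/
def GenericityCondition (ν N : X.Pattern) : Prop :=
  ∀ p ∈ N.support, ∀ i : ℕ, 2 ≤ i → i ≤ (p.2 : ℕ) →
    0 < ∑ k ∈ Finset.Icc 1 (min (i - 1) ((p.2 : ℕ) + 1 - i)),
      ((X.dd p.1 : ℤ) *
          (vac ν N p.1 ((p.2 : ℕ) + 1 - 2 * k) + mult N p.1 ((p.2 : ℕ) + 1 - 2 * k))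
        + Delta N p.1 ((p.2 : ℕ) + 1 - 2 * k))

/-- The matrix `A = (A_{amα,bkβ})`; the quotient by `ε_b d'_a` is exact. -/
def sceMatrix (ν N : X.Pattern) : Matrix (Str N) (Str N) ℤ := fun s t =>
  (if s = t then vac ν N s.color s.len + N s.1.1 else 0)
    + X.cartan t.color s.color * minLen s.color s.len t.color t.len / (X.eps t.color * X.dd s.color)
    - (if s.1 = t.1 then 1 else 0)

/-- The family `z` of nonzero complex numbers solves the string center equation. -/
def IsSCESolution (ν N : X.Pattern) (z : Str N → ℂ) : Prop :=
  (∀ s, z s ≠ 0) ∧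
  ∀ s : Str N, ∏ t, z t ^ sceMatrix ν N s t =
    (-1 : ℂ) ^ (vacHat ν N s.color s.len + N s.1.1 + 1)

/-- `⟨m⟩ = {m - 1, m - 3, …, -m + 1}`. -/
def bracket (m : ℕ) : Set ℤ := {j | ∃ i : ℕ, 1 ≤ i ∧ i ≤ m ∧ j = (m : ℤ) + 1 - 2 * i}

/-- A generic solution of the string center equation. -/
structure IsGenericSCESolution (ν N : X.Pattern) (z : Str N → ℂ) : Prop where
  sce : IsSCESolution ν N z
  ne_one : ∀ s : Str N,
    (∃ k : ℕ+, 0 < ν (s.color, k) ∧ ((k : ℕ) : ℤ) ∈ bracket s.len) → z s ≠ 1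
  ne : ∀ (s : Str N) (b : X.ExtNode) (t : Str N), t.color = X.base b →
    ¬ (b = .inl s.color ∧ s = t) →
    (∃ i ∈ bracket s.len, ∃ j ∈ bracket t.len,
      (X.dd s.color : ℤ) * X.A' s.color b = i * X.dd s.color - j * X.d' (X.node b)) →
    z s ^ X.expL s.color b ≠ (X.sgn b * z t) ^ X.expR s.color b

end Datum

end QBethe

end

noncomputable section

namespace QBethe
namespace Datum

/-- The properties of the data of an affine type on which the correspondence between string
solutions and string centers depends. -/
structure Regular (X : Datum) : Prop where
  kappa_pos : 0 < X.kappa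
  r_pos : 0 < X.r
  d'_pos : ∀ i, 0 < X.d' i
  d'_node : ∀ b, X.d' (X.node b) = X.dd (X.base b)
  epsI_node : ∀ b, X.epsI (X.node b) = X.eps' (X.base b)
  symm : ∀ a b, (X.dd a : ℤ) * X.A' a b = X.d' (X.node b) * X.cartan' (X.node b) (X.ι a)
  diag : ∀ a, X.A' a (.inl a) = 2
  offdiag : ∀ a b, b ≠ .inl a → X.A' a b = 0 ∨
    ((X.dd a : ℤ) * X.A' a b = -max (X.dd a) (X.dd (X.base b)) ∧
      (X.dd a = X.dd (X.base b) ∨ X.dd a = 1 ∧ X.dd (X.base b) ≤ 3 ∨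
        X.dd (X.base b) = 1 ∧ X.dd a ≤ 3))
  fold_left : ∀ a c, X.eps a * ((X.expL a (.inl c) : ℤ) * X.A' a (.inl c) +
    if h : X.eps c = 2 then (X.expL a (.inr ⟨c, h⟩) : ℤ) * X.A' a (.inr ⟨c, h⟩) else 0)
      = id (X.cartan a c)
  fold_right : ∀ a c, X.eps c * ((X.expR a (.inl c) : ℤ) * X.cartan' (X.ι c) (X.ι a) +
    if h : X.eps c = 2 then (X.expR a (.inr ⟨c, h⟩) : ℤ) * X.cartan' (X.σ (X.ι c)) (X.ι a) else 0)
      = id (X.cartan c a)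
  expR_inr : ∀ a c, X.expR a (.inr c) = 1
  delta_iff : ∀ a a', (X.r = 1 ∧ X.d a' < X.d a ∧ X.d a' = 1 ∧ id (X.cartan a a') ≠ 0) ↔
    X.dd a' < X.dd a ∧ X.A' a (.inl a') ≠ 0
  d_eq : X.r = 1 → ∀ a, X.d a = X.dd a
  dd_le : ∀ a c, X.eps c = 2 → X.dd a ≤ X.dd c

theorem nontwisted_regular (n : ℕ) (M : Matrix (Fin n) (Fin n) ℤ) (d : Fin n → ℕ)
    (hd : ∀ i, 0 < d i) (hdiag : ∀ i, M i i = 2)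
    (hsymm : ∀ i j, (d i : ℤ) * M i j = d j * M j i)
    (hoff : ∀ i j, j ≠ i → id (M i j) = 0 ∨ ((d i : ℤ) * M i j = -max (d i) (d j) ∧
      (d i = d j ∨ d i = 1 ∧ d j ≤ 3 ∨ d j = 1 ∧ d i ≤ 3))) :
    (nontwisted n M d).Regular := by
  have heps : ∀ a : (nontwisted n M d).Node, (nontwisted n M d).eps a = 1 := fun a =>
    if_neg (fun h : M a a < 0 => absurd h (by rw [hdiag a]; norm_num))
  have hemp : ∀ c : {a : (nontwisted n M d).Node // (nontwisted n M d).eps a = 2}, False := by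
    rintro ⟨c, hc⟩
    have := heps c
    omega
  have hI : ∀ i : Fin (nontwisted n M d).bigRank, (nontwisted n M d).epsI i = 1 := fun i => by
    simp only [epsI]
    exact if_pos rfl
  have hM : ∀ a b, (nontwisted n M d).epsMax a b = 1 := fun a b => by
    unfold epsMax eps'
    rw [hI, hI, max_self]
  have hL : ∀ a c, (nontwisted n M d).expL a c = 1 := fun a c => by
    unfold expL eps'
    rw [hM, hI]
  have hR : ∀ a c, (nontwisted n M d).expR a c = 1 := fun a c => by
    unfold expR
    rw [hM, hI]
  constructor
  · exact Nat.one_pos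
  · exact Nat.one_pos
  · exact hd
  · rintro (b | b)
    · rfl
    · exact (hemp b).elim
  · rintro (b | b)
    · rfl
    · exact (hemp b).elim
  · rintro a (b | b)
    · exact hsymm a b
    · exact (hemp b).elim
  · exact hdiag
  · rintro a (b | b) hb
    · exact hoff a b (fun h => hb (h ▸ rfl))
    · exact (hemp b).elim
  · intro a c
    rw [dif_neg (fun h => hemp ⟨c, h⟩), hL, heps]
    have : (1 : ℤ) * (1 * M a c + 0) = M a c := by ring
    exact_mod_cast this
  · intro a c
    rw [dif_neg (fun h => hemp ⟨c, h⟩), hR, heps]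
    have : (1 : ℤ) * (1 * M c a + 0) = M c a := by ring
    exact_mod_cast this
  · intro a c
    exact (hemp c).elim
  · intro a a'
    change (1 = 1 ∧ d a' < d a ∧ d a' = 1 ∧ M a a' ≠ 0) ↔ d a' < d a ∧ M a a' ≠ 0
    constructor
    · rintro ⟨-, h1, -, h2⟩
      exact ⟨h1, h2⟩
    · rintro ⟨h1, h2⟩
      refine ⟨rfl, h1, ?_, h2⟩
      have hne : a' ≠ a := by rintro rfl; omega
      have := hd a'
      rcases hoff a a' hne with h | ⟨-, h⟩
      · exact absurd h h2
      · omega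
  · intro _ a
    rfl
  · exact fun a c hc => (hemp ⟨c, hc⟩).elim

theorem A1_regular (n : ℕ) (hn : 1 ≤ n) : (AffineType.A1 n hn).datum.Regular := by
  apply nontwisted_regular
  · simp
  · simp [CartanMatrix.A]
  · intro i j; simp [CartanMatrix.A, Fin.ext_iff]; grind
  · intro i j hij; simp [CartanMatrix.A, Fin.ext_iff] at hij ⊢; grind

theorem D1_regular (n : ℕ) (hn : 4 ≤ n) : (AffineType.D1 n hn).datum.Regular := by
  apply nontwisted_regular
  · simp
  · simp
  · intro i j; simp [CartanMatrix.D, Fin.ext_iff]; grind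
  · intro i j hij; simp [CartanMatrix.D, Fin.ext_iff] at hij ⊢; grind

theorem B1_regular (n : ℕ) (hn : 3 ≤ n) : (AffineType.B1 n hn).datum.Regular := by
  apply nontwisted_regular
  · intro i; split_ifs <;> norm_num
  · simp
  · intro i j
    have := i.2
    have := j.2
    simp [CartanMatrix.B, Fin.ext_iff, -CartanMatrix.B_transpose]; grind
  · intro i j hij
    have := i.2
    have := j.2
    simp [CartanMatrix.B, Fin.ext_iff, -CartanMatrix.B_transpose] at hij ⊢; grind

theorem C1_regular (n : ℕ) (hn : 2 ≤ n) : (AffineType.C1 n hn).datum.Regular := by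
  apply nontwisted_regular
  · intro i; split_ifs <;> norm_num
  · simp
  · intro i j
    have := i.2
    have := j.2
    simp [CartanMatrix.C, Fin.ext_iff, -CartanMatrix.C_transpose]; grind
  · intro i j hij
    have := i.2
    have := j.2
    simp [CartanMatrix.C, Fin.ext_iff, -CartanMatrix.C_transpose] at hij ⊢; grind

theorem E61_regular : AffineType.E61.datum.Regular := by
  apply nontwisted_regular <;> decide

theorem E71_regular : AffineType.E71.datum.Regular := by
  apply nontwisted_regular <;> decide

theorem E81_regular : AffineType.E81.datum.Regular := by
  apply nontwisted_regular <;> decide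

theorem F41_regular : AffineType.F41.datum.Regular := by
  apply nontwisted_regular <;> decide

theorem G21_regular : AffineType.G21.datum.Regular := by
  apply nontwisted_regular <;> decide

theorem E62_regular : AffineType.E62.datum.Regular := by
  constructor <;> decide

theorem D43_regular : AffineType.D43.datum.Regular := by
  constructor <;> decide

theorem regular_of_simplyLaced {m n : ℕ} (M : Matrix (Fin m) (Fin m) ℤ)
    (σ : Equiv.Perm (Fin m)) (ι : Fin n → Fin m) (C : Matrix (Fin n) (Fin n) ℤ) (d : Fin n → ℕ)
    (e : Fin n → ℕ) (he : ∀ a, e a = if σ (ι a) = ι a then 2 else 1) (hι : Function.Injective ι)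
    (hsym : ∀ i j, M i j = M j i) (hdiag : ∀ i, M i i = 2)
    (hoff : ∀ i j, j ≠ i → id (M i j) = 0 ∨ id (M i j) = -1)
    (hσ : ∀ a, 0 ≤ M (ι a) (σ (ι a)))
    (hfold : ∀ a c, ((max (e a) (e c) / e a : ℕ) : ℤ) * M (ι a) (ι c) = id (C a c)) :
    (⟨m, n, 2, 1, M, fun _ => 1, σ, ι, C, d⟩ : Datum).Regular := by
  set X : Datum := ⟨m, n, 2, 1, M, fun _ => 1, σ, ι, C, d⟩ with hX
  have heps : ∀ a : X.Node, X.eps a = 1 := fun a =>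
    if_neg (fun h : M (ι a) (σ (ι a)) < 0 => absurd (hσ a) (not_le.mpr h))
  have hemp : ∀ c : {a : X.Node // X.eps a = 2}, False := by
    rintro ⟨c, hc⟩
    have := heps c
    omega
  have he' : ∀ a : X.Node, X.eps' a = e a := fun a => (he a).symm
  have hM : ∀ a c, X.epsMax a (.inl c) = max (e a) (e c) := fun a c => by
    have : X.epsMax a (.inl c) = max (X.eps' a) (X.eps' c) := rfl
    rw [this, he', he']
  have hL : ∀ a c, X.expL a (.inl c) = max (e a) (e c) / e a := fun a c => by
    unfold expL
    rw [hM, he']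
  have hR : ∀ a c, X.expR a (.inl c) = max (e a) (e c) / e c := fun a c => by
    have : X.expR a (.inl c) = X.epsMax a (.inl c) / X.eps' c := rfl
    rw [this, hM, he']
  constructor
  · exact Nat.one_pos
  · exact Nat.two_pos
  · exact fun _ => Nat.one_pos
  · rintro (b | b)
    · rfl
    · rfl
  · rintro (b | b)
    · rfl
    · exact (hemp b).elim
  · intro a b
    have := hsym (ι a) (X.node b)
    exact congrArg (fun t : ℤ => ((1 : ℕ) : ℤ) * t) this
  · exact fun a => hdiag (ι a)
  · rintro a (b | b) hb
    · rcases hoff (ι a) (ι b) (fun h => hb (by rw [hι h])) with h | h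
      · exact Or.inl h
      · refine Or.inr ⟨?_, Or.inl rfl⟩
        change ((1 : ℕ) : ℤ) * id (M (ι a) (ι b)) = -((max 1 1 : ℕ) : ℤ)
        rw [h]
        norm_num
    · exact (hemp b).elim
  · intro a c
    rw [dif_neg (fun h => hemp ⟨c, h⟩), hL, heps]
    refine Eq.trans ?_ (hfold a c)
    rw [Nat.cast_one, one_mul, add_zero]
    rfl
  · intro a c
    rw [dif_neg (fun h => hemp ⟨c, h⟩), hR, heps, max_comm]
    refine Eq.trans ?_ (hfold c a)
    rw [Nat.cast_one, one_mul, add_zero]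
  · exact fun a c => (hemp c).elim
  · intro a a'
    change (2 = 1 ∧ _) ↔ (1 < 1 ∧ _)
    simp
  · intro h
    exact absurd h (by norm_num [hX])
  · exact fun _ _ _ => le_refl 1

theorem A2odd_regular (n : ℕ) (hn : 2 ≤ n) : (AffineType.A2odd n hn).datum.Regular := by
  refine regular_of_simplyLaced (CartanMatrix.A (2 * n - 1)) Fin.revPerm
    (Fin.castLE (by omega) : Fin n → Fin (2 * n - 1)) (CartanMatrix.C n).transpose _
    (fun a => if (a : ℕ) + 1 = n then 2 else 1) ?_ (Fin.castLE_injective _) ?_ ?_ ?_ ?_ ?_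
  · intro a
    have := a.2
    simp only [Fin.revPerm_apply, Fin.ext_iff, Fin.val_rev, Fin.val_castLE]
    congr 1
    apply propext
    omega
  · intro i j; simp [CartanMatrix.A, Fin.ext_iff]; grind
  · intro i; simp [CartanMatrix.A]
  · intro i j hij; simp [CartanMatrix.A, Fin.ext_iff] at hij ⊢; grind
  · intro a
    have := a.2
    simp only [CartanMatrix.A, Matrix.of_apply, Fin.revPerm_apply, Fin.ext_iff, Fin.val_rev,
      Fin.val_castLE]
    split_ifs <;> omega
  · intro a c
    have := a.2
    have := c.2
    simp only [CartanMatrix.A, CartanMatrix.C, Matrix.transpose_apply, Matrix.of_apply,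
      Fin.ext_iff, Fin.val_castLE, id]
    split_ifs <;> omega

theorem D2_regular (n : ℕ) (hn : 2 ≤ n) : (AffineType.D2 n hn).datum.Regular := by
  refine regular_of_simplyLaced (CartanMatrix.D (n + 1))
    (Equiv.swap ⟨n - 1, by omega⟩ ⟨n, by omega⟩)
    (Fin.castLE (by omega) : Fin n → Fin (n + 1)) (CartanMatrix.B n).transpose _
    (fun a => if (a : ℕ) + 1 = n then 1 else 2) ?_ (Fin.castLE_injective _) ?_ ?_ ?_ ?_ ?_
  · intro a
    have := a.2
    simp only [Equiv.swap_apply_def, Fin.ext_iff, Fin.val_castLE, apply_ite Fin.val]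
    split_ifs <;> omega
  · intro i j; simp [CartanMatrix.D, Fin.ext_iff]; grind
  · intro i; simp
  · intro i j hij; simp [CartanMatrix.D, Fin.ext_iff] at hij ⊢; grind
  · intro a
    have := a.2
    simp only [CartanMatrix.D, Matrix.of_apply, Equiv.swap_apply_def, Fin.ext_iff,
      Fin.val_castLE, apply_ite Fin.val]
    split_ifs <;> omega
  · intro a c
    have := a.2
    have := c.2
    simp only [CartanMatrix.B, CartanMatrix.D, Matrix.transpose_apply, Matrix.of_apply,
      Fin.ext_iff, Fin.val_castLE, id]
    split_ifs <;> omega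

theorem regular_of_simplyLaced_of_fixedPointFree {m n : ℕ} (M : Matrix (Fin m) (Fin m) ℤ)
    (σ : Equiv.Perm (Fin m)) (ι : Fin n → Fin m) (C : Matrix (Fin n) (Fin n) ℤ) (d : Fin n → ℕ)
    (e : Fin n → ℕ) (he : ∀ a, e a = if M (ι a) (σ (ι a)) < 0 then 2 else 1)
    (hσ : ∀ i, σ i ≠ i) (hι : Function.Injective ι) (hσι : ∀ a c, σ (ι c) ≠ ι a)
    (hsym : ∀ i j, M i j = M j i) (hdiag : ∀ i, M i i = 2)
    (hoff : ∀ i j, j ≠ i → id (M i j) = 0 ∨ id (M i j) = -1)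
    (hleft : ∀ a c, (e a : ℤ) * (M (ι a) (ι c) + if e c = 2 then M (ι a) (σ (ι c)) else 0)
      = id (C a c))
    (hright : ∀ a c, (e c : ℤ) * (M (ι c) (ι a) + if e c = 2 then M (σ (ι c)) (ι a) else 0)
      = id (C c a)) :
    (⟨m, n, 2, 2, M, fun _ => 1, σ, ι, C, d⟩ : Datum).Regular := by
  set X : Datum := ⟨m, n, 2, 2, M, fun _ => 1, σ, ι, C, d⟩ with hX
  have heps : ∀ a : X.Node, X.eps a = e a := fun a => (he a).symm
  have hI : ∀ i : Fin X.bigRank, X.epsI i = 1 := fun i => if_neg (hσ i)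
  have hE : ∀ a b, X.epsMax a b = 1 := fun a b => by
    unfold epsMax eps'
    rw [hI, hI, max_self]
  have hL : ∀ a c, X.expL a c = 1 := fun a c => by
    unfold expL eps'
    rw [hE, hI]
  have hR : ∀ a c, X.expR a c = 1 := fun a c => by
    unfold expR
    rw [hE, hI]
  constructor
  · exact Nat.two_pos
  · exact Nat.two_pos
  · exact fun _ => Nat.one_pos
  · exact fun b => rfl
  · intro b
    unfold eps'
    rw [hI, hI]
  · intro a b
    have := hsym (ι a) (X.node b)
    exact congrArg (fun t : ℤ => ((1 : ℕ) : ℤ) * t) this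
  · exact fun a => hdiag (ι a)
  · intro a b hb
    have hne : X.node b ≠ ι a := by
      rcases b with b | b
      · exact fun h => hb (by rw [hι h])
      · exact hσι a b.1
    rcases hoff (ι a) (X.node b) hne with h | h
    · exact Or.inl h
    · refine Or.inr ⟨?_, Or.inl rfl⟩
      change ((1 : ℕ) : ℤ) * id (M (ι a) (X.node b)) = -((max 1 1 : ℕ) : ℤ)
      rw [h]
      norm_num
  · intro a c
    refine Eq.trans ?_ (hleft a c)
    simp only [hL, heps, Nat.cast_one, one_mul]
    rfl
  · intro a c
    refine Eq.trans ?_ (hright a c)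
    simp only [hR, heps, Nat.cast_one, one_mul, dite_eq_ite]
    rfl
  · exact fun a c => hR a _
  · intro a a'
    change (2 = 1 ∧ _) ↔ (1 < 1 ∧ _)
    simp
  · intro h
    exact absurd h (by norm_num [hX])
  · exact fun _ _ _ => le_refl 1

theorem A2even_regular (n : ℕ) (hn : 1 ≤ n) : (AffineType.A2even n hn).datum.Regular := by
  refine regular_of_simplyLaced_of_fixedPointFree (CartanMatrix.A (2 * n)) Fin.revPerm
    (Fin.castLE (by omega) : Fin n → Fin (2 * n)) (CartanMatrix.B n).transpose _
    (fun a => if (a : ℕ) + 1 = n then 2 else 1) ?_ ?_ (Fin.castLE_injective _) ?_ ?_ ?_ ?_ ?_ ?_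
  · intro a
    have := a.2
    simp only [CartanMatrix.A, Matrix.of_apply, Fin.revPerm_apply, Fin.ext_iff, Fin.val_rev,
      Fin.val_castLE]
    split_ifs <;> omega
  · intro i
    have := i.2
    simp only [Fin.revPerm_apply, ne_eq, Fin.ext_iff, Fin.val_rev]
    omega
  · intro a c
    have := a.2
    have := c.2
    simp only [Fin.revPerm_apply, ne_eq, Fin.ext_iff, Fin.val_rev, Fin.val_castLE]
    omega
  · intro i j; simp [CartanMatrix.A, Fin.ext_iff]; grind
  · intro i; simp [CartanMatrix.A]
  · intro i j hij; simp [CartanMatrix.A, Fin.ext_iff] at hij ⊢; grind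
  · intro a c
    have := a.2
    have := c.2
    simp only [CartanMatrix.A, CartanMatrix.B, Matrix.transpose_apply, Matrix.of_apply,
      Fin.revPerm_apply, Fin.ext_iff, Fin.val_rev, Fin.val_castLE, id]
    split_ifs <;> omega
  · intro a c
    have := a.2
    have := c.2
    simp only [CartanMatrix.A, CartanMatrix.B, Matrix.transpose_apply, Matrix.of_apply,
      Fin.revPerm_apply, Fin.ext_iff, Fin.val_rev, Fin.val_castLE, id]
    split_ifs <;> omega

end Datum

theorem AffineType.regular (T : AffineType) : T.datum.Regular := by
  cases T with
  | A1 n hn => exact Datum.A1_regular n hn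
  | B1 n hn => exact Datum.B1_regular n hn
  | C1 n hn => exact Datum.C1_regular n hn
  | D1 n hn => exact Datum.D1_regular n hn
  | E61 => exact Datum.E61_regular
  | E71 => exact Datum.E71_regular
  | E81 => exact Datum.E81_regular
  | F41 => exact Datum.F41_regular
  | G21 => exact Datum.G21_regular
  | A2even n hn => exact Datum.A2even_regular n hn
  | A2odd n hn => exact Datum.A2odd_regular n hn
  | D2 n hn => exact Datum.D2_regular n hn
  | E62 => exact Datum.E62_regular
  | D43 => exact Datum.D43_regular

end QBethe

namespace QBethe

/-! ### Sums over levels of strings -/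

/-- The truncation of `x` to the interval `[-c, c]`. -/
def clamp (c x : ℤ) : ℤ := max (-c) (min c x)

/-- The `i`-th element of `⟨m⟩`, in decreasing order. -/
def lvl (m : ℕ) (i : Fin m) : ℤ := (m : ℤ) + 1 - 2 * ((i : ℕ) + 1)

theorem clamp_neg {c : ℤ} (hc : 0 ≤ c) (x : ℤ) : clamp c (-x) = -clamp c x := by
  unfold clamp; omega

theorem sign_eq_clamp (x : ℤ) : x.sign = clamp 1 x := by
  unfold clamp
  rcases lt_trichotomy x 0 with h | h | h
  · rw [Int.sign_eq_neg_one_of_neg h]; omega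
  · subst h; rfl
  · rw [Int.sign_eq_one_of_pos h]; omega

theorem sum_lvl (m : ℕ) (f : ℤ → ℤ) :
    ∑ i : Fin m, f (lvl m i) = ∑ i ∈ Finset.range m, f ((m : ℤ) - 1 - 2 * (i : ℕ)) := by
  rw [← Fin.sum_univ_eq_sum_range (fun i : ℕ => f ((m : ℤ) - 1 - 2 * (i : ℕ)))]
  refine Finset.sum_congr rfl fun i _ => ?_
  congr 1
  unfold lvl
  ring

theorem lvl_rev {m : ℕ} (i : Fin m) : lvl m i.rev = -lvl m i := by
  unfold lvl
  rw [Fin.val_rev]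
  have := i.2
  push_cast [Nat.sub_add_cancel, show (i : ℕ) + 1 ≤ m from this]
  ring

theorem sum_lvl_neg (m : ℕ) (f : ℤ → ℤ) :
    ∑ i : Fin m, f (-lvl m i) = ∑ i : Fin m, f (lvl m i) := by
  refine Fintype.sum_equiv Fin.revPerm _ _ fun i => ?_
  rw [Fin.revPerm_apply, lvl_rev]

theorem sum_range_clamp (d : ℤ) (hd : 0 ≤ d) (k : ℕ) (y : ℤ) :
    ∑ j ∈ Finset.range k, clamp d (y - 2 * d * j) = clamp (d * k) (y - d * (k - 1)) := by
  induction k with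
  | zero => simp [clamp]
  | succ k ih =>
    rw [Finset.sum_range_succ, ih]
    have h0 : 0 ≤ d * k := by positivity
    have e1 : d * ((k : ℤ) - 1) = d * k - d := by ring
    have e2 : 2 * d * (k : ℤ) = 2 * (d * k) := by ring
    have e3 : d * ((k + 1 : ℕ) : ℤ) = d * k + d := by push_cast; ring
    have e4 : d * (((k + 1 : ℕ) : ℤ) - 1) = d * k := by push_cast; ring
    rw [e1, e2, e3, e4]
    generalize d * (k : ℤ) = t at *
    unfold clamp
    omega

theorem sum_clamp_sub_lvl (d : ℤ) (hd : 0 ≤ d) (k : ℕ) (x : ℤ) :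
    ∑ j : Fin k, clamp d (x - d * lvl k j) = clamp (d * k) x := by
  rw [← sum_lvl_neg k (fun l => clamp d (x - d * l)), sum_lvl k (fun l => clamp d (x - d * -l)),
    ← congrArg (clamp (d * k)) (show (x + d * (k - 1)) - d * ((k : ℤ) - 1) = x by ring),
    ← sum_range_clamp d hd]
  refine Finset.sum_congr rfl fun j _ => ?_
  congr 1
  ring

theorem sum_sign_sub_lvl (k : ℕ) (x : ℤ) : ∑ j : Fin k, (x - lvl k j).sign = clamp k x := by
  have := sum_clamp_sub_lvl 1 zero_le_one k x
  simpa only [sign_eq_clamp, one_mul] using this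

theorem sum_sign_add_lvl (k : ℕ) (x : ℤ) : ∑ j : Fin k, (lvl k j + x).sign = clamp k x := by
  rw [← sum_sign_sub_lvl k x, ← sum_lvl_neg k (fun l => (x - l).sign)]
  refine Finset.sum_congr rfl fun j _ => ?_
  congr 1
  ring

theorem sum_range_odd (g : ℤ → ℤ) (hg : ∀ x, g (-x) = -g x) (k : ℕ) :
    ∑ j ∈ Finset.range (k + 1), g ((k : ℤ) - 2 * j) = 0 := by
  have h := Finset.sum_range_reflect (fun j : ℕ => g ((k : ℤ) - 2 * j)) (k + 1)
  have h2 : ∑ j ∈ Finset.range (k + 1), g ((k : ℤ) - 2 * ((k + 1 - 1 - j : ℕ) : ℤ)) =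
      -∑ j ∈ Finset.range (k + 1), g ((k : ℤ) - 2 * j) := by
    rw [← Finset.sum_neg_distrib]
    refine Finset.sum_congr rfl fun j hj => ?_
    rw [Finset.mem_range] at hj
    rw [← hg]
    congr 1
    omega
  rw [h2] at h
  omega

theorem sum_lvl_add_one (g : ℤ → ℤ) (hg : ∀ x, g (-x) = -g x) (k : ℕ) :
    ∑ j : Fin k, g (lvl k j + 1) = g k := by
  have h := sum_range_odd g hg k
  rw [Finset.sum_range_succ] at h
  rw [sum_lvl k (fun l => g (l + 1))]
  have e : ∀ j ∈ Finset.range k, g ((k : ℤ) - 1 - 2 * j + 1) = g ((k : ℤ) - 2 * j) := by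
    intro j _
    congr 1
    ring
  rw [Finset.sum_congr rfl e]
  have e2 : g ((k : ℤ) - 2 * k) = -g k := by
    rw [← hg]; congr 1; ring
  omega

theorem sum_lvl_add_two (g : ℤ → ℤ) (hg : ∀ x, g (-x) = -g x) (k : ℕ) :
    ∑ j : Fin k, g (lvl k j + 2) = g (k + 1) + g (k - 1) := by
  have h := sum_range_odd g hg (k + 1)
  rw [Finset.sum_range_succ, Finset.sum_range_succ] at h
  rw [sum_lvl k (fun l => g (l + 2))]
  have e : ∀ j ∈ Finset.range k, g ((k : ℤ) - 1 - 2 * j + 2) = g (((k + 1 : ℕ) : ℤ) - 2 * j) := by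
    intro j _
    congr 1
    push_cast
    ring
  rw [Finset.sum_congr rfl e]
  have e2 : g (((k + 1 : ℕ) : ℤ) - 2 * k) = -g (k - 1) := by
    rw [← hg]; congr 1; push_cast; ring
  have e3 : g (((k + 1 : ℕ) : ℤ) - 2 * (k + 1 : ℕ)) = -g (k + 1) := by
    rw [← hg]; congr 1; push_cast; ring
  omega

/-! ### Sign sums over pairs of strings -/

theorem sign_sum_diag (d : ℤ) (hd : 0 < d) (m k : ℕ) (hm : 0 < m) :
    ∑ i : Fin m, ∑ j : Fin k, (d * lvl m i - d * lvl k j + d * 2).sign =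
      2 * min (m : ℤ) k - if m = k then 1 else 0 := by
  have e : ∀ i : Fin m, ∑ j : Fin k, (d * lvl m i - d * lvl k j + d * 2).sign =
      clamp k (lvl m i + 2) := by
    intro i
    rw [← sum_sign_sub_lvl]
    refine Finset.sum_congr rfl fun j _ => ?_
    rw [show d * lvl m i - d * lvl k j + d * 2 = d * (lvl m i + 2 - lvl k j) by ring,
      Int.sign_mul, Int.sign_eq_one_of_pos hd, one_mul]
  rw [Finset.sum_congr rfl fun i _ => e i,
    sum_lvl_add_two (clamp k) (clamp_neg (Int.natCast_nonneg k))]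
  unfold clamp
  split_ifs <;> omega

theorem sign_sum_of_one_left (d : ℤ) (hd : 0 < d) (m k : ℕ) :
    ∑ i : Fin m, ∑ j : Fin k, (lvl m i - d * lvl k j - d).sign = -min (m : ℤ) (d * k) := by
  rw [Finset.sum_comm]
  have e : ∀ j : Fin k, ∑ i : Fin m, (lvl m i - d * lvl k j - d).sign =
      -clamp m (d * (lvl k j + 1)) := by
    intro j
    rw [← clamp_neg (Int.natCast_nonneg m), ← sum_sign_add_lvl]
    refine Finset.sum_congr rfl fun i _ => ?_
    congr 1
    ring
  rw [Finset.sum_congr rfl fun j _ => e j, Finset.sum_neg_distrib,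
    sum_lvl_add_one (fun x => clamp m (d * x)) (fun x => by
      rw [mul_neg, clamp_neg (Int.natCast_nonneg m)])]
  have : 0 ≤ d * k := by positivity
  unfold clamp
  omega

theorem sign_sum_of_one_right (d : ℤ) (hd : 0 < d) (m k : ℕ) :
    ∑ i : Fin m, ∑ j : Fin k, (d * lvl m i - lvl k j - d).sign = -min (d * m) (k : ℤ) := by
  have h := sign_sum_of_one_left d hd k m
  rw [Finset.sum_comm, min_comm] at h
  rw [← h]
  rw [← sum_lvl_neg m (fun l => ∑ j : Fin k, (d * l - lvl k j - d).sign),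
    ]
  refine Finset.sum_congr rfl fun i _ => ?_
  rw [← sum_lvl_neg k (fun l => (d * -lvl m i - l - d).sign)]
  refine Finset.sum_congr rfl fun j _ => ?_
  congr 1
  ring

theorem sign_sum_zero (c d : ℤ) (m k : ℕ) :
    ∑ i : Fin m, ∑ j : Fin k, (c * lvl m i - d * lvl k j).sign = 0 := by
  have h : ∑ i : Fin m, ∑ j : Fin k, (c * lvl m i - d * lvl k j).sign =
      -∑ i : Fin m, ∑ j : Fin k, (c * lvl m i - d * lvl k j).sign := by
    conv_lhs => rw [← sum_lvl_neg m (fun l => ∑ j : Fin k, (c * l - d * lvl k j).sign)]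
    rw [← Finset.sum_neg_distrib]
    refine Finset.sum_congr rfl fun i _ => ?_
    rw [← sum_lvl_neg k (fun l => (c * -lvl m i - d * l).sign), ← Finset.sum_neg_distrib]
    refine Finset.sum_congr rfl fun j _ => ?_
    rw [← Int.sign_neg]
    congr 1
    ring
  omega

/-! ### Sums of differences of orders -/

/-- The difference of the expected orders of two matching factors. -/
def ordDiff (B u v : ℤ) : ℤ := min (u + B) v - min u (v + B)

theorem ordDiff_neg (B u v : ℤ) : ordDiff B (-u) (-v) = -ordDiff B u v := by
  unfold ordDiff; omega

theorem ordDiff_of_nonneg {D : ℤ} (hD : 0 ≤ D) (u v : ℤ) : ordDiff (-D) u v = clamp D (u - v) := by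
  unfold ordDiff clamp; omega

theorem ordDiff_sum_zero (c d l : ℤ) (k : ℕ) :
    ∑ j : Fin k, ordDiff 0 (c * l) (d * lvl k j) = 0 := by
  refine Finset.sum_eq_zero fun j _ => ?_
  unfold ordDiff; omega

theorem ordDiff_sum_diag (d : ℤ) (hd : 0 < d) (l : ℤ) (hl : 1 ≤ l) (k : ℕ) :
    ∑ j : Fin k, ordDiff (d * 2) (d * l) (d * lvl k j) =
      -d * (2 * min l k) + d * if l = k then 1 else 0 := by
  have e : ∀ j : Fin k, ordDiff (d * 2) (d * l) (d * lvl k j) =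
      -d * ((l + 1 - lvl k j).sign + (l - 1 - lvl k j).sign) := by
    intro j
    have h1 : ordDiff (d * 2) (d * l) (d * lvl k j) = d * ordDiff 2 l (lvl k j) := by
      unfold ordDiff
      rw [mul_sub, mul_min_of_nonneg _ _ hd.le, mul_min_of_nonneg _ _ hd.le, mul_add, mul_add]
    rw [h1, neg_mul, ← mul_neg, sign_eq_clamp, sign_eq_clamp]
    congr 1
    unfold ordDiff clamp
    omega
  rw [Finset.sum_congr rfl fun j _ => e j, ← Finset.mul_sum, Finset.sum_add_distrib,
    sum_sign_sub_lvl, sum_sign_sub_lvl, neg_mul, neg_mul, ← mul_neg, ← mul_neg, ← mul_add]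
  congr 1
  unfold clamp
  split_ifs <;> omega

theorem ordDiff_sum_of_one_left (d : ℤ) (hd : 0 < d) (l : ℤ) (hl : 1 ≤ l) (k : ℕ) :
    ∑ j : Fin k, ordDiff (-d) l (d * lvl k j) = min l (d * k) := by
  simp only [ordDiff_of_nonneg hd.le]
  rw [sum_clamp_sub_lvl d hd.le]
  have : 0 ≤ d * k := by positivity
  unfold clamp
  omega

theorem ordDiff_sum_of_eq (d : ℤ) (hd : 0 < d) (l : ℤ) (hl : 1 ≤ l) (k : ℕ) :
    ∑ j : Fin k, ordDiff (-d) (d * l) (d * lvl k j) = d * min l k := by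
  simp only [ordDiff_of_nonneg hd.le]
  rw [sum_clamp_sub_lvl d hd.le, mul_min_of_nonneg _ _ hd.le]
  have : 0 ≤ d * k := by positivity
  have : 0 ≤ d * l := by positivity
  unfold clamp
  omega

theorem ordDiff_sum_two_one (l : ℤ) (hl : 1 ≤ l) (k : ℕ) :
    ∑ j : Fin k, ordDiff (-2) (2 * l) (lvl k j) =
      2 * min (2 * l) k - if (k : ℤ) = 2 * l then 1 else 0 := by
  have e : ∀ j : Fin k, ordDiff (-2) (2 * l) (lvl k j) =
      (2 * l + 1 - lvl k j).sign + (2 * l - 1 - lvl k j).sign := by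
    intro j
    rw [sign_eq_clamp, sign_eq_clamp]
    unfold ordDiff clamp
    omega
  rw [Finset.sum_congr rfl fun j _ => e j, Finset.sum_add_distrib, sum_sign_sub_lvl,
    sum_sign_sub_lvl]
  unfold clamp
  split_ifs <;> omega

theorem ordDiff_sum_three_one (l : ℤ) (hl : 1 ≤ l) (k : ℕ) :
    ∑ j : Fin k, ordDiff (-3) (3 * l) (lvl k j) =
      3 * min (3 * l) k - ((if (k : ℤ) = 3 * l - 1 then 1 else 0) +
        2 * (if (k : ℤ) = 3 * l then 1 else 0) + if (k : ℤ) = 3 * l + 1 then 1 else 0) := by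
  have e : ∀ j : Fin k, ordDiff (-3) (3 * l) (lvl k j) =
      (3 * l + 2 - lvl k j).sign + (3 * l - lvl k j).sign + (3 * l - 2 - lvl k j).sign := by
    intro j
    rw [sign_eq_clamp, sign_eq_clamp, sign_eq_clamp]
    unfold ordDiff clamp
    omega
  rw [Finset.sum_congr rfl fun j _ => e j, Finset.sum_add_distrib, Finset.sum_add_distrib,
    sum_sign_sub_lvl, sum_sign_sub_lvl, sum_sign_sub_lvl]
  unfold clamp
  split_ifs <;> omega

end QBethe

namespace QBethe
namespace Datum
variable {X : Datum}

/-! ### Reindexing sums and products over roots -/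

@[to_additive]
theorem prod_base {M : Type*} [CommMonoid M] (c : X.Node) (f : X.ExtNode → M) :
    ∏ b with X.base b = c, f b = f (.inl c) * if h : X.eps c = 2 then f (.inr ⟨c, h⟩) else 1 := by
  rw [Finset.prod_filter, Fintype.prod_sum_type]
  congr 1
  · rw [Finset.prod_eq_single c]
    · exact if_pos rfl
    · intro b _ hb
      exact if_neg hb
    · simp
  · split_ifs with h
    · rw [Finset.prod_eq_single ⟨c, h⟩]
      · exact if_pos rfl
      · intro b _ hb
        exact if_neg (fun h' => hb (Subtype.ext h'))
      · simp
    · refine Finset.prod_eq_one fun b _ => if_neg ?_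
      rintro rfl
      exact h b.2

@[to_additive]
theorem prod_ext_root {M : Type*} [CommMonoid M] {N : X.Pattern}
    (f : X.ExtNode → Root N → M) :
    ∏ b : X.ExtNode, ∏ u : Root N with u.color = X.base b, f b u =
      ∏ s : Str N, ∏ b with X.base b = s.color, ∏ j : Fin s.len, f b ⟨s, j⟩ := by
  simp_rw [Finset.prod_filter]
  rw [Finset.prod_comm]
  rw [Fintype.prod_sigma]
  refine Finset.prod_congr rfl fun s _ => ?_
  rw [Finset.prod_comm]
  refine Finset.prod_congr rfl fun b _ => ?_
  split_ifs with h
  · refine Finset.prod_congr rfl fun j _ => if_pos h.symm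
  · exact Finset.prod_eq_one fun j _ => if_neg (fun h' => h h'.symm)

theorem sum_str (N : X.Pattern) (g : X.Node → ℕ → ℤ) :
    ∑ s : Str N, g s.color s.len = ∑ p ∈ N.support, g p.1 p.2 * N p := by
  rw [Fintype.sum_sigma (fun s : Str N => g s.color s.len),
    ← Finset.sum_coe_sort N.support (fun p => g p.1 p.2 * (N p : ℤ))]
  refine Finset.sum_congr rfl fun p _ => ?_
  change ∑ _ : Fin (N p.1), g p.1.1 p.1.2 = _
  rw [Finset.sum_const, Finset.card_univ, Fintype.card_fin, nsmul_eq_mul, mul_comm]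

theorem sum_str_ite (N : X.Pattern) (a : X.Node) (j : ℕ) :
    ∑ s : Str N, (if s.color = a ∧ s.len = j then (1 : ℤ) else 0) = mult N a j := by
  rw [sum_str N (fun c k => if c = a ∧ k = j then (1 : ℤ) else 0)]
  unfold mult
  split_ifs with h
  · rw [Finset.sum_eq_single (a, ⟨j, h⟩)]
    · simp
    · rintro ⟨c, k⟩ _ hne
      rw [if_neg, zero_mul]
      rintro ⟨h1, h2⟩
      exact hne (Prod.ext h1 (PNat.eq h2))
    · intro hp
      rw [Finsupp.notMem_support_iff] at hp
      rw [hp]; simp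
  · refine Finset.sum_eq_zero fun p _ => ?_
    rw [if_neg, zero_mul]
    rintro ⟨-, h2⟩
    exact h (h2 ▸ p.2.pos)

/-! ### The pairing between colored lengths -/

/-- `A'_{ab} min (d'_a m, d'_b k) / d'_b`. -/
def pairing (a : X.Node) (m : ℕ) (b : X.ExtNode) (k : ℕ) : ℤ :=
  X.A' a b * minLen a m (X.base b) k / X.dd (X.base b)

namespace Regular

variable (hX : X.Regular)
include hX

theorem dd_pos (a : X.Node) : 0 < (X.dd a : ℤ) := by exact_mod_cast hX.d'_pos _

theorem eps'_pos (a : X.Node) : 0 < (X.eps' a : ℤ) := by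
  have := hX.r_pos
  unfold eps' epsI
  split_ifs <;> omega

theorem pairing_eq {a : X.Node} {m : ℕ} {b : X.ExtNode} {k : ℕ} {p : ℤ}
    (h : X.A' a b * minLen a m (X.base b) k = X.dd (X.base b) * p) : pairing a m b k = p := by
  rw [pairing, h, Int.mul_ediv_cancel_left _ (hX.dd_pos _).ne']

/-- The case distinction on pairs of nodes. -/
theorem cases_node (a : X.Node) (b : X.ExtNode) :
    (b = .inl a ∧ X.A' a b = 2) ∨ (b ≠ .inl a ∧ X.A' a b = 0) ∨
    (b ≠ .inl a ∧ (X.A' a b = -1 ∧ X.dd a = X.dd (X.base b) ∨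
      X.A' a b = -(X.dd (X.base b)) ∧ X.dd a = 1 ∨
      X.A' a b = -1 ∧ X.dd (X.base b) = 1 ∧ (X.dd a = 2 ∨ X.dd a = 3))) := by
  by_cases hb : b = .inl a
  · exact Or.inl ⟨hb, hb ▸ hX.diag a⟩
  rcases hX.offdiag a b hb with h | ⟨h, hd⟩
  · exact Or.inr (Or.inl ⟨hb, h⟩)
  · refine Or.inr (Or.inr ⟨hb, ?_⟩)
    have ha := hX.dd_pos a
    have hb := hX.dd_pos (X.base b)
    rcases hd with hd | ⟨hd, -⟩ | ⟨hd, hd'⟩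
    · left
      rw [hd, max_self] at h
      refine ⟨?_, hd⟩
      have : (X.dd (X.base b) : ℤ) * X.A' a b = X.dd (X.base b) * (-1) := by rw [h]; ring
      exact mul_left_cancel₀ hb.ne' this
    · right; left
      rw [hd, max_eq_right (by exact_mod_cast hb)] at h
      exact ⟨by simpa using h, hd⟩
    · rw [hd, max_eq_left (by exact_mod_cast ha)] at h
      have : (X.dd a : ℤ) * X.A' a b = X.dd a * (-1) := by rw [h]; ring
      have h1 := mul_left_cancel₀ ha.ne' this
      have : X.dd a = 1 ∨ X.dd a = 2 ∨ X.dd a = 3 := by omega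
      rcases this with h2 | h2
      · exact Or.inl ⟨h1, by rw [hd, h2]⟩
      · exact Or.inr (Or.inr ⟨h1, hd, h2⟩)

theorem pairing_spec (a : X.Node) (m : ℕ) (b : X.ExtNode) (k : ℕ) :
    (X.dd (X.base b) : ℤ) * pairing a m b k = X.A' a b * minLen a m (X.base b) k := by
  suffices h : ∃ p : ℤ, X.A' a b * minLen a m (X.base b) k = X.dd (X.base b) * p by
    obtain ⟨p, hp⟩ := h
    rw [hX.pairing_eq hp, hp]
  rcases hX.cases_node a b with ⟨rfl, h⟩ | ⟨-, h⟩ | ⟨-, ⟨h, hd⟩ | ⟨h, hd⟩ | ⟨h, hd, -⟩⟩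
  · refine ⟨2 * min (m : ℤ) k, ?_⟩
    change _ = (X.dd a : ℤ) * _
    rw [h, minLen]
    change 2 * min ((X.dd a : ℤ) * m) ((X.dd a : ℤ) * k) = _
    rw [← mul_min_of_nonneg _ _ (hX.dd_pos a).le]
    ring
  · exact ⟨0, by rw [h]; ring⟩
  · refine ⟨-min (m : ℤ) k, ?_⟩
    rw [h, minLen, hd, ← mul_min_of_nonneg _ _ (hX.dd_pos _).le]
    ring
  · exact ⟨-minLen a m (X.base b) k, by rw [h]; ring⟩
  · exact ⟨-minLen a m (X.base b) k, by rw [h, hd]; push_cast; ring⟩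

theorem sign_sum (a : X.Node) (m : ℕ) (hm : 0 < m) (b : X.ExtNode) (k : ℕ) :
    ∑ i : Fin m, ∑ j : Fin k,
      (X.dd a * lvl m i - X.dd (X.base b) * lvl k j + X.dd a * X.A' a b).sign =
      pairing a m b k - if b = .inl a ∧ m = k then 1 else 0 := by
  have hda := hX.dd_pos a
  have hdb := hX.dd_pos (X.base b)
  rcases hX.cases_node a b with ⟨rfl, h⟩ | ⟨hb, h⟩ | ⟨hb, ⟨h, hd⟩ | ⟨h, hd⟩ | ⟨h, hd, -⟩⟩
  · rw [h, show pairing a m (.inl a) k = 2 * min (m : ℤ) k from hX.pairing_eq (by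
      change _ = (X.dd a : ℤ) * _
      rw [h, minLen]
      change 2 * min ((X.dd a : ℤ) * m) ((X.dd a : ℤ) * k) = _
      rw [← mul_min_of_nonneg _ _ (hX.dd_pos a).le]
      ring)]
    simp only [true_and]
    exact sign_sum_diag _ hda m k hm
  · rw [h, show pairing a m b k = 0 from hX.pairing_eq (by rw [h]; ring)]
    simp only [hb, false_and, if_false, mul_zero, add_zero, sub_zero]
    exact sign_sum_zero _ _ m k
  · rw [h, show pairing a m b k = -min (m : ℤ) k from hX.pairing_eq (by
      rw [h, minLen, hd, ← mul_min_of_nonneg _ _ (hX.dd_pos _).le]; ring)]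
    simp only [hb, false_and, if_false, sub_zero]
    rw [hd]
    have := sign_sum_of_one_left 1 one_pos m k
    rw [one_mul] at this
    rw [← this]
    refine Finset.sum_congr rfl fun i _ => Finset.sum_congr rfl fun j _ => ?_
    rw [show (X.dd (X.base b) : ℤ) * lvl m i - X.dd (X.base b) * lvl k j + X.dd (X.base b) * -1 =
      X.dd (X.base b) * (lvl m i - 1 * lvl k j - 1) by ring, Int.sign_mul,
      Int.sign_eq_one_of_pos hdb, one_mul]
  · rw [h, show pairing a m b k = -min (m : ℤ) (X.dd (X.base b) * k) from hX.pairing_eq (by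
      rw [h, minLen, hd]; push_cast; rw [one_mul]; ring)]
    simp only [hb, false_and, if_false, sub_zero]
    rw [← sign_sum_of_one_left _ hdb, hd]
    refine Finset.sum_congr rfl fun i _ => Finset.sum_congr rfl fun j _ => ?_
    congr 1
    push_cast
    ring
  · rw [h, show pairing a m b k = -min (X.dd a * (m : ℤ)) k from hX.pairing_eq (by
      rw [h, minLen, hd]; push_cast; rw [one_mul]; ring)]
    simp only [hb, false_and, if_false, sub_zero]
    rw [← sign_sum_of_one_right _ hda, hd]
    refine Finset.sum_congr rfl fun i _ => Finset.sum_congr rfl fun j _ => ?_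
    congr 1
    push_cast
    ring

end Regular

/-- The contribution to `Δ_l^{(a)}` of a string of length `k` in the color of `b`. -/
def deltaTerm (a : X.Node) (l : ℕ) (b : X.ExtNode) (k : ℕ) : ℤ :=
  if X.dd (X.base b) < X.dd a ∧ X.A' a b ≠ 0 then
    if X.dd a = 2 then -(if k = 2 * l then 1 else 0)
    else -((if k = 3 * l - 1 then 1 else 0) + 2 * (if k = 3 * l then 1 else 0) +
      if k = 3 * l + 1 then 1 else 0)
  else 0

namespace Regular
variable (hX : X.Regular)
include hX

theorem ordDiff_sum (a : X.Node) (l : ℕ) (hl : 0 < l) (b : X.ExtNode) (k : ℕ) :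
    ∑ j : Fin k, ordDiff (X.dd a * X.A' a b) (X.dd a * l) (X.dd (X.base b) * lvl k j) =
      -X.dd a * pairing a l b k + (if b = .inl a ∧ l = k then (X.dd a : ℤ) else 0)
        + deltaTerm a l b k := by
  have hda := hX.dd_pos a
  have hdb := hX.dd_pos (X.base b)
  have hl' : (1 : ℤ) ≤ l := by exact_mod_cast hl
  rcases hX.cases_node a b with ⟨rfl, h⟩ | ⟨hb, h⟩ | ⟨hb, ⟨h, hd⟩ | ⟨h, hd⟩ | ⟨h, hd, hd3⟩⟩
  · rw [h, show pairing a l (.inl a) k = 2 * min (l : ℤ) k from hX.pairing_eq (by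
      change _ = (X.dd a : ℤ) * _
      rw [h, minLen]
      change 2 * min ((X.dd a : ℤ) * l) ((X.dd a : ℤ) * k) = _
      rw [← mul_min_of_nonneg _ _ (hX.dd_pos a).le]
      ring), show deltaTerm a l (.inl a) k = 0 from if_neg (fun h => lt_irrefl _ h.1)]
    simp only [true_and, add_zero]
    refine (ordDiff_sum_diag _ hda l hl' k).trans ?_
    rw [mul_ite, mul_one, mul_zero]
    norm_cast
  · rw [h, show pairing a l b k = 0 from hX.pairing_eq (by rw [h]; ring),
      show deltaTerm a l b k = 0 from if_neg (fun h' => h'.2 h)]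
    simp only [hb, false_and, if_false, mul_zero, add_zero]
    exact ordDiff_sum_zero _ _ _ k
  · rw [h, show pairing a l b k = -min (l : ℤ) k from hX.pairing_eq (by
      rw [h, minLen, hd, ← mul_min_of_nonneg _ _ (hX.dd_pos _).le]; ring),
      show deltaTerm a l b k = 0 from if_neg (fun h' => by omega)]
    simp only [hb, false_and, if_false, add_zero]
    rw [hd, mul_neg, mul_one, ordDiff_sum_of_eq _ hdb _ hl']
    ring
  · rw [h, show pairing a l b k = -min (l : ℤ) (X.dd (X.base b) * k) from hX.pairing_eq (by
      rw [h, minLen, hd]; push_cast; rw [one_mul]; ring),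
      show deltaTerm a l b k = 0 from if_neg (fun h' => by omega)]
    simp only [hb, false_and, if_false, add_zero]
    rw [hd]
    push_cast
    rw [one_mul, one_mul, ordDiff_sum_of_one_left _ hdb _ hl']
    ring
  · rw [h, show pairing a l b k = -min (X.dd a * (l : ℤ)) k from hX.pairing_eq (by
      rw [h, minLen, hd]; push_cast; rw [one_mul]; ring)]
    have hne : X.A' a b ≠ 0 := by rw [h]; norm_num
    simp only [hb, false_and, if_false, add_zero, deltaTerm, hne, ne_eq, not_false_eq_true,
      and_true]
    rw [if_pos (by omega), hd]
    push_cast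
    simp only [one_mul, mul_neg, mul_one, neg_mul, neg_neg]
    rcases hd3 with hd3 | hd3
    · rw [if_pos hd3, hd3]
      push_cast
      rw [ordDiff_sum_two_one _ hl']
      split_ifs <;> omega
    · rw [if_neg (by omega), hd3]
      push_cast
      rw [ordDiff_sum_three_one _ hl']
      split_ifs <;> omega

theorem fold_left_pairing (a : X.Node) (m : ℕ) (c : X.Node) (k : ℕ) :
    X.cartan a c * minLen a m c k / (X.eps a * X.dd c) =
      ∑ b with X.base b = c, (X.expL a b : ℤ) * pairing a m b k := by
  have heps : 0 < (X.eps a : ℤ) := by unfold eps; split_ifs <;> norm_num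
  have h := hX.fold_left a c
  rw [← sum_base c (fun b => (X.expL a b : ℤ) * X.A' a b), id] at h
  refine Int.ediv_eq_of_eq_mul_right (mul_pos heps (hX.dd_pos c)).ne' ?_
  rw [← h, mul_assoc, mul_assoc, Finset.sum_mul, Finset.mul_sum (a := (X.dd c : ℤ))]
  congr 1
  refine Finset.sum_congr rfl fun b hb => ?_
  obtain rfl : X.base b = c := (Finset.mem_filter.mp hb).2
  rw [mul_assoc, ← hX.pairing_spec a m b k]
  ring

theorem fold_right_pairing (a : X.Node) (m : ℕ) (c : X.Node) (k : ℕ) :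
    X.cartan c a * minLen a m c k / (X.eps c * X.dd a) =
      ∑ b with X.base b = c, (X.expR a b : ℤ) * pairing a m b k := by
  have heps : 0 < (X.eps c : ℤ) := by unfold eps; split_ifs <;> norm_num
  have h := hX.fold_right a c
  have h' := sum_base c (fun b => (X.expR a b : ℤ) * X.cartan' (X.node b) (X.ι a))
  simp only [node] at h'
  rw [← h', id] at h
  refine Int.ediv_eq_of_eq_mul_right (mul_pos heps (hX.dd_pos a)).ne' ?_
  rw [← h, mul_assoc, mul_assoc, Finset.sum_mul, Finset.mul_sum (a := (X.dd a : ℤ))]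
  congr 1
  refine Finset.sum_congr rfl fun b hb => ?_
  obtain rfl : X.base b = c := (Finset.mem_filter.mp hb).2
  have h1 := hX.pairing_spec a m b k
  have h2 := hX.symm a b
  rw [hX.d'_node] at h2
  have h3 : (X.dd a : ℤ) * pairing a m b k =
      X.cartan' (X.node b) (X.ι a) * minLen a m (X.base b) k := by
    refine mul_left_cancel₀ (hX.dd_pos (X.base b)).ne' ?_
    calc _ = (X.dd a : ℤ) * (X.dd (X.base b) * pairing a m b k) := by ring
      _ = X.dd a * X.A' a b * minLen a m (X.base b) k := by rw [h1]; ring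
      _ = _ := by rw [h2]; ring
  change (X.expR a b : ℤ) * X.cartan' (X.node b) (X.ι a) * _ = _
  rw [mul_assoc, ← h3]
  ring

theorem vac_eq (ν N : X.Pattern) (a : X.Node) (m : ℕ) :
    vac ν N a m = gam ν a m -
      ∑ s : Str N, ∑ b with X.base b = s.color, (X.expL a b : ℤ) * pairing a m b s.len := by
  rw [vac, sum_str N (fun c k => ∑ b with X.base b = c, (X.expL a b : ℤ) * pairing a m b k)]
  congr 1
  refine Finset.sum_congr rfl fun p _ => ?_
  rw [hX.fold_left_pairing]

omit hX in
theorem vacHat_eq (ν N : X.Pattern) (a : X.Node) (m : ℕ) :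
    vacHat ν N a m = gam ν a m - ∑ s : Str N, pairing a m (.inl s.color) s.len := by
  rw [vacHat, sum_str N (fun c k => pairing a m (.inl c) k)]
  rfl

theorem sceMatrix_eq (ν N : X.Pattern) (s t : Str N) :
    sceMatrix ν N s t = (if s = t then vac ν N s.color s.len + N s.1.1 else 0)
      + ∑ b with X.base b = t.color, (X.expR s.color b : ℤ) * pairing s.color s.len b t.len
      - (if s.1 = t.1 then 1 else 0) := by
  rw [sceMatrix, hX.fold_right_pairing]

end Regular
end Datum
end QBethe

namespace QBethe
namespace Datum
variable {X : Datum}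

/-! ### Orders of consecutive differences in a string -/

/-- The difference of the orders of the two sides of the Bethe equation at an entry of level `l`,
up to the contributions of the neighboring entries of the same string. -/
def defect (ν N : X.Pattern) (a : X.Node) (l : ℤ) : ℤ :=
  X.kappa * X.eps' a * X.dd a * ∑ p ∈ ν.support with p.1 = a, (ν p : ℤ) * clamp (p.2 : ℕ) l +
    X.kappa * ∑ b : X.ExtNode, ∑ u : Root N with u.color = X.base b,
      (X.epsMax a b : ℤ) *
        ordDiff (X.dd a * X.A' a b) (X.dd a * l) (X.dd (X.base b) * u.level)

/-- The order of the difference of the normalized `i`-th and `(i + 1)`-st entries of a string. -/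
def gapOrd (ν N : X.Pattern) (s : Str N) (i : ℕ) : ℤ :=
  ∑ j ∈ Finset.range i, defect ν N s.color ((s.len : ℤ) - 1 - 2 * j)

theorem gapOrd_zero (ν N : X.Pattern) (s : Str N) : gapOrd ν N s 0 = 0 := rfl

theorem defect_neg (ν N : X.Pattern) (a : X.Node) (l : ℤ) :
    defect ν N a (-l) = -defect ν N a l := by
  unfold defect
  rw [neg_add, ← mul_neg, ← mul_neg, ← Finset.sum_neg_distrib]
  congr 2
  · refine Finset.sum_congr rfl fun p _ => ?_
    rw [clamp_neg (Int.natCast_nonneg _), mul_neg]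
  · rw [sum_ext_root, sum_ext_root, ← Finset.sum_neg_distrib]
    refine Finset.sum_congr rfl fun s _ => ?_
    rw [← Finset.sum_neg_distrib]
    refine Finset.sum_congr rfl fun b _ => ?_
    rw [← Finset.sum_neg_distrib]
    have := sum_lvl_neg s.len (fun l' => (X.epsMax a b : ℤ) *
        ordDiff (X.dd a * X.A' a b) (X.dd a * -l) (X.dd (X.base b) * l'))
    refine this.symm.trans (Finset.sum_congr rfl fun j _ => ?_)
    rw [mul_neg, mul_neg, ordDiff_neg, mul_neg]
    rfl

theorem gapOrd_len (ν N : X.Pattern) (s : Str N) : gapOrd ν N s s.len = 0 := by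
  have hs : 0 < s.len := s.1.1.2.pos
  have h := sum_range_odd (defect ν N s.color) (defect_neg ν N s.color) (s.len - 1)
  rw [Nat.sub_add_cancel hs] at h
  rw [← h]
  refine Finset.sum_congr rfl fun j _ => ?_
  rw [Nat.cast_sub hs]
  rfl

theorem gapOrd_reflect (ν N : X.Pattern) (s : Str N) {i : ℕ} (hi : i ≤ s.len) :
    gapOrd ν N s i = gapOrd ν N s (s.len - i) := by
  have h := gapOrd_len ν N s
  unfold gapOrd at h ⊢
  rw [← Finset.sum_range_add_sum_Ico _ hi, Finset.sum_Ico_eq_sum_range] at h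
  rw [eq_neg_of_add_eq_zero_left h, ← Finset.sum_neg_distrib, ← Finset.sum_range_reflect]
  refine Finset.sum_congr rfl fun j hj => ?_
  rw [Finset.mem_range] at hj
  rw [← defect_neg]
  congr 1
  omega

namespace Regular
variable (hX : X.Regular)
include hX

theorem epsMax_eq (a : X.Node) (b : X.ExtNode) : X.epsMax a b = X.eps' a * X.expL a b := by
  unfold expL
  refine (Nat.mul_div_cancel' ?_).symm
  have h1 : X.eps' a = X.r ∨ X.eps' a = 1 := by
    unfold eps' epsI; split_ifs <;> simp
  have h2 : X.epsI (X.node b) = X.r ∨ X.epsI (X.node b) = 1 := by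
    unfold epsI; split_ifs <;> simp
  have := hX.r_pos
  unfold epsMax
  rcases h1 with h1 | h1 <;> rcases h2 with h2 | h2 <;> rw [h1, h2]
  · simp
  · rw [max_eq_left (by omega)]
  · exact one_dvd _
  · simp

theorem epsMax_eq' (a : X.Node) (b : X.ExtNode) :
    X.epsMax a b = X.eps' (X.base b) * X.expR a b := by
  unfold expR
  rw [← hX.epsI_node]
  refine (Nat.mul_div_cancel' ?_).symm
  have h1 : X.eps' a = X.r ∨ X.eps' a = 1 := by
    unfold eps' epsI; split_ifs <;> simp
  have h2 : X.epsI (X.node b) = X.r ∨ X.epsI (X.node b) = 1 := by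
    unfold epsI; split_ifs <;> simp
  have := hX.r_pos
  unfold epsMax
  rcases h1 with h1 | h1 <;> rcases h2 with h2 | h2 <;> rw [h1, h2]
  · simp
  · exact one_dvd _
  · rw [max_eq_right (by omega)]
  · simp

theorem expL_self (a : X.Node) : X.expL a (.inl a) = 1 := by
  have : X.expL a (.inl a) = max (X.eps' a) (X.eps' a) / X.eps' a := rfl
  rw [this, max_self, Nat.div_self (by exact_mod_cast hX.eps'_pos a)]

theorem expR_self (a : X.Node) : X.expR a (.inl a) = 1 := by
  have : X.expR a (.inl a) = max (X.eps' a) (X.eps' a) / X.eps' a := rfl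
  rw [this, max_self, Nat.div_self (by exact_mod_cast hX.eps'_pos a)]

theorem xi_eta_eq_defect (ν N : X.Pattern) (t : Root N) :
    xiMinus ν t - xiPlus ν t + (etaPlus t - etaMinus t) = defect ν N t.color t.level := by
  unfold xiMinus xiPlus etaPlus etaMinus defect
  rw [← mul_sub, ← mul_sub, ← Finset.sum_sub_distrib, ← Finset.sum_sub_distrib]
  congr 2
  · refine Finset.sum_congr rfl fun p _ => ?_
    have := p.2.pos
    rw [← mul_sub]
    unfold clamp
    congr 1
    omega
  · refine Finset.sum_congr rfl fun b _ => ?_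
    rw [← Finset.sum_sub_distrib]
    refine Finset.sum_congr rfl fun u _ => ?_
    rw [← mul_sub, mul_add, mul_add, ← hX.symm, hX.d'_node]
    rfl

theorem sum_expL_delta_self (N : X.Pattern) (a : X.Node) (l : ℕ) :
    ∑ s : Str N, ∑ b with X.base b = s.color,
      (X.expL a b : ℤ) * (if b = .inl a ∧ l = s.len then (X.dd a : ℤ) else 0) =
      X.dd a * mult N a l := by
  rw [← sum_str_ite, Finset.mul_sum]
  refine Finset.sum_congr rfl fun s _ => ?_
  rw [sum_base]
  simp only [reduceCtorEq, false_and, if_false, mul_zero, dite_eq_ite, ite_self, add_zero,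
    Sum.inl.injEq]
  by_cases h : s.color = a
  · simp only [h, true_and, hX.expL_self, Nat.cast_one, one_mul, mul_ite, mul_one, mul_zero,
      eq_comm]
  · simp [h]

theorem sum_expL_deltaTerm (N : X.Pattern) (a : X.Node) (l : ℕ) :
    ∑ s : Str N, ∑ b with X.base b = s.color, (X.expL a b : ℤ) * deltaTerm a l b s.len =
      Delta N a l := by
  set h : ℕ → ℤ := fun k => if X.dd a = 2 then -(if k = 2 * l then 1 else 0)
    else -((if k = 3 * l - 1 then 1 else 0) + 2 * (if k = 3 * l then 1 else 0) +
      if k = 3 * l + 1 then 1 else 0) with hh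
  have hterm : ∀ b k, deltaTerm a l b k =
      if X.dd (X.base b) < X.dd a ∧ X.A' a b ≠ 0 then h k else 0 := fun b k => rfl
  have e : ∀ s : Str N, ∑ b with X.base b = s.color, (X.expL a b : ℤ) * deltaTerm a l b s.len =
      if X.r = 1 ∧ X.d s.color < X.d a ∧ X.d s.color = 1 ∧ X.cartan a s.color ≠ 0
        then h s.len else 0 := by
    intro s
    have e0 : (if hc : X.eps s.color = 2 then (X.expL a (.inr ⟨s.color, hc⟩) : ℤ) *
        deltaTerm a l (.inr ⟨s.color, hc⟩) s.len else 0) = 0 := by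
      split_ifs with hc
      · rw [hterm, if_neg, mul_zero]
        exact fun hlt => absurd (hX.dd_le a s.color hc) (not_le.mpr hlt.1)
      · rfl
    have hiff : (X.r = 1 ∧ X.d s.color < X.d a ∧ X.d s.color = 1 ∧ X.cartan a s.color ≠ 0) ↔
        X.dd s.color < X.dd a ∧ X.A' a (.inl s.color) ≠ 0 := hX.delta_iff a s.color
    have hterm' : deltaTerm a l (.inl s.color) s.len =
      if X.dd s.color < X.dd a ∧ X.A' a (.inl s.color) ≠ 0 then h s.len else 0 := rfl
    rw [sum_base, e0, add_zero, hterm']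
    by_cases hc : X.dd s.color < X.dd a ∧ X.A' a (.inl s.color) ≠ 0
    · have hc' := hiff.mpr hc
      rw [if_pos hc', if_pos hc]
      have he : X.expL a (.inl s.color) = 1 := by
        unfold expL epsMax eps' epsI
        rw [hc'.1]
        simp
      rw [he, Nat.cast_one, one_mul]
    · rw [if_neg (fun h' => hc (hiff.mp h')), if_neg hc, mul_zero]
  rw [Finset.sum_congr rfl fun s _ => e s, Delta]
  by_cases hr : X.r = 1
  · rw [if_pos hr]
    have h1 : ∀ a' : X.Node, (if X.d a = 2 then -mult N a' (2 * l) else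
        -(mult N a' (3 * l - 1) + 2 * mult N a' (3 * l) + mult N a' (3 * l + 1))) =
        ∑ s : Str N, if s.color = a' then h s.len else 0 := by
      intro a'
      simp only [← sum_str_ite, hX.d_eq hr]
      split_ifs with h2
      · rw [← Finset.sum_neg_distrib]
        refine Finset.sum_congr rfl fun s _ => ?_
        rw [hh]
        simp only [h2, if_true]
        by_cases hs : s.color = a' <;> simp [hs]
      · rw [Finset.mul_sum, ← Finset.sum_add_distrib, ← Finset.sum_add_distrib,
          ← Finset.sum_neg_distrib]
        refine Finset.sum_congr rfl fun s _ => ?_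
        rw [hh]
        simp only [h2, if_false]
        by_cases hs : s.color = a' <;> simp [hs]
    rw [Finset.sum_congr rfl fun a' _ => h1 a', Finset.sum_comm]
    refine Finset.sum_congr rfl fun s _ => ?_
    rw [Finset.sum_ite_eq]
    simp [hr]
  · rw [if_neg hr]
    exact Finset.sum_eq_zero fun s _ => if_neg fun h' => hr h'.1

theorem defect_eq (ν N : X.Pattern) (a : X.Node) (l : ℕ) (hl : 0 < l) :
    defect ν N a l =
      X.kappa * X.eps' a * (X.dd a * (vac ν N a l + mult N a l) + Delta N a l) := by
  have h1 : ∑ p ∈ ν.support with p.1 = a, (ν p : ℤ) * clamp (p.2 : ℕ) l = gam ν a l := by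
    refine Finset.sum_congr rfl fun p _ => ?_
    have := p.2.pos
    rw [mul_comm]
    unfold clamp
    congr 1
    omega
  have h2 : ∑ b : X.ExtNode, ∑ u : Root N with u.color = X.base b, (X.epsMax a b : ℤ) *
      ordDiff (X.dd a * X.A' a b) (X.dd a * l) (X.dd (X.base b) * u.level) =
      X.eps' a * (X.dd a * (vac ν N a l - gam ν a l) + X.dd a * mult N a l + Delta N a l) := by
    rw [sum_ext_root, hX.vac_eq, ← hX.sum_expL_deltaTerm N a l, ← hX.sum_expL_delta_self,
      sub_sub_cancel_left, mul_neg, Finset.mul_sum (a := (X.dd a : ℤ)), ← Finset.sum_neg_distrib,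
      ← Finset.sum_add_distrib, ← Finset.sum_add_distrib, Finset.mul_sum]
    refine Finset.sum_congr rfl fun s _ => ?_
    rw [Finset.mul_sum, ← Finset.sum_neg_distrib,
      ← Finset.sum_add_distrib, ← Finset.sum_add_distrib, Finset.mul_sum]
    refine Finset.sum_congr rfl fun b _ => ?_
    rw [← Finset.mul_sum, hX.epsMax_eq]
    have := hX.ordDiff_sum a l hl b s.len
    refine Eq.trans (congrArg (_ * ·) this) ?_
    push_cast
    ring
  rw [defect, h1, h2]
  ring

theorem gapOrd_pos {ν N : X.Pattern} (hgen : GenericityCondition ν N) (s : Str N) {i : ℕ}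
    (h0 : 0 < i) (hi : i < s.len) : 0 < gapOrd ν N s i := by
  have key : gapOrd ν N s i = gapOrd ν N s (min i (s.len - i)) := by
    rcases le_total i (s.len - i) with h | h
    · rw [min_eq_left h]
    · rw [min_eq_right h, gapOrd_reflect ν N s hi.le]
  have hsum : gapOrd ν N s (min i (s.len - i)) = X.kappa * X.eps' s.color *
      ∑ k ∈ Finset.Icc 1 (min i (s.len - i)),
      ((X.dd s.color : ℤ) * (vac ν N s.color (s.len + 1 - 2 * k) +
        mult N s.color (s.len + 1 - 2 * k)) + Delta N s.color (s.len + 1 - 2 * k)) := by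
    rw [Finset.mul_sum, ← Finset.Ico_add_one_right_eq_Icc, Finset.sum_Ico_eq_sum_range]
    refine Finset.sum_congr rfl fun j hj => ?_
    rw [Finset.mem_range] at hj
    rw [← hX.defect_eq ν N _ _ (by omega)]
    congr 1
    omega
  have h := hgen s.1.1 s.1.2 (i + 1) (by omega) hi
  rw [key, hsum]
  refine mul_pos (mul_pos (by exact_mod_cast hX.kappa_pos) (hX.eps'_pos _)) ?_
  have e1 : i + 1 - 1 = i := by omega
  have e2 : s.len + 1 - (i + 1) = s.len - i := by omega
  change 0 < ∑ k ∈ Finset.Icc 1 (min (i + 1 - 1) (s.len + 1 - (i + 1))), _ at h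
  rw [e1, e2] at h
  exact h

end Regular
end Datum
end QBethe

namespace QBethe

/-! ### Normalized binomials -/

/-- The binomial `u q^p - v q^r` with `p - r = e`, divided by the power `q^(min p r)`. -/
def bin (e : ℤ) (u v q : ℂ) : ℂ := u * q ^ e.toNat - v * q ^ (-e).toNat

theorem zpow_mul_bin {q : ℂ} (hq : q ≠ 0) (p r : ℤ) (u v : ℂ) :
    u * q ^ p - v * q ^ r = q ^ min p r * bin (p - r) u v q := by
  unfold bin
  rw [mul_sub, mul_left_comm, mul_left_comm (q ^ min p r), ← zpow_natCast, ← zpow_natCast,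
    ← zpow_add₀ hq, ← zpow_add₀ hq]
  congr 3 <;> omega

theorem bin_zero_of_pos {e : ℤ} (he : 0 < e) (u v : ℂ) : bin e u v 0 = -v := by
  have h1 : e.toNat ≠ 0 := by omega
  have h2 : (-e).toNat = 0 := by omega
  simp [bin, h1, h2]

theorem bin_zero_of_neg {e : ℤ} (he : e < 0) (u v : ℂ) : bin e u v 0 = u := by
  have h1 : (-e).toNat ≠ 0 := by omega
  have h2 : e.toNat = 0 := by omega
  simp [bin, h1, h2]

theorem bin_zero_left (u v q : ℂ) : bin 0 u v q = u - v := by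
  simp [bin]

theorem bin_zero_neg (e : ℤ) {u v : ℂ} (hu : u ≠ 0) (hv : v ≠ 0) :
    bin (-e) u v 0 = bin e u v 0 * (-(u / v)) ^ e.sign := by
  rcases lt_trichotomy e 0 with h | rfl | h
  · rw [bin_zero_of_neg h, bin_zero_of_pos (by omega), Int.sign_eq_neg_one_of_neg h]
    field_simp
  · simp
  · rw [bin_zero_of_pos h, bin_zero_of_neg (by omega), Int.sign_eq_one_of_pos h]
    field_simp

theorem bin_zero_mul {c : ℤ} (hc : 0 < c) (e : ℤ) (u v : ℂ) : bin (c * e) u v 0 = bin e u v 0 := by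
  rcases lt_trichotomy e 0 with h | rfl | h
  · rw [bin_zero_of_neg h, bin_zero_of_neg (mul_neg_of_pos_of_neg hc h)]
  · simp
  · rw [bin_zero_of_pos h, bin_zero_of_pos (mul_pos hc h)]

theorem bin_zero_ne_zero_iff {e : ℤ} {u v : ℂ} (hu : u ≠ 0) (hv : v ≠ 0) :
    bin e u v 0 ≠ 0 ↔ (e = 0 → u ≠ v) := by
  rcases lt_trichotomy e 0 with h | rfl | h
  · simp [bin_zero_of_neg h, hu, h.ne]
  · simp [bin_zero_left, sub_eq_zero]
  · simp [bin_zero_of_pos h, hv, h.ne']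

theorem prod_zpow_eq {ι : Type*} {q : ℂ} (hq : q ≠ 0) (s : Finset ι) (f : ι → ℤ) :
    ∏ i ∈ s, q ^ f i = q ^ ∑ i ∈ s, f i := by
  classical
  induction s using Finset.induction_on with
  | empty => simp
  | insert a s ha ih => rw [Finset.prod_insert ha, Finset.sum_insert ha, zpow_add₀ hq, ih]

namespace Datum
variable {X : Datum}

/-! ### Normalized factors of the Bethe equation -/

/-- The order of the entry `t` of a string. -/
def rootOrd {N : X.Pattern} (t : Root N) : ℤ :=
  t.level * X.kappa * X.eps' t.color * X.dd t.color

/-- The normalization of `F_{i+}` (for `θ = 1`) and of `F_{i-}` (for `θ = -1`). -/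
def normF (ν : X.Pattern) {N : X.Pattern} (θ : ℤ) (t : Root N) (q : ℂ) (Y : Root N → ℂ) : ℂ :=
  ∏ p ∈ ν.support with p.1 = t.color,
    bin ((X.kappa * X.eps' t.color * X.dd t.color : ℤ) * (t.level + θ * (p.2 : ℕ))) (Y t) 1 q ^ ν p

/-- The normalization of `G_{i+}` (for `θ = 1`) and of `G_{i-}` (for `θ = -1`), without the
factor that belongs to the neighboring entry of the same string. -/
def normG {N : X.Pattern} (θ : ℤ) (t : Root N) (q : ℂ) (Y : Root N → ℂ) : ℂ :=
  ∏ b : X.ExtNode, ∏ u : Root N with u.color = X.base b,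
    if b = .inl t.color ∧ u.1 = t.1 ∧ u.level = t.level + 2 * θ then 1 else
      bin ((X.kappa * X.epsMax t.color b : ℤ) *
        (X.dd t.color * t.level - X.dd (X.base b) * u.level +
          θ * (X.dd t.color * X.A' t.color b)))
        (Y t ^ X.expL t.color b) ((X.sgn b * Y u) ^ X.expR t.color b) q

/-- The difference with the preceding entry of the string. -/
def diffPrev {N : X.Pattern} (t : Root N) (Y : Root N → ℂ) : ℂ :=
  if 0 < (t.2 : ℕ) then Y t - Y ⟨t.1, ⟨t.2 - 1, by omega⟩⟩ else 1

/-- The difference with the next entry of the string. -/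
def diffNext {N : X.Pattern} (t : Root N) (Y : Root N → ℂ) : ℂ :=
  if h : (t.2 : ℕ) + 1 < t.1.len then Y t - Y ⟨t.1, ⟨t.2 + 1, h⟩⟩ else 1

theorem prod_ext_ite {M : Type*} [CommMonoid M] {N : X.Pattern} (t u₀ : Root N)
    (hu₀ : u₀.color = t.color) (C : X.ExtNode → Root N → Prop) [∀ b u, Decidable (C b u)]
    (hC : ∀ b u, C b u ↔ b = .inl t.color ∧ u = u₀) (g : X.ExtNode → Root N → M) :
    ∏ b : X.ExtNode, ∏ u : Root N with u.color = X.base b, (if C b u then g b u else 1) =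
      g (.inl t.color) u₀ := by
  rw [Finset.prod_eq_single (.inl t.color), Finset.prod_eq_single u₀]
  · exact if_pos ((hC _ _).mpr ⟨rfl, rfl⟩)
  · intro u _ hu
    exact if_neg fun h => hu ((hC _ _).mp h).2
  · intro h
    exact absurd (Finset.mem_filter.mpr ⟨Finset.mem_univ u₀, hu₀⟩) h
  · intro b _ hb
    exact Finset.prod_eq_one fun u _ => if_neg fun h => hb ((hC _ _).mp h).1
  · simp

theorem prod_ext_mul_ite {M : Type*} [CommMonoid M] {N : X.Pattern}
    (C : X.ExtNode → Root N → Prop) [∀ b u, Decidable (C b u)] (g : X.ExtNode → Root N → M) :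
    ∏ b : X.ExtNode, ∏ u : Root N with u.color = X.base b, g b u =
    (∏ b : X.ExtNode, ∏ u : Root N with u.color = X.base b, if C b u then g b u else 1) *
      ∏ b : X.ExtNode, ∏ u : Root N with u.color = X.base b, if C b u then 1 else g b u := by
  rw [← Finset.prod_mul_distrib]
  refine Finset.prod_congr rfl fun b _ => ?_
  rw [← Finset.prod_mul_distrib]
  refine Finset.prod_congr rfl fun u _ => ?_
  split_ifs <;> simp

theorem root_ext {N : X.Pattern} {t u : Root N} (h1 : u.1 = t.1) (h2 : (u.2 : ℕ) = t.2) :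
    u = t := by
  obtain ⟨s, i⟩ := t
  obtain ⟨s', j⟩ := u
  obtain rfl : s' = s := h1
  exact congrArg _ (Fin.ext h2)

theorem level_eq {N : X.Pattern} {t u : Root N} (h1 : u.1 = t.1) (θ : ℤ) :
    u.level = t.level + 2 * θ ↔ ((u.2 : ℕ) : ℤ) = (t.2 : ℕ) - θ := by
  unfold Root.level
  have : u.1.len = t.1.len := congrArg Str.len h1
  omega

namespace Regular
variable (hX : X.Regular)
include hX

theorem prod_bin_eq_diffPrev_mul {N : X.Pattern} (t : Root N) (q : ℂ) (Y : Root N → ℂ) :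
    ∏ b : X.ExtNode, ∏ u : Root N with u.color = X.base b,
      bin ((X.kappa * X.epsMax t.color b : ℤ) *
        (X.dd t.color * t.level - X.dd (X.base b) * u.level +
          1 * (X.dd t.color * X.A' t.color b)))
        (Y t ^ X.expL t.color b) ((X.sgn b * Y u) ^ X.expR t.color b) q =
      diffPrev t Y * normG 1 t q Y := by
  rw [prod_ext_mul_ite (fun b u => b = .inl t.color ∧ u.1 = t.1 ∧ u.level = t.level + 2 * 1)]
  refine congrArg (· * _) ?_
  unfold diffPrev
  split_ifs with h
  · rw [prod_ext_ite t ⟨t.1, ⟨t.2 - 1, by omega⟩⟩ rfl]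
    · have e : (X.dd t.color : ℤ) * t.level - X.dd (X.base (.inl t.color)) *
          Root.level (⟨t.1, ⟨t.2 - 1, by omega⟩⟩ : Root N) +
          1 * (X.dd t.color * X.A' t.color (.inl t.color)) = 0 := by
        rw [(level_eq (t := t) (u := ⟨t.1, ⟨t.2 - 1, by omega⟩⟩) rfl 1).mpr (by
          change ((t.2 - 1 : ℕ) : ℤ) = _; omega), hX.diag]
        change (X.dd t.color : ℤ) * t.level - X.dd t.color * _ + _ = 0
        ring
      rw [e, mul_zero, bin_zero_left, hX.expL_self, hX.expR_self, pow_one, pow_one, sgn, one_mul]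
    · intro b u
      refine and_congr_right fun _ => ⟨fun hu => root_ext hu.1 ?_, ?_⟩
      · have := (level_eq hu.1 1).mp hu.2
        change _ = (t.2 : ℕ) - 1
        omega
      · rintro rfl
        refine ⟨rfl, (level_eq (t := t)
          (u := ⟨t.1, ⟨t.2 - 1, by omega⟩⟩) rfl 1).mpr ?_⟩
        change ((t.2 - 1 : ℕ) : ℤ) = _
        omega
  · refine Finset.prod_eq_one fun b _ => Finset.prod_eq_one fun u _ => if_neg ?_
    rintro ⟨-, h1, h2⟩
    have := (level_eq h1 1).mp h2
    omega

theorem prod_bin_eq_diffNext_mul {N : X.Pattern} (t : Root N) (q : ℂ) (Y : Root N → ℂ) :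
    ∏ b : X.ExtNode, ∏ u : Root N with u.color = X.base b,
      bin ((X.kappa * X.epsMax t.color b : ℤ) *
        (X.dd t.color * t.level - X.dd (X.base b) * u.level +
          (-1) * (X.dd t.color * X.A' t.color b)))
        (Y t ^ X.expL t.color b) ((X.sgn b * Y u) ^ X.expR t.color b) q =
      diffNext t Y * normG (-1) t q Y := by
  rw [prod_ext_mul_ite (fun b u => b = .inl t.color ∧ u.1 = t.1 ∧ u.level = t.level + 2 * (-1))]
  refine congrArg (· * _) ?_
  unfold diffNext
  split_ifs with h
  · rw [prod_ext_ite t ⟨t.1, ⟨t.2 + 1, h⟩⟩ rfl]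
    · have e : (X.dd t.color : ℤ) * t.level - X.dd (X.base (.inl t.color)) *
          Root.level (⟨t.1, ⟨t.2 + 1, h⟩⟩ : Root N) +
          (-1) * (X.dd t.color * X.A' t.color (.inl t.color)) = 0 := by
        rw [(level_eq (t := t) (u := ⟨t.1, ⟨t.2 + 1, h⟩⟩) rfl (-1)).mpr (by
          change ((t.2 + 1 : ℕ) : ℤ) = _; omega), hX.diag]
        change (X.dd t.color : ℤ) * t.level - X.dd t.color * _ + _ = 0
        ring
      rw [e, mul_zero, bin_zero_left, hX.expL_self, hX.expR_self, pow_one, pow_one, sgn, one_mul]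
    · intro b u
      refine and_congr_right fun _ => ⟨fun hu => root_ext hu.1 ?_, ?_⟩
      · have := (level_eq hu.1 (-1)).mp hu.2
        change _ = (t.2 : ℕ) + 1
        omega
      · rintro rfl
        refine ⟨rfl, (level_eq (t := t) (u := ⟨t.1, ⟨t.2 + 1, h⟩⟩) rfl (-1)).mpr ?_⟩
        change ((t.2 + 1 : ℕ) : ℤ) = _
        omega
  · refine Finset.prod_eq_one fun b _ => Finset.prod_eq_one fun u _ => if_neg ?_
    rintro ⟨-, h1, h2⟩
    have h3 := (level_eq h1 (-1)).mp h2
    have h4 := u.2.2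
    have h5 : u.1.len = t.1.len := congrArg Str.len h1
    omega

theorem unit_pos (a : X.Node) : 0 < (X.kappa * X.eps' a * X.dd a : ℤ) :=
  mul_pos (mul_pos (by exact_mod_cast hX.kappa_pos) (hX.eps'_pos a)) (hX.dd_pos a)

theorem epsMax_pos (a : X.Node) (b : X.ExtNode) : 0 < (X.kappa * X.epsMax a b : ℤ) := by
  refine mul_pos (by exact_mod_cast hX.kappa_pos) ?_
  exact lt_of_lt_of_le (hX.eps'_pos a) (by exact_mod_cast le_max_left _ _)

variable (ν : X.Pattern) {N : X.Pattern} (x : Root N → ℂ → ℂ) (Y : Root N → ℂ) {q : ℂ}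
  (hx : ∀ t, x t q = q ^ rootOrd t * Y t)
include hx

theorem pow_expL_eq (t : Root N) (b : X.ExtNode) :
    x t q ^ X.expL t.color b = Y t ^ X.expL t.color b *
      q ^ ((X.kappa * X.epsMax t.color b : ℤ) * (X.dd t.color * t.level)) := by
  rw [hx, mul_pow, mul_comm, ← zpow_natCast (q ^ _), ← zpow_mul, hX.epsMax_eq, rootOrd]
  congr 2
  push_cast
  ring

theorem pow_expR_eq (t u : Root N) (b : X.ExtNode) (hu : u.color = X.base b) :
    (X.sgn b * x u q) ^ X.expR t.color b = (X.sgn b * Y u) ^ X.expR t.color b *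
      q ^ ((X.kappa * X.epsMax t.color b : ℤ) * (X.dd (X.base b) * u.level)) := by
  rw [hx, mul_left_comm, mul_pow, mul_comm, ← zpow_natCast (q ^ _), ← zpow_mul, hX.epsMax_eq',
    rootOrd, hu]
  congr 2
  push_cast
  ring

variable (hq : q ≠ 0)
include hq

theorem Fplus_eq (t : Root N) :
    Fplus Root.color ν x t q = q ^ xiPlus ν t * normF ν 1 t q Y := by
  unfold Fplus normF xiPlus
  rw [Finset.mul_sum, ← prod_zpow_eq hq, ← Finset.prod_mul_distrib]
  refine Finset.prod_congr rfl fun p _ => ?_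
  have h := zpow_mul_bin hq
    ((X.kappa * X.eps' t.color * X.dd t.color : ℤ) * (t.level + 1 * (p.2 : ℕ))) 0 (Y t) 1
  have hm : min ((X.kappa * X.eps' t.color * X.dd t.color : ℤ) * (t.level + 1 * (p.2 : ℕ))) 0 =
      (X.kappa * X.eps' t.color * X.dd t.color : ℤ) * min (t.level + (p.2 : ℕ)) 0 := by
    rw [mul_min_of_nonneg _ _ (hX.unit_pos _).le, mul_zero, one_mul]
  have hl : x t q * q ^ ((p.2 : ℕ) * X.kappa * X.eps' t.color * X.dd t.color) = Y t *
      q ^ ((X.kappa * X.eps' t.color * X.dd t.color : ℤ) * (t.level + 1 * (p.2 : ℕ))) := by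
    rw [hx, ← zpow_natCast, mul_right_comm, ← zpow_add₀ hq, mul_comm, rootOrd]
    congr 2
    push_cast
    ring
  rw [sub_zero, hm, zpow_zero, mul_one] at h
  rw [show (X.kappa * X.eps' t.color * X.dd t.color : ℤ) *
    ((ν p : ℤ) * min (t.level + (p.2 : ℕ)) 0) = ((X.kappa * X.eps' t.color * X.dd t.color : ℤ) *
    min (t.level + (p.2 : ℕ)) 0) * (ν p : ℕ) by ring, zpow_mul, zpow_natCast, ← mul_pow, ← h, hl]

theorem Fminus_eq (t : Root N) :
    Fminus Root.color ν x t q = q ^ xiMinus ν t * normF ν (-1) t q Y := by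
  unfold Fminus normF xiMinus
  rw [Finset.mul_sum, ← prod_zpow_eq hq, ← Finset.prod_mul_distrib]
  refine Finset.prod_congr rfl fun p _ => ?_
  have h := zpow_mul_bin hq ((X.kappa * X.eps' t.color * X.dd t.color : ℤ) * t.level)
    ((X.kappa * X.eps' t.color * X.dd t.color : ℤ) * (p.2 : ℕ)) (Y t) 1
  rw [← mul_min_of_nonneg _ _ (hX.unit_pos _).le, ← mul_sub, one_mul] at h
  have hl : x t q = Y t * q ^ ((X.kappa * X.eps' t.color * X.dd t.color : ℤ) * t.level) := by
    rw [hx, mul_comm, rootOrd]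
    congr 2
    ring
  have hr : q ^ ((p.2 : ℕ) * X.kappa * X.eps' t.color * X.dd t.color) =
      q ^ ((X.kappa * X.eps' t.color * X.dd t.color : ℤ) * (p.2 : ℕ)) := by
    rw [← zpow_natCast]
    congr 1
    push_cast
    ring
  rw [show (X.kappa * X.eps' t.color * X.dd t.color : ℤ) *
    ((ν p : ℤ) * min t.level (p.2 : ℕ)) = ((X.kappa * X.eps' t.color * X.dd t.color : ℤ) *
    min t.level (p.2 : ℕ)) * (ν p : ℕ) by ring, zpow_mul, zpow_natCast, ← mul_pow,
    neg_one_mul, ← sub_eq_add_neg, ← h, hl, hr]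

theorem Gplus_eq (t : Root N) :
    Gplus Root.color x t q = q ^ etaPlus t * (diffPrev t Y * normG 1 t q Y) := by
  rw [← hX.prod_bin_eq_diffPrev_mul]
  unfold Gplus etaPlus
  rw [Finset.mul_sum, ← prod_zpow_eq hq, ← Finset.prod_mul_distrib]
  refine Finset.prod_congr rfl fun b _ => ?_
  rw [Finset.mul_sum, ← prod_zpow_eq hq, ← Finset.prod_mul_distrib]
  refine Finset.prod_congr rfl fun u hu => ?_
  replace hu := (Finset.mem_filter.mp hu).2
  have h := zpow_mul_bin hq
    ((X.kappa * X.epsMax t.color b : ℤ) * (X.dd t.color * (t.level + X.A' t.color b)))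
    ((X.kappa * X.epsMax t.color b : ℤ) * (X.dd (X.base b) * u.level))
    (Y t ^ X.expL t.color b) ((X.sgn b * Y u) ^ X.expR t.color b)
  rw [← mul_min_of_nonneg _ _ (hX.epsMax_pos _ _).le, ← mul_sub] at h
  rw [hX.pow_expL_eq x Y hx, hX.pow_expR_eq x Y hx t u b hu, hX.d'_node,
    ← mul_assoc (X.kappa : ℤ) (X.epsMax t.color b : ℤ) (min _ _),
    show (X.dd t.color * t.level - X.dd (X.base b) * u.level +
          1 * (X.dd t.color * X.A' t.color b) : ℤ) =
      X.dd t.color * (t.level + X.A' t.color b) - X.dd (X.base b) * u.level by ring, ← h,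
    mul_assoc (Y t ^ X.expL t.color b), ← zpow_add₀ hq, shift]
  congr 3
  ring

theorem Gminus_eq (t : Root N) :
    Gminus Root.color x t q = q ^ etaMinus t * (diffNext t Y * normG (-1) t q Y) := by
  rw [← hX.prod_bin_eq_diffNext_mul]
  unfold Gminus etaMinus
  rw [Finset.mul_sum, ← prod_zpow_eq hq, ← Finset.prod_mul_distrib]
  refine Finset.prod_congr rfl fun b _ => ?_
  rw [Finset.mul_sum, ← prod_zpow_eq hq, ← Finset.prod_mul_distrib]
  refine Finset.prod_congr rfl fun u hu => ?_
  replace hu := (Finset.mem_filter.mp hu).2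
  have h := zpow_mul_bin hq
    ((X.kappa * X.epsMax t.color b : ℤ) * (X.dd t.color * t.level))
    ((X.kappa * X.epsMax t.color b : ℤ) *
      (X.dd (X.base b) * u.level + X.dd t.color * X.A' t.color b))
    (Y t ^ X.expL t.color b) ((X.sgn b * Y u) ^ X.expR t.color b)
  rw [← mul_min_of_nonneg _ _ (hX.epsMax_pos _ _).le, ← mul_sub] at h
  rw [hX.pow_expL_eq x Y hx, hX.pow_expR_eq x Y hx t u b hu, mul_add (X.d' _ : ℤ),
    ← hX.symm, hX.d'_node, ← mul_assoc (X.kappa : ℤ) (X.epsMax t.color b : ℤ) (min _ _),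
    show (X.dd t.color * t.level - X.dd (X.base b) * u.level +
          (-1) * (X.dd t.color * X.A' t.color b) : ℤ) =
      X.dd t.color * t.level - (X.dd (X.base b) * u.level + X.dd t.color * X.A' t.color b) by ring,
    ← h, mul_assoc ((X.sgn b * Y u) ^ X.expR t.color b), ← zpow_add₀ hq, shift]
  congr 3
  ring

end Regular
end Datum
end QBethe

namespace QBethe

theorem prod_lvl_neg {M : Type*} [CommMonoid M] (m : ℕ) (f : ℤ → M) :
    ∏ i : Fin m, f (-lvl m i) = ∏ i : Fin m, f (lvl m i) := by
  refine Fintype.prod_equiv Fin.revPerm _ _ fun i => ?_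
  rw [Fin.revPerm_apply, lvl_rev]

namespace Datum
variable {X : Datum}

/-! ### The Bethe equation at `q = 0` -/

theorem mem_bracket_iff {m : ℕ} {j : ℤ} : j ∈ bracket m ↔ ∃ i : Fin m, lvl m i = j := by
  constructor
  · rintro ⟨i, h1, h2, rfl⟩
    refine ⟨⟨i - 1, by omega⟩, ?_⟩
    unfold lvl
    change (m : ℤ) + 1 - 2 * (((i - 1 : ℕ) : ℤ) + 1) = _
    omega
  · rintro ⟨i, rfl⟩
    exact ⟨i + 1, by omega, i.2, by unfold lvl; push_cast; ring⟩

theorem neg_mem_bracket {m : ℕ} {j : ℤ} (h : j ∈ bracket m) : -j ∈ bracket m := by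
  obtain ⟨i, rfl⟩ := mem_bracket_iff.mp h
  exact mem_bracket_iff.mpr ⟨i.rev, lvl_rev i⟩

theorem level_mem_bracket {N : X.Pattern} (t : Root N) : t.level ∈ bracket t.1.len :=
  mem_bracket_iff.mpr ⟨t.2, rfl⟩

theorem str_fst_eq_iff {N : X.Pattern} (s t : Str N) :
    s.1 = t.1 ↔ s.color = t.color ∧ s.len = t.len := by
  constructor
  · intro h
    unfold Str.color Str.len
    rw [h]
    exact ⟨rfl, rfl⟩
  · rintro ⟨h1, h2⟩
    exact Subtype.ext (Prod.ext h1 (PNat.eq h2))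

theorem sum_same_fst {N : X.Pattern} (s : Str N) :
    ∑ t : Str N, (if s.1 = t.1 then (1 : ℤ) else 0) = N s.1.1 := by
  have h := sum_str_ite N s.color s.len
  have e : mult N s.color s.len = N s.1.1 := by
    unfold mult
    rw [dif_pos (show 0 < s.len from s.1.1.2.pos)]
    rfl
  rw [← e, ← h]
  refine Finset.sum_congr rfl fun t _ => ?_
  simp only [str_fst_eq_iff, eq_comm]

theorem sum_filter_base_ite (a c : X.Node) (p : Prop) [Decidable p] (f : X.ExtNode → ℤ) :
    ∑ b with X.base b = c, f b * (if b = .inl a ∧ p then 1 else 0) =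
      if a = c ∧ p then f (.inl a) else 0 := by
  rw [sum_base]
  simp only [reduceCtorEq, false_and, if_false, mul_zero, dite_eq_ite, ite_self, add_zero,
    Sum.inl.injEq]
  by_cases h : c = a
  · subst h; simp
  · have h' : ¬ a = c := fun e => h e.symm
    simp [h, h']

namespace Regular
variable (hX : X.Regular) (ν : X.Pattern) {N : X.Pattern} {z : Str N → ℂ}
include hX

theorem normF_zero (θ : ℤ) (t : Root N) :
    normF ν θ t 0 (fun u => z u.1) =
      ∏ p ∈ ν.support with p.1 = t.color, bin (t.level + θ * (p.2 : ℕ)) (z t.1) 1 0 ^ ν p := by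
  unfold normF
  refine Finset.prod_congr rfl fun p _ => ?_
  rw [bin_zero_mul (hX.unit_pos _)]

theorem normG_zero (θ : ℤ) (t : Root N) :
    normG θ t 0 (fun u => z u.1) =
      ∏ b : X.ExtNode, ∏ u : Root N with u.color = X.base b,
        if b = .inl t.color ∧ u.1 = t.1 ∧ u.level = t.level + 2 * θ then 1 else
          bin (X.dd t.color * t.level - X.dd (X.base b) * u.level +
            θ * (X.dd t.color * X.A' t.color b))
            (z t.1 ^ X.expL t.color b) ((X.sgn b * z u.1) ^ X.expR t.color b) 0 := by
  unfold normG
  refine Finset.prod_congr rfl fun b _ => Finset.prod_congr rfl fun u _ => ?_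
  rw [bin_zero_mul (hX.epsMax_pos _ _)]

theorem prod_normF_zero (hz : ∀ s, z s ≠ 0) (s : Str N) :
    ∏ i : Fin s.len, normF ν (-1) ⟨s, i⟩ 0 (fun u => z u.1) =
      (∏ i : Fin s.len, normF ν 1 ⟨s, i⟩ 0 (fun u => z u.1)) *
        (-z s) ^ gam ν s.color s.len := by
  have hz' : -z s ≠ 0 := neg_ne_zero.mpr (hz s)
  have e : ∀ θ, ∏ i : Fin s.len, normF ν θ ⟨s, i⟩ 0 (fun u => z u.1) =
      ∏ p ∈ ν.support with p.1 = s.color, ∏ i : Fin s.len,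
        bin (lvl s.len i + θ * (p.2 : ℕ)) (z s) 1 0 ^ ν p := fun θ => by
    rw [Finset.prod_comm]
    exact Finset.prod_congr rfl fun i _ => hX.normF_zero ν θ ⟨s, i⟩
  rw [e, e]
  rw [gam, ← prod_zpow_eq hz', ← Finset.prod_mul_distrib]
  refine Finset.prod_congr rfl fun p _ => ?_
  rw [Finset.prod_pow, Finset.prod_pow, zpow_mul, zpow_natCast, ← mul_pow]
  congr 1
  have h := prod_lvl_neg s.len (fun l => bin (l + -1 * (p.2 : ℕ)) (z s) 1 0)
  refine h.symm.trans ?_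
  have e : ∀ i : Fin s.len, bin (-lvl s.len i + -1 * (p.2 : ℕ)) (z s) 1 0 =
      bin (lvl s.len i + 1 * (p.2 : ℕ)) (z s) 1 0 *
        (-z s) ^ (lvl s.len i + (p.2 : ℕ)).sign := by
    intro i
    have h := bin_zero_neg (lvl s.len i + 1 * (p.2 : ℕ)) (hz s) one_ne_zero
    rw [div_one, one_mul] at h
    rw [one_mul, ← h]
    congr 1
    ring
  rw [Finset.prod_congr rfl fun i _ => e i, Finset.prod_mul_distrib, prod_zpow_eq hz',
    sum_sign_add_lvl]
  congr 2
  have := p.2.pos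
  unfold clamp
  omega

theorem prod_normG_zero (hz : ∀ s, z s ≠ 0) (s : Str N) :
    ∏ i : Fin s.len, normG (-1) ⟨s, i⟩ 0 (fun u => z u.1) =
      (∏ i : Fin s.len, normG 1 ⟨s, i⟩ 0 (fun u => z u.1)) *
        ∏ t : Str N, ∏ b with X.base b = t.color,
          (-(z s ^ X.expL s.color b / (X.sgn b * z t) ^ X.expR s.color b)) ^
            (pairing s.color s.len b t.len - if b = .inl s.color ∧ s.len = t.len then 1 else 0)
      := by
  have hsgn : ∀ b, X.sgn b ≠ 0 := by rintro (b | b) <;> simp [sgn]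
  have e : ∀ θ : ℤ, ∏ i : Fin s.len, normG θ ⟨s, i⟩ 0 (fun u => z u.1) =
      ∏ t : Str N, ∏ b with X.base b = t.color, ∏ i : Fin s.len, ∏ j : Fin t.len,
        if b = .inl s.color ∧ t = s ∧ lvl t.len j = lvl s.len i + 2 * θ then 1 else
          bin (X.dd s.color * lvl s.len i - X.dd (X.base b) * lvl t.len j +
            θ * (X.dd s.color * X.A' s.color b))
            (z s ^ X.expL s.color b) ((X.sgn b * z t) ^ X.expR s.color b) 0 := by
    intro θ
    simp only [hX.normG_zero]
    simp only [prod_ext_root]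
    rw [Finset.prod_comm]
    refine Finset.prod_congr rfl fun t _ => ?_
    rw [Finset.prod_comm]
    rfl
  rw [e, e, ← Finset.prod_mul_distrib]
  refine Finset.prod_congr rfl fun t _ => ?_
  rw [← Finset.prod_mul_distrib]
  refine Finset.prod_congr rfl fun b _ => ?_
  have hu : z s ^ X.expL s.color b ≠ 0 := pow_ne_zero _ (hz s)
  have hv : (X.sgn b * z t) ^ X.expR s.color b ≠ 0 :=
    pow_ne_zero _ (mul_ne_zero (hsgn b) (hz t))
  set u := z s ^ X.expL s.color b
  set v := (X.sgn b * z t) ^ X.expR s.color b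
  have hw : -(u / v) ≠ 0 := neg_ne_zero.mpr (div_ne_zero hu hv)
  have hrev := prod_lvl_neg s.len (fun l => ∏ j : Fin t.len,
    if b = .inl s.color ∧ t = s ∧ lvl t.len j = l + 2 * (-1) then 1 else
          bin (X.dd s.color * l - X.dd (X.base b) * lvl t.len j +
            (-1) * (X.dd s.color * X.A' s.color b)) u v 0)
  rw [← hrev, ← hX.sign_sum s.color s.len s.1.1.2.pos b t.len, ← prod_zpow_eq hw,
    ← Finset.prod_mul_distrib]
  refine Finset.prod_congr rfl fun i _ => ?_
  have hrev' := prod_lvl_neg t.len (fun l =>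
    if b = .inl s.color ∧ t = s ∧ l = -lvl s.len i + 2 * (-1) then 1 else
          bin (X.dd s.color * (-lvl s.len i) - X.dd (X.base b) * l +
            (-1) * (X.dd s.color * X.A' s.color b)) u v 0)
  rw [← hrev', ← prod_zpow_eq hw, ← Finset.prod_mul_distrib]
  refine Finset.prod_congr rfl fun j _ => ?_
  by_cases hc : b = .inl s.color ∧ t = s ∧ lvl t.len j = lvl s.len i + 2 * 1
  · rw [if_pos hc, if_pos ⟨hc.1, hc.2.1, by rw [hc.2.2]; ring⟩, hc.2.2, hc.1, hX.diag, one_mul]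
    change 1 = _ ^ ((X.dd s.color : ℤ) * lvl s.len i - X.dd s.color * _ + _).sign
    rw [show (X.dd s.color : ℤ) * lvl s.len i - X.dd s.color * (lvl s.len i + 2 * 1) +
      X.dd s.color * 2 = 0 by ring, Int.sign_zero, zpow_zero]
  · rw [if_neg hc, if_neg (fun h => hc ⟨h.1, h.2.1, by linarith [h.2.2]⟩), one_mul,
      ← bin_zero_neg _ hu hv]
    congr 1
    ring

/-- The product of the normalized Bethe equations over a string, at `q = 0`. -/
theorem prod_norm_zero (hz : ∀ s, z s ≠ 0) (s : Str N) :
    ∏ i : Fin s.len, (normF ν (-1) ⟨s, i⟩ 0 (fun u => z u.1) *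
        normG 1 ⟨s, i⟩ 0 (fun u => z u.1)) =
      (∏ i : Fin s.len, (normF ν 1 ⟨s, i⟩ 0 (fun u => z u.1) *
        normG (-1) ⟨s, i⟩ 0 (fun u => z u.1))) *
      ((-1) ^ (vacHat ν N s.color s.len + N s.1.1) * ∏ t, z t ^ sceMatrix ν N s t) := by
  have hsgn : ∀ b, X.sgn b ≠ 0 := by rintro (b | b) <;> simp [sgn]
  set S : Str N → X.ExtNode → ℤ := fun t b =>
    pairing s.color s.len b t.len - if b = .inl s.color ∧ s.len = t.len then 1 else 0 with hS
  set W : Str N → X.ExtNode → ℂ := fun t b =>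
    -(z s ^ X.expL s.color b / (X.sgn b * z t) ^ X.expR s.color b) with hW
  have hW0 : ∀ t b, W t b ≠ 0 := fun t b => neg_ne_zero.mpr (div_ne_zero (pow_ne_zero _ (hz s))
    (pow_ne_zero _ (mul_ne_zero (hsgn b) (hz t))))
  have hWS : ∀ t, ∏ b with X.base b = t.color, W t b ^ S t b =
      (-1) ^ S t (.inl t.color) * (z t ^ (-∑ b with X.base b = t.color, (X.expR s.color b : ℤ) * S t b) *
        z s ^ (∑ b with X.base b = t.color, (X.expL s.color b : ℤ) * S t b)) := by
    intro t
    have h1 : ∀ b, W t b ^ S t b = (-(X.sgn b ^ X.expR s.color b)) ^ S t b *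
        (z t ^ (-((X.expR s.color b : ℤ) * S t b)) * z s ^ ((X.expL s.color b : ℤ) * S t b)) := by
      intro b
      have h2 : W t b = -(X.sgn b ^ X.expR s.color b) *
          (z t ^ (-(X.expR s.color b : ℤ)) * z s ^ (X.expL s.color b : ℤ)) := by
        rw [hW]
        have : (X.sgn b ^ X.expR s.color b)⁻¹ = X.sgn b ^ X.expR s.color b := by
          rcases b with b | b
          · simp [sgn]
          · rw [hX.expR_inr]; simp [sgn]
        simp only
        rw [mul_pow, zpow_neg, zpow_natCast, zpow_natCast, div_eq_mul_inv, mul_inv, this]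
        ring
      rw [h2, mul_zpow, mul_zpow, ← zpow_mul, ← zpow_mul, neg_mul]
    rw [Finset.prod_congr rfl fun b _ => h1 b, Finset.prod_mul_distrib, Finset.prod_mul_distrib,
      prod_zpow_eq (hz t), prod_zpow_eq (hz s), Finset.sum_neg_distrib]
    congr 1
    rw [prod_base]
    have h3 : (if h : X.eps t.color = 2 then
        (-(X.sgn (.inr ⟨t.color, h⟩) ^ X.expR s.color (.inr ⟨t.color, h⟩))) ^
          S t (.inr ⟨t.color, h⟩) else 1) = 1 := by
      split_ifs with h
      · rw [hX.expR_inr]; simp [sgn]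
      · rfl
    rw [h3, mul_one, sgn, one_pow]
  have hR : ∀ t, ∑ b with X.base b = t.color, (X.expR s.color b : ℤ) * S t b =
      ∑ b with X.base b = t.color, (X.expR s.color b : ℤ) * pairing s.color s.len b t.len -
        if s.1 = t.1 then 1 else 0 := by
    intro t
    simp only [hS, mul_sub, Finset.sum_sub_distrib, sum_filter_base_ite, hX.expR_self,
      str_fst_eq_iff, Nat.cast_one]
  have hL : ∀ t, ∑ b with X.base b = t.color, (X.expL s.color b : ℤ) * S t b =
      ∑ b with X.base b = t.color, (X.expL s.color b : ℤ) * pairing s.color s.len b t.len -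
        if s.1 = t.1 then 1 else 0 := by
    intro t
    simp only [hS, mul_sub, Finset.sum_sub_distrib, sum_filter_base_ite, hX.expL_self,
      str_fst_eq_iff, Nat.cast_one]
  have hI : ∀ t, S t (.inl t.color) = pairing s.color s.len (.inl t.color) t.len -
      if s.1 = t.1 then 1 else 0 := by
    intro t
    simp only [hS, str_fst_eq_iff, Sum.inl.injEq, @eq_comm _ t.color]
  have hsign : (-1 : ℂ) ^ (vacHat ν N s.color s.len + N s.1.1) =
      (-1) ^ gam ν s.color s.len * (-1) ^ ∑ t : Str N, S t (.inl t.color) := by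
    rw [← zpow_add₀ (by norm_num), Finset.sum_congr rfl fun t _ => hI t,
      Finset.sum_sub_distrib, sum_same_fst, vacHat_eq,
      show gam ν s.color s.len + (∑ t : Str N, pairing s.color s.len (.inl t.color) t.len -
        (N s.1.1 : ℤ)) = gam ν s.color s.len - ∑ t : Str N, pairing s.color s.len (.inl t.color)
        t.len + N s.1.1 + 2 * (∑ t : Str N, pairing s.color s.len (.inl t.color) t.len -
        (N s.1.1 : ℤ)) by ring, zpow_add₀ (by norm_num) _ (2 * _), zpow_mul]
    norm_num
  have hmat : ∏ t, z t ^ sceMatrix ν N s t =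
      z s ^ (gam ν s.color s.len - ∑ t : Str N, ∑ b with X.base b = t.color,
        (X.expL s.color b : ℤ) * S t b) *
      ∏ t : Str N, z t ^ ∑ b with X.base b = t.color, (X.expR s.color b : ℤ) * S t b := by
    have h1 : gam ν s.color s.len - ∑ t : Str N, ∑ b with X.base b = t.color,
        (X.expL s.color b : ℤ) * S t b = vac ν N s.color s.len + N s.1.1 := by
      rw [hX.vac_eq, Finset.sum_congr rfl fun t _ => hL t, Finset.sum_sub_distrib, sum_same_fst]
      ring
    have h2 : z s ^ (vac ν N s.color s.len + N s.1.1) =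
        ∏ t : Str N, z t ^ (if s = t then vac ν N s.color s.len + N s.1.1 else 0) := by
      rw [Finset.prod_eq_single s]
      · rw [if_pos rfl]
      · intro t _ ht
        rw [if_neg (Ne.symm ht), zpow_zero]
      · simp
    rw [h1, h2, ← Finset.prod_mul_distrib]
    refine Finset.prod_congr rfl fun t _ => ?_
    rw [← zpow_add₀ (hz t), hR, hX.sceMatrix_eq, add_sub_assoc]
  have hprodW : ∏ t : Str N, ∏ b with X.base b = t.color, W t b ^ S t b ≠ 0 :=
    Finset.prod_ne_zero_iff.mpr fun t _ => Finset.prod_ne_zero_iff.mpr fun b _ =>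
      zpow_ne_zero _ (hW0 t b)
  have hfinal : (-1 : ℂ) ^ (vacHat ν N s.color s.len + N s.1.1) *
      (∏ t, z t ^ sceMatrix ν N s t) *
      ∏ t : Str N, ∏ b with X.base b = t.color, W t b ^ S t b =
      (-z s) ^ gam ν s.color s.len := by
    rw [Finset.prod_congr rfl fun t _ => hWS t, Finset.prod_mul_distrib,
      Finset.prod_mul_distrib, prod_zpow_eq (hz s), prod_zpow_eq (by norm_num : (-1 : ℂ) ≠ 0),
      hsign, hmat, zpow_sub₀ (hz s), neg_eq_neg_one_mul (z s), mul_zpow]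
    have h1 : (∏ t : Str N, z t ^ ∑ b with X.base b = t.color, (X.expR s.color b : ℤ) * S t b) *
        ∏ t : Str N, z t ^ (-∑ b with X.base b = t.color, (X.expR s.color b : ℤ) * S t b) = 1 := by
      rw [← Finset.prod_mul_distrib]
      refine Finset.prod_eq_one fun t _ => ?_
      rw [← zpow_add₀ (hz t), add_neg_cancel, zpow_zero]
    have h2 : ((-1 : ℂ) ^ ∑ t : Str N, S t (.inl t.color)) *
        (-1) ^ ∑ t : Str N, S t (.inl t.color) = 1 := by
      rw [← mul_zpow]; norm_num
    have h3 := zpow_ne_zero (∑ t : Str N, ∑ b with X.base b = t.color,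
        (X.expL s.color b : ℤ) * S t b) (hz s)
    generalize (∏ t : Str N, z t ^ ∑ b with X.base b = t.color, (X.expR s.color b : ℤ) * S t b)
      = p1 at *
    generalize (∏ t : Str N, z t ^ (-∑ b with X.base b = t.color, (X.expR s.color b : ℤ) * S t b))
      = p2 at *
    generalize (-1 : ℂ) ^ ∑ t : Str N, S t (.inl t.color) = p3 at *
    generalize z s ^ (∑ t : Str N, ∑ b with X.base b = t.color,
        (X.expL s.color b : ℤ) * S t b) = p4 at *
    field_simp
    linear_combination z s ^ gam ν s.color s.len *
      (p3 ^ 2 * h1 + h2)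
  rw [Finset.prod_mul_distrib, Finset.prod_mul_distrib, hX.prod_normF_zero ν hz,
    hX.prod_normG_zero hz, ← hfinal]
  ring

/-! ### Non-vanishing of the normalized factors -/

theorem normF_zero_ne_zero (hz : ∀ s, z s ≠ 0)
    (h1 : ∀ s : Str N, (∃ k : ℕ+, 0 < ν (s.color, k) ∧ ((k : ℕ) : ℤ) ∈ bracket s.len) → z s ≠ 1)
    {θ : ℤ} (hθ : θ = 1 ∨ θ = -1) (t : Root N) : normF ν θ t 0 (fun u => z u.1) ≠ 0 := by
  rw [hX.normF_zero]
  refine Finset.prod_ne_zero_iff.mpr fun p hp => pow_ne_zero _ ?_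
  rw [Finset.mem_filter] at hp
  rw [bin_zero_ne_zero_iff (hz _) one_ne_zero]
  intro he
  refine h1 t.1 ⟨p.2, ?_, ?_⟩
  · have : (t.1.color, p.2) = p := Prod.ext hp.2.symm rfl
    rw [this]
    exact Nat.pos_of_ne_zero (Finsupp.mem_support_iff.mp hp.1)
  · have h := level_mem_bracket t
    rcases hθ with rfl | rfl
    · rw [show ((p.2 : ℕ) : ℤ) = -t.level by linarith]
      exact neg_mem_bracket h
    · rwa [show ((p.2 : ℕ) : ℤ) = t.level by linarith]

theorem ne_one_of_normF (hz : ∀ s, z s ≠ 0) (h : ∀ t, normF ν 1 t 0 (fun u => z u.1) ≠ 0)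
    (s : Str N) (hs : ∃ k : ℕ+, 0 < ν (s.color, k) ∧ ((k : ℕ) : ℤ) ∈ bracket s.len) :
    z s ≠ 1 := by
  obtain ⟨k, hk, hk'⟩ := hs
  obtain ⟨i, hi⟩ := mem_bracket_iff.mp (neg_mem_bracket hk')
  have h2 := h ⟨s, i⟩
  rw [hX.normF_zero, Finset.prod_ne_zero_iff] at h2
  have h3 := h2 (s.color, k) (Finset.mem_filter.mpr ⟨Finsupp.mem_support_iff.mpr hk.ne', rfl⟩)
  rw [pow_ne_zero_iff hk.ne', bin_zero_ne_zero_iff (hz _) one_ne_zero] at h3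
  refine h3 ?_
  change lvl s.len i + 1 * ((k : ℕ) : ℤ) = 0
  rw [hi]
  ring

theorem normG_zero_ne_zero (hz : ∀ s, z s ≠ 0)
    (h1 : ∀ (s : Str N) (b : X.ExtNode) (t : Str N), t.color = X.base b →
      ¬ (b = .inl s.color ∧ s = t) →
      (∃ i ∈ bracket s.len, ∃ j ∈ bracket t.len,
        (X.dd s.color : ℤ) * X.A' s.color b = i * X.dd s.color - j * X.d' (X.node b)) →
      z s ^ X.expL s.color b ≠ (X.sgn b * z t) ^ X.expR s.color b)
    {θ : ℤ} (hθ : θ = 1 ∨ θ = -1) (t : Root N) : normG θ t 0 (fun u => z u.1) ≠ 0 := by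
  have hsgn : ∀ b, X.sgn b ≠ 0 := by rintro (b | b) <;> simp [sgn]
  rw [hX.normG_zero]
  refine Finset.prod_ne_zero_iff.mpr fun b _ => Finset.prod_ne_zero_iff.mpr fun u hu => ?_
  rw [Finset.mem_filter] at hu
  split_ifs with hc
  · exact one_ne_zero
  rw [bin_zero_ne_zero_iff (pow_ne_zero _ (hz _))
    (pow_ne_zero _ (mul_ne_zero (hsgn b) (hz _)))]
  intro he
  refine h1 t.1 b u.1 hu.2 ?_ ?_
  · rintro ⟨hb, htu⟩
    refine hc ⟨hb, htu.symm, ?_⟩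
    have hbase : X.base b = t.color := by rw [hb]; rfl
    rw [hbase, hb] at he
    have hd := hX.diag t.color
    change X.A' t.color (.inl t.color) = 2 at hd
    have he' : (X.dd t.color : ℤ) * u.level = X.dd t.color * (t.level + 2 * θ) := by
      change (X.dd t.color : ℤ) * t.level - X.dd t.color * u.level +
        θ * (X.dd t.color * X.A' t.color (.inl t.color)) = 0 at he
      rw [hd] at he
      linarith
    exact mul_left_cancel₀ (hX.dd_pos _).ne' he'
  · have ht := level_mem_bracket t
    have hu' := level_mem_bracket u
    rcases hθ with rfl | rfl
    · refine ⟨_, neg_mem_bracket ht, _, neg_mem_bracket hu', ?_⟩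
      rw [hX.d'_node]
      change (X.dd t.color : ℤ) * X.A' t.color b = -t.level * X.dd t.color - _
      linarith
    · refine ⟨_, ht, _, hu', ?_⟩
      rw [hX.d'_node]
      change (X.dd t.color : ℤ) * X.A' t.color b = t.level * X.dd t.color - _
      linarith

theorem ne_of_normG (hz : ∀ s, z s ≠ 0) (h : ∀ t, normG 1 t 0 (fun u => z u.1) ≠ 0)
    (s : Str N) (b : X.ExtNode) (t : Str N) (hb : t.color = X.base b)
    (hst : ¬ (b = .inl s.color ∧ s = t))
    (hij : ∃ i ∈ bracket s.len, ∃ j ∈ bracket t.len,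
      (X.dd s.color : ℤ) * X.A' s.color b = i * X.dd s.color - j * X.d' (X.node b)) :
    z s ^ X.expL s.color b ≠ (X.sgn b * z t) ^ X.expR s.color b := by
  have hsgn : ∀ b, X.sgn b ≠ 0 := by rintro (b | b) <;> simp [sgn]
  obtain ⟨i, hi, j, hj, he⟩ := hij
  obtain ⟨i', hi'⟩ := mem_bracket_iff.mp (neg_mem_bracket hi)
  obtain ⟨j', hj'⟩ := mem_bracket_iff.mp (neg_mem_bracket hj)
  have h2 := h ⟨s, i'⟩
  rw [hX.normG_zero, Finset.prod_ne_zero_iff] at h2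
  have h3 := Finset.prod_ne_zero_iff.mp (h2 b (Finset.mem_univ _)) ⟨t, j'⟩
    (Finset.mem_filter.mpr ⟨Finset.mem_univ _, hb⟩)
  rw [if_neg (fun h' => hst ⟨h'.1, h'.2.1.symm⟩), bin_zero_ne_zero_iff (pow_ne_zero _ (hz _))
    (pow_ne_zero _ (mul_ne_zero (hsgn b) (hz _)))] at h3
  refine h3 ?_
  change (X.dd s.color : ℤ) * lvl s.len i' - X.dd (X.base b) * lvl t.len j' +
    1 * (X.dd s.color * X.A' s.color b) = 0
  rw [hi', hj', he, hX.d'_node]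
  ring

end Regular
end Datum
end QBethe

namespace QBethe
namespace Datum
variable {X : Datum}

/-! ### The reduced Bethe equation -/

/-- The order of the difference of consecutive entries of a string, as a natural number. -/
def gapExp (ν : X.Pattern) {N : X.Pattern} (s : Str N) (i : ℕ) : ℕ := (gapOrd ν N s i).toNat

/-- The normalized entries of strings whose consecutive differences are `q ^ gapExp * Y`. -/
def stack (ν : X.Pattern) {N : X.Pattern} (q : ℂ) (Y : Root N → ℂ) : Root N → ℂ := fun t =>
  ∑ j ∈ Finset.range (t.2 + 1),
    if h : j < t.1.len then q ^ gapExp ν t.1 j * Y ⟨t.1, ⟨j, h⟩⟩ else 0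

/-- The reduced difference with the preceding entry. -/
def headCoord {N : X.Pattern} (Y : Root N → ℂ) (t : Root N) : ℂ :=
  if 0 < (t.2 : ℕ) then Y t else 1

/-- The reduced difference with the next entry. -/
def tailCoord {N : X.Pattern} (Y : Root N → ℂ) (t : Root N) : ℂ :=
  if h : (t.2 : ℕ) + 1 < t.1.len then -Y ⟨t.1, ⟨t.2 + 1, h⟩⟩ else 1

/-- The normalized `F_{i+} G_{i-}`. -/
def normL (ν : X.Pattern) {N : X.Pattern} (t : Root N) (q : ℂ) (Y : Root N → ℂ) : ℂ :=
  normF ν 1 t q Y * normG (-1) t q Y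

/-- The normalized `F_{i-} G_{i+}`. -/
def normR (ν : X.Pattern) {N : X.Pattern} (t : Root N) (q : ℂ) (Y : Root N → ℂ) : ℂ :=
  normF ν (-1) t q Y * normG 1 t q Y

/-- The Bethe equation in the variables `Y`, divided by a power of `q`. -/
def reducedBethe (ν : X.Pattern) {N : X.Pattern} (p : ℂ × (Root N → ℂ)) : Root N → ℂ := fun t =>
  normL ν t p.1 (stack ν p.1 p.2) * tailCoord p.2 t +
    normR ν t p.1 (stack ν p.1 p.2) * headCoord p.2 t

section
variable (ν : X.Pattern) {N : X.Pattern}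

theorem diffPrev_stack (q : ℂ) (Y : Root N → ℂ) (t : Root N) :
    diffPrev t (stack ν q Y) = q ^ gapExp ν t.1 t.2 * headCoord Y t := by
  unfold diffPrev headCoord
  split_ifs with h
  · obtain ⟨s, i, hi⟩ := t
    obtain ⟨k, rfl⟩ := Nat.exists_eq_add_of_le' h
    simp only [stack]
    rw [Finset.sum_range_succ]
    simp [hi]
  · have : (t.2 : ℕ) = 0 := by omega
    simp [this, gapExp, gapOrd_zero]

theorem diffNext_stack (q : ℂ) (Y : Root N → ℂ) (t : Root N) :
    diffNext t (stack ν q Y) = q ^ gapExp ν t.1 (t.2 + 1) * tailCoord Y t := by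
  unfold diffNext tailCoord
  split_ifs with h
  · simp only [stack]
    rw [Finset.sum_range_succ _ ((t.2 : ℕ) + 1)]
    simp [h]
  · have : (t.2 : ℕ) + 1 = t.1.len := by omega
    rw [this, gapExp, gapOrd_len]
    simp

theorem stack_zero (hgen : ∀ (s : Str N) (i : ℕ), 0 < i → i < s.len → 0 < gapOrd ν N s i)
    (Y : Root N → ℂ) : stack ν 0 Y = fun t => Y t.1.first := by
  funext t
  unfold stack
  rw [Finset.sum_range_succ', Finset.sum_eq_zero, zero_add,
    dif_pos (show 0 < t.1.len from t.1.1.1.2.pos)]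
  · simp [gapExp, gapOrd_zero]
    rfl
  · intro j _
    split_ifs with h
    · have := hgen t.1 (j + 1) (by omega) h
      have h' : gapExp ν t.1 (j + 1) ≠ 0 := by unfold gapExp; omega
      rw [zero_pow h', zero_mul]
    · rfl

theorem contDiff_bin {E : Type*} [NormedAddCommGroup E] [NormedSpace ℂ E] {n : WithTop ℕ∞}
    (e : ℤ) {u v q : E → ℂ} (hu : ContDiff ℂ n u) (hv : ContDiff ℂ n v) (hq : ContDiff ℂ n q) :
    ContDiff ℂ n fun p => bin e (u p) (v p) (q p) := by
  unfold bin
  fun_prop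

section
variable {E : Type*} [NormedAddCommGroup E] [NormedSpace ℂ E] {n : WithTop ℕ∞}
    {q : E → ℂ} {Z : E → Root N → ℂ}

theorem contDiff_stack (hq : ContDiff ℂ n q) (hZ : ContDiff ℂ n Z) :
    ContDiff ℂ n fun p => stack ν (q p) (Z p) := by
  rw [contDiff_pi]
  intro t
  unfold stack
  refine ContDiff.sum fun j _ => ?_
  split_ifs with h
  · exact (hq.pow _).mul (contDiff_pi.mp hZ _)
  · exact contDiff_const

theorem contDiff_normF (θ : ℤ) (t : Root N) (hq : ContDiff ℂ n q) (hZ : ContDiff ℂ n Z) :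
    ContDiff ℂ n fun p => normF ν θ t (q p) (Z p) := by
  unfold normF
  refine contDiff_prod fun j _ => ContDiff.pow ?_ _
  exact contDiff_bin _ (contDiff_pi.mp hZ _) contDiff_const hq

theorem contDiff_normG (θ : ℤ) (t : Root N) (hq : ContDiff ℂ n q) (hZ : ContDiff ℂ n Z) :
    ContDiff ℂ n fun p => normG θ t (q p) (Z p) := by
  unfold normG
  refine contDiff_prod fun b _ => contDiff_prod fun u _ => ?_
  split_ifs
  · exact contDiff_const
  · exact contDiff_bin _ ((contDiff_pi.mp hZ _).pow _)
      ((contDiff_const.mul (contDiff_pi.mp hZ _)).pow _) hq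

theorem contDiff_normL (t : Root N) (hq : ContDiff ℂ n q) (hZ : ContDiff ℂ n Z) :
    ContDiff ℂ n fun p => normL ν t (q p) (Z p) :=
  (contDiff_normF ν _ t hq hZ).mul (contDiff_normG _ t hq hZ)

theorem contDiff_normR (t : Root N) (hq : ContDiff ℂ n q) (hZ : ContDiff ℂ n Z) :
    ContDiff ℂ n fun p => normR ν t (q p) (Z p) :=
  (contDiff_normF ν _ t hq hZ).mul (contDiff_normG _ t hq hZ)

end

theorem contDiff_reducedBethe {n : WithTop ℕ∞} : ContDiff ℂ n (reducedBethe ν (N := N)) := by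
  rw [contDiff_pi]
  intro t
  have hs := contDiff_stack ν (n := n) (q := fun p : ℂ × (Root N → ℂ) => p.1) (Z := fun p => p.2)
    contDiff_fst contDiff_snd
  refine ((contDiff_normL ν t contDiff_fst hs).mul ?_).add
    ((contDiff_normR ν t contDiff_fst hs).mul ?_)
  · unfold tailCoord
    split_ifs
    · exact (contDiff_pi.mp contDiff_snd _).neg
    · exact contDiff_const
  · unfold headCoord
    split_ifs
    · exact contDiff_pi.mp contDiff_snd _
    · exact contDiff_const

end

namespace Regular
variable (hX : X.Regular) (ν : X.Pattern) {N : X.Pattern}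
include hX

theorem bethe_iff_reducedBethe
    (hgen : ∀ (s : Str N) (i : ℕ), 0 < i → i < s.len → 0 < gapOrd ν N s i)
    (x : Root N → ℂ → ℂ) (Y : Root N → ℂ) {q : ℂ} (hq : q ≠ 0)
    (hx : ∀ t, x t q = q ^ rootOrd t * stack ν q Y t) (t : Root N) :
    Fplus Root.color ν x t q * Gminus Root.color x t q =
      -(Fminus Root.color ν x t q * Gplus Root.color x t q) ↔ reducedBethe ν (q, Y) t = 0 := by
  have hcast : ∀ i ≤ t.1.len, q ^ gapExp ν t.1 i = q ^ gapOrd ν N t.1 i := by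
    intro i hi
    rw [← zpow_natCast, gapExp, Int.toNat_of_nonneg]
    rcases Nat.eq_zero_or_pos i with rfl | h0
    · rw [gapOrd_zero]
    rcases hi.eq_or_lt with rfl | h1
    · rw [gapOrd_len]
    · exact (hgen _ _ h0 h1).le
  have hgap : gapOrd ν N t.1 (t.2 + 1) = gapOrd ν N t.1 t.2 + defect ν N t.color t.level := by
    unfold gapOrd
    rw [Finset.sum_range_succ]
    congr 2
    unfold Root.level
    ring
  have hexp : xiMinus ν t + etaPlus t + gapOrd ν N t.1 t.2 =
      xiPlus ν t + etaMinus t + gapOrd ν N t.1 (t.2 + 1) := by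
    rw [hgap, ← hX.xi_eta_eq_defect ν N t]
    ring
  rw [hX.Fplus_eq ν x _ hx hq, hX.Fminus_eq ν x _ hx hq, hX.Gplus_eq x _ hx hq,
    hX.Gminus_eq x _ hx hq, diffPrev_stack, diffNext_stack, hcast _ t.2.2.le, hcast _ t.2.2,
    eq_neg_iff_add_eq_zero]
  have : q ^ xiPlus ν t * normF ν 1 t q (stack ν q Y) *
      (q ^ etaMinus t * (q ^ gapOrd ν N t.1 (t.2 + 1) * tailCoord Y t *
        normG (-1) t q (stack ν q Y))) +
      q ^ xiMinus ν t * normF ν (-1) t q (stack ν q Y) *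
      (q ^ etaPlus t * (q ^ gapOrd ν N t.1 t.2 * headCoord Y t * normG 1 t q (stack ν q Y))) =
      q ^ (xiMinus ν t + etaPlus t + gapOrd ν N t.1 t.2) * reducedBethe ν (q, Y) t := by
    simp only [reducedBethe, normL, normR, mul_add]
    nth_rw 1 [hexp]
    rw [zpow_add₀ hq, zpow_add₀ hq, zpow_add₀ hq, zpow_add₀ hq]
    ring
  rw [this, mul_eq_zero, or_iff_right (zpow_ne_zero _ hq)]

omit hX in
/-- The quotients of the two sides of the Bethe equation at `q = 0`. -/
def ratio (z : Str N → ℂ) (s : Str N) (j : ℕ) : ℂ :=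
  if h : j < s.len then
    normR ν ⟨s, ⟨j, h⟩⟩ 0 (fun u => z u.1) / normL ν ⟨s, ⟨j, h⟩⟩ 0 (fun u => z u.1) else 1

variable (hgen : ∀ (s : Str N) (i : ℕ), 0 < i → i < s.len → 0 < gapOrd ν N s i)
include hgen

omit hX in
theorem reducedBethe_zero_apply (Y : Root N → ℂ) (t : Root N) :
    reducedBethe ν (0, Y) t = normL ν t 0 (fun u => Y u.1.first) * tailCoord Y t +
      normR ν t 0 (fun u => Y u.1.first) * headCoord Y t := by
  simp only [reducedBethe, stack_zero ν hgen]

omit hX in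
theorem reducedBethe_zero_iff (Y : Root N → ℂ)
    (hL : ∀ t, normL ν t 0 (fun u => Y u.1.first) ≠ 0) :
    reducedBethe ν (0, Y) = 0 ↔
      (∀ t, headCoord Y t = ∏ j ∈ Finset.range t.2, ratio ν (fun s => Y s.first) t.1 j) ∧
      ∀ s : Str N, ∏ j ∈ Finset.range s.len, ratio ν (fun s => Y s.first) s j = -1 := by
  have hstep : ∀ t, reducedBethe ν (0, Y) t = 0 ↔
      ratio ν (fun s => Y s.first) t.1 t.2 * headCoord Y t = -tailCoord Y t := by
    intro t
    rw [reducedBethe_zero_apply ν hgen, ratio, dif_pos t.2.2]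
    have := hL t
    change _ ↔ normR ν t 0 (fun u => Y u.1.first) / normL ν t 0 (fun u => Y u.1.first) * _ = _
    rw [div_mul_eq_mul_div, div_eq_iff this, ← sub_eq_zero (b := -tailCoord Y t * _)]
    ring_nf
  constructor
  · intro h
    have h' : ∀ t, ratio ν (fun s => Y s.first) t.1 t.2 * headCoord Y t = -tailCoord Y t :=
      fun t => (hstep t).mp (congrFun h t)
    have hhead : ∀ (s : Str N) (i : ℕ) (hi : i < s.len), headCoord Y ⟨s, ⟨i, hi⟩⟩ =
        ∏ j ∈ Finset.range i, ratio ν (fun s => Y s.first) s j := by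
      intro s i
      induction i with
      | zero => intro hi; simp [headCoord]
      | succ i ih =>
        intro hi
        have h1 := h' ⟨s, ⟨i, by omega⟩⟩
        rw [ih (by omega)] at h1
        rw [Finset.prod_range_succ, mul_comm]
        refine Eq.trans ?_ h1.symm
        simp [headCoord, tailCoord, hi]
    refine ⟨fun t => hhead t.1 t.2 t.2.2, fun s => ?_⟩
    have hs : 0 < s.len := s.1.1.2.pos
    obtain ⟨k, hk⟩ := Nat.exists_eq_add_of_le' hs
    have h1 := h' ⟨s, ⟨k, by omega⟩⟩
    rw [hhead] at h1
    rw [hk, Finset.prod_range_succ, mul_comm]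
    refine h1.trans ?_
    simp [tailCoord, hk]
  · rintro ⟨h1, h2⟩
    funext t
    refine (hstep t).mpr ?_
    rw [h1, mul_comm, ← Finset.prod_range_succ]
    unfold tailCoord
    split_ifs with h
    · rw [neg_neg, ← h1 ⟨t.1, ⟨t.2 + 1, h⟩⟩]
      simp [headCoord]
    · rw [show (t.2 : ℕ) + 1 = t.1.len by have := t.2.2; omega, h2]

end Regular
end Datum
end QBethe

namespace QBethe
namespace Datum
variable {X : Datum}
namespace Regular
variable (hX : X.Regular) (ν : X.Pattern) {N : X.Pattern}
include hX

/-! ### The string center equation and the initial values -/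

theorem prod_ratio (z : Str N → ℂ) (hz : ∀ s, z s ≠ 0)
    (hL : ∀ t : Root N, normL ν t 0 (fun u => z u.1) ≠ 0) (s : Str N) :
    ∏ j ∈ Finset.range s.len, ratio ν z s j =
      (-1) ^ (vacHat ν N s.color s.len + N s.1.1) * ∏ t, z t ^ sceMatrix ν N s t := by
  have h := hX.prod_norm_zero ν hz s
  have h1 : ∏ j ∈ Finset.range s.len, ratio ν z s j =
      (∏ i : Fin s.len, normR ν ⟨s, i⟩ 0 (fun u => z u.1)) /
        ∏ i : Fin s.len, normL ν ⟨s, i⟩ 0 (fun u => z u.1) := by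
    rw [Finset.prod_range, ← Finset.prod_div_distrib]
    refine Finset.prod_congr rfl fun i _ => ?_
    rw [ratio, dif_pos i.2]
  rw [h1, div_eq_iff (Finset.prod_ne_zero_iff.mpr fun i _ => hL _), mul_comm]
  exact h

theorem isSCESolution_iff (z : Str N → ℂ) (hz : ∀ s, z s ≠ 0)
    (hL : ∀ t : Root N, normL ν t 0 (fun u => z u.1) ≠ 0) :
    IsSCESolution ν N z ↔ ∀ s : Str N, ∏ j ∈ Finset.range s.len, ratio ν z s j = -1 := by
  rw [IsSCESolution, and_iff_right hz]
  refine forall_congr' fun s => ?_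
  rw [hX.prod_ratio ν z hz hL, zpow_add₀ (by norm_num : (-1 : ℂ) ≠ 0)]
  have h : ((-1 : ℂ) ^ (vacHat ν N s.color s.len + N s.1.1)) *
      (-1) ^ (vacHat ν N s.color s.len + N s.1.1) = 1 := by
    rw [← mul_zpow]; norm_num
  generalize ((-1 : ℂ) ^ (vacHat ν N s.color s.len + N s.1.1)) = e at *
  constructor
  · intro h1
    rw [h1]
    linear_combination -h
  · intro h1
    linear_combination e * h1 - (∏ t, z t ^ sceMatrix ν N s t) * h

omit hX in
/-- The solution at `q = 0` with given string centers. -/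
def initial (z : Str N → ℂ) : Root N → ℂ := fun t =>
  if 0 < (t.2 : ℕ) then ∏ j ∈ Finset.range t.2, ratio ν z t.1 j else z t.1

omit hX in
theorem initial_first (z : Str N → ℂ) (s : Str N) : initial ν z s.first = z s := by
  simp [initial, Str.first]

variable (hgen : ∀ (s : Str N) (i : ℕ), 0 < i → i < s.len → 0 < gapOrd ν N s i)
include hgen

theorem reducedBethe_initial (z : Str N → ℂ)
    (hL : ∀ t : Root N, normL ν t 0 (fun u => z u.1) ≠ 0) (hz : IsSCESolution ν N z) :
    reducedBethe ν (0, initial ν z) = 0 := by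
  rw [reducedBethe_zero_iff ν hgen]
  · simp only [initial_first]
    refine ⟨fun t => ?_, (hX.isSCESolution_iff ν z hz.1 hL).mp hz⟩
    unfold headCoord initial
    split_ifs with h
    · rfl
    · rw [show (t.2 : ℕ) = 0 by omega, Finset.prod_range_zero]
  · simpa only [initial_first] using hL

omit hX in
theorem eq_initial (Y : Root N → ℂ) (hL : ∀ t, normL ν t 0 (fun u => Y u.1.first) ≠ 0)
    (hY : reducedBethe ν (0, Y) = 0) : Y = initial ν (fun s => Y s.first) := by
  have h := ((reducedBethe_zero_iff ν hgen Y hL).mp hY).1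
  funext t
  unfold initial
  split_ifs with ht
  · rw [← h, headCoord, if_pos ht]
  · congr 1
    exact root_ext rfl (show (t.2 : ℕ) = 0 by omega)

/-! ### The Jacobian -/

theorem jacobian_ker (hdet : (sceMatrix ν N).det ≠ 0) (Y v : Root N → ℂ) (hY0 : ∀ t, Y t ≠ 0)
    (hL : ∀ t, normL ν t 0 (fun u => Y u.1.first) ≠ 0)
    (hR : ∀ t, normR ν t 0 (fun u => Y u.1.first) ≠ 0)
    (hY : reducedBethe ν (0, Y) = 0)
    (hv : HasDerivAt (fun τ : ℂ => reducedBethe ν (0, Y + τ • v)) 0 0) : v = 0 := by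
  set z : ℂ → Str N → ℂ := fun τ s => Y s.first + τ * v s.first with hz
  have hzd : ∀ s, Differentiable ℂ fun τ => z τ s := fun s => by simp only [hz]; fun_prop
  have hz0 : ∀ s, z 0 s = Y s.first := fun s => by simp [hz]
  have hzC : ContDiff ℂ 1 fun (τ : ℂ) (u : Root N) => z τ u.1 := by
    simp only [hz]
    fun_prop
  have hLd : ∀ t, Differentiable ℂ fun τ => normL ν t 0 (fun u => z τ u.1) := fun t =>
    (contDiff_normL ν t contDiff_const hzC).differentiable one_ne_zero
  have hRd : ∀ t, Differentiable ℂ fun τ => normR ν t 0 (fun u => z τ u.1) := fun t =>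
    (contDiff_normR ν t contDiff_const hzC).differentiable one_ne_zero
  have hL0 : ∀ t, normL ν t 0 (fun u => z 0 u.1) ≠ 0 := by simpa only [hz0] using hL
  have hR0 : ∀ t, normR ν t 0 (fun u => z 0 u.1) ≠ 0 := by simpa only [hz0] using hR
  set lL : Root N → ℂ := fun t => logDeriv (fun τ => normL ν t 0 (fun u => z τ u.1)) 0 with hlL
  set lR : Root N → ℂ := fun t => logDeriv (fun τ => normR ν t 0 (fun u => z τ u.1)) 0 with hlR
  set h : Str N → ℕ → ℂ := fun s i =>
    if hi : 0 < i ∧ i < s.len then v ⟨s, ⟨i, hi.2⟩⟩ / Y ⟨s, ⟨i, hi.2⟩⟩ else 0 with hh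
  have hhead0 : ∀ t, headCoord Y t ≠ 0 := by
    intro t
    unfold headCoord
    split_ifs
    exacts [hY0 _, one_ne_zero]
  have htail0 : ∀ t, tailCoord Y t ≠ 0 := by
    intro t
    unfold tailCoord
    split_ifs
    exacts [neg_ne_zero.mpr (hY0 _), one_ne_zero]
  have hhead : ∀ t, HasDerivAt (fun τ : ℂ => headCoord (Y + τ • v) t)
      (headCoord Y t * h t.1 t.2) 0 := by
    intro t
    unfold headCoord
    by_cases ht : 0 < (t.2 : ℕ)
    · simp only [if_pos ht, hh, dif_pos (show 0 < (t.2 : ℕ) ∧ (t.2 : ℕ) < t.1.len from ⟨ht, t.2.2⟩)]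
      rw [mul_div_cancel₀ _ (hY0 _)]
      have := ((hasDerivAt_id (0 : ℂ)).mul_const (v t)).const_add (Y t)
      simpa using this
    · simp only [hh, ht, false_and, dif_neg not_false, mul_zero]
      exact hasDerivAt_const _ _
  have htail : ∀ t, HasDerivAt (fun τ : ℂ => tailCoord (Y + τ • v) t)
      (tailCoord Y t * h t.1 (t.2 + 1)) 0 := by
    intro t
    unfold tailCoord
    by_cases ht : (t.2 : ℕ) + 1 < t.1.len
    · simp only [dif_pos ht, hh, dif_pos (show 0 < (t.2 : ℕ) + 1 ∧ (t.2 : ℕ) + 1 < t.1.len from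
        ⟨Nat.succ_pos _, ht⟩)]
      rw [neg_mul, mul_div_cancel₀ _ (hY0 _)]
      have := (((hasDerivAt_id (0 : ℂ)).mul_const (v ⟨t.1, ⟨t.2 + 1, ht⟩⟩)).const_add
        (Y ⟨t.1, ⟨t.2 + 1, ht⟩⟩)).fun_neg
      refine HasDerivAt.congr_deriv this ?_ |>.congr_of_eventuallyEq (Eventually.of_forall fun τ => ?_)
      · simp
      · simp
    · simp only [hh, ht, and_false, dif_neg not_false, mul_zero]
      exact hasDerivAt_const _ _
  have hder : ∀ t, lL t - lR t = h t.1 t.2 - h t.1 (t.2 + 1) := by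
    intro t
    have h1 := (hasDerivAt_pi.mp hv) t
    have h2 := ((hLd t 0).hasDerivAt.mul (htail t)).add ((hRd t 0).hasDerivAt.mul (hhead t))
    have h3 : (fun τ : ℂ => reducedBethe ν (0, Y + τ • v) t) =
        (fun τ => normL ν t 0 (fun u => z τ u.1)) * (fun τ : ℂ => tailCoord (Y + τ • v) t) +
        (fun τ => normR ν t 0 (fun u => z τ u.1)) * (fun τ : ℂ => headCoord (Y + τ • v) t) := by
      funext τ
      rw [reducedBethe_zero_apply ν hgen]
      rfl
    rw [h3] at h1
    have h4 := h1.unique h2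
    have h5 := congrFun hY t
    rw [reducedBethe_zero_apply ν hgen] at h5
    simp only [zero_smul, add_zero, hz0, Pi.zero_apply] at h4 h5
    have e1 : deriv (fun τ => normL ν t 0 (fun u => z τ u.1)) 0 =
        lL t * normL ν t 0 (fun u => Y u.1.first) := by
      simp only [hlL, logDeriv_apply, hz0, div_mul_cancel₀ _ (hL t)]
    have e2 : deriv (fun τ => normR ν t 0 (fun u => z τ u.1)) 0 =
        lR t * normR ν t 0 (fun u => Y u.1.first) := by
      simp only [hlR, logDeriv_apply, hz0, div_mul_cancel₀ _ (hR t)]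
    rw [e1, e2] at h4
    have h6 := mul_ne_zero (hL t) (htail0 t)
    refine mul_left_cancel₀ h6 ?_
    linear_combination -h4 - (lR t + h t.1 t.2) * h5
  have hsum : ∀ s : Str N, ∑ i : Fin s.len, lL ⟨s, i⟩ = ∑ i : Fin s.len, lR ⟨s, i⟩ := by
    intro s
    rw [← sub_eq_zero, ← Finset.sum_sub_distrib, Finset.sum_congr rfl fun i _ => hder ⟨s, i⟩,
      Fin.sum_univ_eq_sum_range (fun i => h s i - h s (i + 1)), Finset.sum_range_sub']
    simp [hh]
  have hlog : ∀ s : Str N, ∑ i : Fin s.len, lR ⟨s, i⟩ = ∑ i : Fin s.len, lL ⟨s, i⟩ +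
      ∑ t, (sceMatrix ν N s t : ℂ) * (v t.first / Y t.first) := by
    intro s
    have hne : ∀ᶠ τ in 𝓝 (0 : ℂ), ∀ s, z τ s ≠ 0 := by
      rw [eventually_all]
      intro s
      exact (hzd s).continuous.continuousAt.eventually_ne (by rw [hz0]; exact hY0 _)
    have hev : (fun τ => ∏ i : Fin s.len, normR ν ⟨s, i⟩ 0 (fun u => z τ u.1)) =ᶠ[𝓝 0]
        fun τ => (∏ i : Fin s.len, normL ν ⟨s, i⟩ 0 (fun u => z τ u.1)) *
          ((-1) ^ (vacHat ν N s.color s.len + N s.1.1) * ∏ t, z τ t ^ sceMatrix ν N s t) := by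
      filter_upwards [hne] with τ hτ
      exact hX.prod_norm_zero ν hτ s
    have h1 := (logDeriv_congr_nhds hev).eq_of_nhds
    have hzz : ∀ t, z 0 t ≠ 0 := fun t => by rw [hz0]; exact hY0 _
    have hzp : ∀ t, DifferentiableAt ℂ (fun τ => z τ t ^ sceMatrix ν N s t) 0 := fun t =>
      (hzd t 0).zpow (Or.inl (hzz t))
    have hsgn : ((-1 : ℂ) ^ (vacHat ν N s.color s.len + N s.1.1)) ≠ 0 :=
      zpow_ne_zero _ (by norm_num)
    rw [logDeriv_prod (f := fun (i : Fin s.len) τ => normR ν ⟨s, i⟩ 0 (fun u => z τ u.1))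
        (fun i _ => hR0 _) (fun i _ => hRd _ 0), logDeriv_mul, logDeriv_const_mul,
      logDeriv_prod (f := fun (i : Fin s.len) τ => normL ν ⟨s, i⟩ 0 (fun u => z τ u.1))
        (fun i _ => hL0 _) (fun i _ => hLd _ 0),
      logDeriv_prod (f := fun t τ => z τ t ^ sceMatrix ν N s t)] at h1
    · rw [h1]
      congr 1
      refine Finset.sum_congr rfl fun t _ => ?_
      rw [logDeriv_fun_zpow (hzd t 0), logDeriv_apply, hz0]
      congr 2
      have := ((hasDerivAt_id (0 : ℂ)).mul_const (v t.first)).const_add (Y t.first)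
      have h2 : HasDerivAt (fun τ => z τ t) (v t.first) 0 := by simpa [hz] using this
      exact h2.deriv
    · exact fun t _ => zpow_ne_zero _ (hzz t)
    · exact fun t _ => hzp t
    · exact hsgn
    · exact Finset.prod_ne_zero_iff.mpr fun i _ => hL0 _
    · exact mul_ne_zero hsgn (Finset.prod_ne_zero_iff.mpr fun t _ => zpow_ne_zero _ (hzz t))
    · exact DifferentiableAt.fun_finsetProd fun i _ => hLd _ 0
    · exact (DifferentiableAt.fun_finsetProd fun t _ => hzp t).const_mul _
  have hfirst : ∀ s : Str N, v s.first = 0 := by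
    have hdet' : ((sceMatrix ν N).map (Int.cast : ℤ → ℂ)).det ≠ 0 := by
      have := (Int.castRingHom ℂ).map_det (sceMatrix ν N)
      change _ = ((sceMatrix ν N).map (Int.cast : ℤ → ℂ)).det at this
      rw [← this]
      exact Int.cast_ne_zero.mpr hdet
    have h1 := Matrix.eq_zero_of_mulVec_eq_zero (v := fun t : Str N => v t.first / Y t.first)
      hdet' (by
        funext s
        have h2 := hlog s
        rw [hsum, left_eq_add] at h2
        exact h2)
    intro s
    have h2 := congrFun h1 s
    exact (div_eq_zero_iff.mp h2).resolve_right (hY0 _)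
  have hzc : ∀ τ, z τ = fun s => Y s.first := fun τ => by
    funext s
    simp [hz, hfirst]
  have hl : ∀ t, lL t = 0 ∧ lR t = 0 := by
    intro t
    simp [hlL, hlR, hzc]
  have hh0 : ∀ (s : Str N) (i : ℕ), i < s.len → h s i = 0 := by
    intro s i
    induction i with
    | zero => intro _; simp [hh]
    | succ i ih =>
      intro hi
      have h1 := hder ⟨s, ⟨i, by omega⟩⟩
      rw [(hl _).1, (hl _).2, sub_zero] at h1
      change 0 = h s i - h s (i + 1) at h1
      rw [ih (by omega), zero_sub] at h1
      exact neg_eq_zero.mp h1.symm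
  funext t
  rcases Nat.eq_zero_or_pos (t.2 : ℕ) with ht | ht
  · have : t = t.1.first := root_ext rfl ht
    rw [this]
    exact hfirst _
  · have h1 := hh0 t.1 t.2 t.2.2
    simp only [hh, dif_pos (show 0 < (t.2 : ℕ) ∧ (t.2 : ℕ) < t.1.len from ⟨ht, t.2.2⟩)] at h1
    exact (div_eq_zero_iff.mp h1).resolve_right (hY0 _)

end Regular
end Datum
end QBethe

namespace QBethe

/-! ### Orders of meromorphic functions -/

theorem _root_.AnalyticAt.meromorphicOrderAt_eq_zero_iff {f : ℂ → ℂ} {x : ℂ}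
    (hf : AnalyticAt ℂ f x) : meromorphicOrderAt f x = 0 ↔ f x ≠ 0 := by
  rw [← hf.analyticOrderAt_eq_zero, hf.meromorphicOrderAt_eq]
  cases analyticOrderAt f x with
  | top => simp
  | coe n =>
    rw [ENat.map_natCast]
    norm_cast

theorem meromorphicOrderAt_zpow_mul {f h : ℂ → ℂ} {n : ℤ} (hh : MeromorphicAt h 0)
    (hf : ∀ᶠ q in 𝓝[≠] (0 : ℂ), f q = q ^ n * h q) :
    meromorphicOrderAt f 0 = n + meromorphicOrderAt h 0 := by
  have hf' : f =ᶠ[𝓝[≠] 0] (fun q => q ^ n) * h := hf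
  rw [meromorphicOrderAt_congr hf', meromorphicOrderAt_mul _ hh]
  · congr 1
    simpa using fun_meromorphicOrderAt_zpow_id_sub_const (x := (0 : ℂ)) (n := n)
  · exact (MeromorphicAt.id 0).zpow n

theorem trailingCoeff_zpow_mul {f h : ℂ → ℂ} {n : ℤ} (hh : AnalyticAt ℂ h 0) (h0 : h 0 ≠ 0)
    (hf : ∀ᶠ q in 𝓝[≠] (0 : ℂ), f q = q ^ n * h q) : meromorphicTrailingCoeffAt f 0 = h 0 := by
  refine hh.meromorphicTrailingCoeffAt_of_ne_zero_of_eq_nhdsNE (n := n) h0 ?_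
  filter_upwards [hf] with q hq
  rw [hq, sub_zero, smul_eq_mul]

theorem normalized_eventuallyEq {f h : ℂ → ℂ} {n : ℤ} (hh : AnalyticAt ℂ h 0) (h0 : h 0 ≠ 0)
    (hf : ∀ᶠ q in 𝓝[≠] (0 : ℂ), f q = q ^ n * h q) :
    Datum.normalized f =ᶠ[𝓝[≠] 0] h := by
  have ho := meromorphicOrderAt_zpow_mul hh.meromorphicAt hf
  rw [hh.meromorphicOrderAt_eq_zero_iff.mpr h0, add_zero] at ho
  filter_upwards [hf, self_mem_nhdsWithin] with q hq hq0
  rw [Datum.normalized, ho, hq, WithTop.untop₀_coe, ← mul_assoc, ← zpow_add₀ hq0]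
  simp

theorem eventually_nhds_of_nhdsNE {f : ℂ → ℂ} {c : ℂ} (hf : ContinuousAt f 0)
    (h : ∀ᶠ q in 𝓝[≠] (0 : ℂ), f q = c) : ∀ᶠ q in 𝓝 (0 : ℂ), f q = c :=
  (hf.eventuallyEq_nhds_iff_eventuallyEq_nhdsNE (g := fun _ => c) continuousAt_const).mp h

namespace Datum
variable {X : Datum}

section
variable (ν : X.Pattern) {N : X.Pattern} {g : Root N → ℂ → ℂ} (hg : ∀ t, AnalyticAt ℂ (g t) 0)
include hg

omit hg in
theorem analyticAt_of_contDiff {f : ℂ × (Root N → ℂ) → ℂ} (hf : ContDiff ℂ ⊤ f)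
    (hg : ∀ t, AnalyticAt ℂ (g t) 0) : AnalyticAt ℂ (fun q => f (q, fun t => g t q)) 0 := by
  have h1 : AnalyticAt ℂ (fun q : ℂ => (q, fun t => g t q)) 0 :=
    analyticAt_id.prod (analyticAt_pi_iff.mpr hg)
  exact AnalyticAt.fun_comp (g := f) hf.contDiffAt.analyticAt h1

theorem analyticAt_normF (θ : ℤ) (t : Root N) :
    AnalyticAt ℂ (fun q => normF ν θ t q (fun u => g u q)) 0 :=
  analyticAt_of_contDiff (contDiff_normF ν θ t contDiff_fst contDiff_snd) hg

theorem analyticAt_normG (θ : ℤ) (t : Root N) :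
    AnalyticAt ℂ (fun q => normG θ t q (fun u => g u q)) 0 :=
  analyticAt_of_contDiff (contDiff_normG θ t contDiff_fst contDiff_snd) hg

theorem analyticAt_diffPrev (t : Root N) :
    AnalyticAt ℂ (fun q => diffPrev t (fun u => g u q)) 0 := by
  unfold diffPrev
  split_ifs
  exacts [(hg _).sub (hg _), analyticAt_const]

theorem analyticAt_diffNext (t : Root N) :
    AnalyticAt ℂ (fun q => diffNext t (fun u => g u q)) 0 := by
  unfold diffNext
  split_ifs
  exacts [(hg _).sub (hg _), analyticAt_const]

theorem analyticAt_stack (t : Root N) :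
    AnalyticAt ℂ (fun q => stack ν q (fun u => g u q) t) 0 :=
  analyticAt_of_contDiff (contDiff_pi.mp (contDiff_stack ν contDiff_fst contDiff_snd) t) hg

variable (hg0 : ∀ t, g t 0 ≠ 0) {x : Root N → ℂ → ℂ}
  (hx : ∀ t, ∀ᶠ q in 𝓝[≠] (0 : ℂ), x t q = q ^ rootOrd t * g t q)
include hx

section
include hg0

theorem zetaOrd_eq_diffPrev (t : Root N) : zetaOrd x t.1 (t.2 + 1) =
    meromorphicOrderAt (fun q => diffPrev t (fun u => g u q)) 0 := by
  unfold zetaOrd diffPrev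
  by_cases ht : 0 < (t.2 : ℕ)
  · rw [dif_pos ⟨by omega, t.2.2⟩]
    simp only [if_pos ht]
    refine meromorphicOrderAt_congr ((normalized_eventuallyEq (hg _) (hg0 _) (hx _)).sub
      (normalized_eventuallyEq (hg _) (hg0 _) (hx _)))
  · rw [dif_neg (by omega)]
    simp only [if_neg ht]
    exact ((analyticAt_const (v := (1 : ℂ))).meromorphicOrderAt_eq_zero_iff.mpr one_ne_zero).symm

theorem zetaOrd_eq_diffNext (t : Root N) : zetaOrd x t.1 (t.2 + 2) =
    meromorphicOrderAt (fun q => diffNext t (fun u => g u q)) 0 := by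
  unfold zetaOrd diffNext
  by_cases ht : (t.2 : ℕ) + 1 < t.1.len
  · rw [dif_pos ⟨by omega, by omega⟩]
    simp only [dif_pos ht]
    rw [meromorphicOrderAt_neg]
    refine meromorphicOrderAt_congr ?_
    filter_upwards [(normalized_eventuallyEq (hg ⟨t.1, ⟨t.2 + 1, ht⟩⟩) (hg0 _) (hx _)).sub
      (normalized_eventuallyEq (hg t) (hg0 _) (hx _))] with q hq
    change -_ = _
    rw [← neg_sub (g ⟨t.1, ⟨t.2 + 1, ht⟩⟩ q)]
    exact congrArg _ hq
  · rw [dif_neg (by omega)]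
    simp only [dif_neg ht]
    exact ((analyticAt_const (v := (1 : ℂ))).meromorphicOrderAt_eq_zero_iff.mpr one_ne_zero).symm

end

variable (hX : X.Regular)
include hX

theorem order_Fplus (t : Root N) : meromorphicOrderAt (Fplus Root.color ν x t) 0 =
    xiPlus ν t + meromorphicOrderAt (fun q => normF ν 1 t q (fun u => g u q)) 0 := by
  refine meromorphicOrderAt_zpow_mul (analyticAt_normF ν hg 1 t).meromorphicAt ?_
  filter_upwards [eventually_all.mpr hx, self_mem_nhdsWithin] with q hq hq0
  exact hX.Fplus_eq ν x _ hq hq0 t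

theorem order_Fminus (t : Root N) : meromorphicOrderAt (Fminus Root.color ν x t) 0 =
    xiMinus ν t + meromorphicOrderAt (fun q => normF ν (-1) t q (fun u => g u q)) 0 := by
  refine meromorphicOrderAt_zpow_mul (analyticAt_normF ν hg (-1) t).meromorphicAt ?_
  filter_upwards [eventually_all.mpr hx, self_mem_nhdsWithin] with q hq hq0
  exact hX.Fminus_eq ν x _ hq hq0 t

include hg0

theorem order_Gplus (t : Root N) : meromorphicOrderAt (Gplus Root.color x t) 0 =
    etaPlus t + zetaOrd x t.1 (t.2 + 1) +
      meromorphicOrderAt (fun q => normG 1 t q (fun u => g u q)) 0 := by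
  rw [zetaOrd_eq_diffPrev hg hg0 hx, add_assoc,
    ← meromorphicOrderAt_mul (analyticAt_diffPrev hg t).meromorphicAt
      (analyticAt_normG hg 1 t).meromorphicAt]
  refine meromorphicOrderAt_zpow_mul ((analyticAt_diffPrev hg t).mul
    (analyticAt_normG hg 1 t)).meromorphicAt ?_
  filter_upwards [eventually_all.mpr hx, self_mem_nhdsWithin] with q hq hq0
  exact hX.Gplus_eq x _ hq hq0 t

theorem order_Gminus (t : Root N) : meromorphicOrderAt (Gminus Root.color x t) 0 =
    etaMinus t + zetaOrd x t.1 (t.2 + 2) +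
      meromorphicOrderAt (fun q => normG (-1) t q (fun u => g u q)) 0 := by
  rw [zetaOrd_eq_diffNext hg hg0 hx, add_assoc,
    ← meromorphicOrderAt_mul (analyticAt_diffNext hg t).meromorphicAt
      (analyticAt_normG hg (-1) t).meromorphicAt]
  refine meromorphicOrderAt_zpow_mul ((analyticAt_diffNext hg t).mul
    (analyticAt_normG hg (-1) t)).meromorphicAt ?_
  filter_upwards [eventually_all.mpr hx, self_mem_nhdsWithin] with q hq hq0
  exact hX.Gminus_eq x _ hq hq0 t

end

/-! ### Solutions of the reduced Bethe equation -/

/-- Analytic solutions of the reduced Bethe equation with nonvanishing normalized factors. -/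
structure IsReducedSolution (ν : X.Pattern) {N : X.Pattern} (Y : Root N → ℂ → ℂ) : Prop where
  analytic : ∀ t, AnalyticAt ℂ (Y t) 0
  ne_zero : ∀ t, Y t 0 ≠ 0
  normF_ne : ∀ (t : Root N) (θ : ℤ), θ = 1 ∨ θ = -1 →
    normF ν θ t 0 (fun u => Y u.1.first 0) ≠ 0
  normG_ne : ∀ (t : Root N) (θ : ℤ), θ = 1 ∨ θ = -1 →
    normG θ t 0 (fun u => Y u.1.first 0) ≠ 0
  eq : ∀ᶠ q in 𝓝 (0 : ℂ), reducedBethe ν (q, fun t => Y t q) = 0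

namespace IsReducedSolution
variable {ν N : X.Pattern} {Y : Root N → ℂ → ℂ} (hY : IsReducedSolution ν Y)
include hY

theorem normL_ne (t : Root N) : normL ν t 0 (fun u => Y u.1.first 0) ≠ 0 :=
  mul_ne_zero (hY.normF_ne t 1 (Or.inl rfl)) (hY.normG_ne t (-1) (Or.inr rfl))

theorem normR_ne (t : Root N) : normR ν t 0 (fun u => Y u.1.first 0) ≠ 0 :=
  mul_ne_zero (hY.normF_ne t (-1) (Or.inr rfl)) (hY.normG_ne t 1 (Or.inl rfl))

variable (hX : X.Regular)
  (hgen : ∀ (s : Str N) (i : ℕ), 0 < i → i < s.len → 0 < gapOrd ν N s i)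
include hX hgen

theorem isGenericStringSolution {x : Root N → ℂ → ℂ}
    (hx : ∀ t, ∀ᶠ q in 𝓝[≠] (0 : ℂ), x t q = q ^ rootOrd t * stack ν q (fun u => Y u q) t) :
    IsGenericStringSolution ν N x ∧
      ∀ t, meromorphicTrailingCoeffAt (x t) 0 = Y t.1.first 0 := by
  set g : Root N → ℂ → ℂ := fun t q => stack ν q (fun u => Y u q) t with hgdef
  have hg : ∀ t, AnalyticAt ℂ (g t) 0 := analyticAt_stack ν hY.analytic
  have hgz : ∀ t, g t 0 = Y t.1.first 0 := fun t => by
    simp only [hgdef, stack_zero ν hgen]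
  have hg0 : ∀ t, g t 0 ≠ 0 := fun t => by rw [hgz]; exact hY.ne_zero _
  have hFo : ∀ t θ, θ = 1 ∨ θ = -1 →
      meromorphicOrderAt (fun q => normF ν θ t q (fun u => g u q)) 0 = 0 := by
    intro t θ hθ
    rw [(analyticAt_normF ν hg θ t).meromorphicOrderAt_eq_zero_iff]
    simpa only [hgz] using hY.normF_ne t θ hθ
  have hGo : ∀ t θ, θ = 1 ∨ θ = -1 →
      meromorphicOrderAt (fun q => normG θ t q (fun u => g u q)) 0 = 0 := by
    intro t θ hθ
    rw [(analyticAt_normG hg θ t).meromorphicOrderAt_eq_zero_iff]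
    simpa only [hgz] using hY.normG_ne t θ hθ
  have hFp : ∀ t, meromorphicOrderAt (Fplus Root.color ν x t) 0 = xiPlus ν t := fun t => by
    rw [order_Fplus ν hg hx hX, hFo t 1 (Or.inl rfl), add_zero]
  have hFm : ∀ t, meromorphicOrderAt (Fminus Root.color ν x t) 0 = xiMinus ν t := fun t => by
    rw [order_Fminus ν hg hx hX, hFo t (-1) (Or.inr rfl), add_zero]
  have hGp : ∀ t, meromorphicOrderAt (Gplus Root.color x t) 0 =
      etaPlus t + zetaOrd x t.1 (t.2 + 1) := fun t => by
    rw [order_Gplus hg hg0 hx hX, hGo t 1 (Or.inl rfl), add_zero]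
  have hGm : ∀ t, meromorphicOrderAt (Gminus Root.color x t) 0 =
      etaMinus t + zetaOrd x t.1 (t.2 + 2) := fun t => by
    rw [order_Gminus hg hg0 hx hX, hGo t (-1) (Or.inr rfl), add_zero]
  have hord : ∀ t, meromorphicOrderAt (x t) 0 = rootOrd t := fun t => by
    rw [meromorphicOrderAt_zpow_mul (hg t).meromorphicAt (hx t),
      (hg t).meromorphicOrderAt_eq_zero_iff.mpr (hg0 t), add_zero]
  have htc : ∀ t, meromorphicTrailingCoeffAt (x t) 0 = Y t.1.first 0 := fun t => by
    rw [trailingCoeff_zpow_mul (hg t) (hg0 t) (hx t), hgz]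
  have hmer : ∀ t, MeromorphicAt (x t) 0 := fun t =>
    (((MeromorphicAt.id 0).zpow (rootOrd t)).mul (hg t).meromorphicAt).congr
      (EventuallyEq.symm (hx t))
  refine ⟨⟨⟨⟨hmer, fun t => ?_⟩, fun t => ?_, hord, fun t => ?_⟩, hFp, hFm, hGp, hGm⟩, htc⟩
  · filter_upwards [eventually_all.mpr hx, self_mem_nhdsWithin,
      hY.eq.filter_mono nhdsWithin_le_nhds] with q hq hq0 he
    exact (hX.bethe_iff_reducedBethe ν hgen x _ hq0 hq t).mpr (congrFun he t)
  · have hz : zetaOrd x t.1 (t.2 + 2) ≠ ⊤ := by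
      rw [zetaOrd_eq_diffNext hg hg0 hx]
      have hd : AnalyticAt ℂ (fun q => tailCoord (fun u => Y u q) t) 0 := by
        unfold tailCoord
        split_ifs
        exacts [(hY.analytic _).neg, analyticAt_const]
      rw [meromorphicOrderAt_zpow_mul (n := gapExp ν t.1 (t.2 + 1)) hd.meromorphicAt
        (Eventually.of_forall fun q => by rw [zpow_natCast]; exact diffNext_stack ν q _ t),
        hd.meromorphicOrderAt_eq_zero_iff.mpr, add_zero]
      · exact WithTop.coe_ne_top
      · unfold tailCoord
        split_ifs
        exacts [neg_ne_zero.mpr (hY.ne_zero _), one_ne_zero]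
    have hm1 : MeromorphicAt (Fplus Root.color ν x t) 0 := by
      unfold Fplus
      fun_prop
    have hm2 : MeromorphicAt (Gminus Root.color x t) 0 := by
      unfold Gminus
      fun_prop
    rw [meromorphicOrderAt_mul hm1 hm2, hFp, hGm]
    exact WithTop.add_ne_top.mpr ⟨WithTop.coe_ne_top, WithTop.add_ne_top.mpr
      ⟨WithTop.coe_ne_top, hz⟩⟩
  · rw [htc, htc]
    rfl

end IsReducedSolution
end Datum
end QBethe

namespace QBethe
namespace Datum
variable {X : Datum}

theorem exists_zpow_mul {f : ℂ → ℂ} {n : ℤ} (hf : MeromorphicAt f 0)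
    (hn : meromorphicOrderAt f 0 = n) : ∃ h : ℂ → ℂ, AnalyticAt ℂ h 0 ∧ h 0 ≠ 0 ∧
      ∀ᶠ q in 𝓝[≠] (0 : ℂ), f q = q ^ n * h q := by
  simpa only [sub_zero, smul_eq_mul] using (meromorphicOrderAt_eq_int_iff hf).mp hn

namespace IsGenericStringSolution
variable {ν N : X.Pattern} {x : Root N → ℂ → ℂ} (hx : IsGenericStringSolution ν N x)
  (hX : X.Regular)
include hx

theorem meromorphicAt_Fplus (t : Root N) : MeromorphicAt (Fplus Root.color ν x t) 0 := by
  have := hx.isString.bethe.1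
  unfold Fplus
  fun_prop

theorem meromorphicAt_Fminus (t : Root N) : MeromorphicAt (Fminus Root.color ν x t) 0 := by
  have := hx.isString.bethe.1
  unfold Fminus
  fun_prop

theorem meromorphicAt_Gplus (t : Root N) : MeromorphicAt (Gplus Root.color x t) 0 := by
  have := hx.isString.bethe.1
  unfold Gplus
  fun_prop

theorem meromorphicAt_Gminus (t : Root N) : MeromorphicAt (Gminus Root.color x t) 0 := by
  have := hx.isString.bethe.1
  unfold Gminus
  fun_prop

theorem zetaOrd_ne_top (s : Str N) {i : ℕ} (hi : i < s.len) : zetaOrd x s (i + 1) ≠ ⊤ := by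
  rcases i with _ | i
  · rw [zetaOrd, dif_neg (by omega)]
    exact WithTop.zero_ne_top
  · have h := hx.isString.ord_finite ⟨s, ⟨i, by omega⟩⟩
    rw [meromorphicOrderAt_mul (hx.meromorphicAt_Fplus _) (hx.meromorphicAt_Gminus _),
      hx.ord_Gminus] at h
    exact (WithTop.add_ne_top.mp (WithTop.add_ne_top.mp h).2).2

include hX

theorem zetaOrd_eq_gapOrd (s : Str N) (i : ℕ) (hi : i < s.len) :
    zetaOrd x s (i + 1) = gapOrd ν N s i := by
  induction i with
  | zero =>
    rw [zetaOrd, dif_neg (by omega), gapOrd_zero]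
    rfl
  | succ i ih =>
    have ih := ih (by omega)
    set t : Root N := ⟨s, ⟨i, by omega⟩⟩ with ht
    have h := hx.isString.bethe.2 t
    have h1 : meromorphicOrderAt (Fplus Root.color ν x t * Gminus Root.color x t) 0 =
        meromorphicOrderAt (Fminus Root.color ν x t * Gplus Root.color x t) 0 := by
      rw [meromorphicOrderAt_neg (f := Fminus Root.color ν x t * Gplus Root.color x t)]
      exact meromorphicOrderAt_congr h
    rw [meromorphicOrderAt_mul (hx.meromorphicAt_Fplus _) (hx.meromorphicAt_Gminus _),
      meromorphicOrderAt_mul (hx.meromorphicAt_Fminus _) (hx.meromorphicAt_Gplus _),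
      hx.ord_Fplus, hx.ord_Fminus, hx.ord_Gplus, hx.ord_Gminus] at h1
    change (xiPlus ν t : WithTop ℤ) + (etaMinus t + zetaOrd x s (i + 1 + 1)) =
      xiMinus ν t + (etaPlus t + zetaOrd x s (i + 1)) at h1
    have h2 := hX.xi_eta_eq_defect ν N t
    have h3 : gapOrd ν N s (i + 1) = gapOrd ν N s i + defect ν N t.color t.level := by
      unfold gapOrd
      rw [Finset.sum_range_succ]
      congr 2
      change _ = (s.len : ℤ) + 1 - 2 * ((i : ℕ) + 1)
      ring
    obtain ⟨k, hk⟩ := WithTop.ne_top_iff_exists.mp (hx.zetaOrd_ne_top s hi)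
    rw [ih, ← hk] at h1
    rw [← hk]
    norm_cast at h1 ⊢
    omega

variable (hgen : ∀ (s : Str N) (i : ℕ), 0 < i → i < s.len → 0 < gapOrd ν N s i)
include hgen

/-- A generic string solution comes from a solution of the reduced Bethe equation. -/
theorem exists_isReducedSolution : ∃ Y : Root N → ℂ → ℂ, IsReducedSolution ν Y ∧
    ∀ t, ∀ᶠ q in 𝓝[≠] (0 : ℂ), x t q = q ^ rootOrd t * stack ν q (fun u => Y u q) t := by
  choose g hg hg0 hxg using fun t =>
    exists_zpow_mul (n := rootOrd t) (hx.isString.bethe.1 t) (hx.isString.ord_eq t)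
  have hgz : ∀ t, g t 0 = g t.1.first 0 := fun t => by
    rw [← trailingCoeff_zpow_mul (hg t) (hg0 t) (hxg t), hx.isString.center_eq,
      trailingCoeff_zpow_mul (hg _) (hg0 _) (hxg _)]
  have hdiff : ∀ t : Root N, ∃ Y : ℂ → ℂ, AnalyticAt ℂ Y 0 ∧ Y 0 ≠ 0 ∧
      ((t.2 : ℕ) = 0 → Y = g t) ∧ (0 < (t.2 : ℕ) → ∀ᶠ q in 𝓝[≠] (0 : ℂ),
        diffPrev t (fun u => g u q) = q ^ gapExp ν t.1 t.2 * Y q) := by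
    intro t
    rcases Nat.eq_zero_or_pos (t.2 : ℕ) with ht | ht
    · exact ⟨g t, hg t, hg0 t, fun _ => rfl, fun h => absurd h (by omega)⟩
    · have h1 := (zetaOrd_eq_diffPrev hg hg0 hxg t).symm.trans
        (hx.zetaOrd_eq_gapOrd hX t.1 t.2 t.2.2)
      obtain ⟨Y, h2, h3, h4⟩ := exists_zpow_mul (analyticAt_diffPrev hg t).meromorphicAt h1
      refine ⟨Y, h2, h3, fun h => absurd h (by omega), fun _ => ?_⟩
      filter_upwards [h4] with q hq
      rw [hq, ← zpow_natCast, gapExp, Int.toNat_of_nonneg (hgen _ _ ht t.2.2).le]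
  choose Y hYan hY0 hYfirst hYdiff using hdiff
  have hYf : ∀ s : Str N, Y s.first = g s.first := fun s => hYfirst _ rfl
  have hstack : ∀ (s : Str N) (i : ℕ) (hi : i < s.len), ∀ᶠ q in 𝓝[≠] (0 : ℂ),
      stack ν q (fun u => Y u q) ⟨s, ⟨i, hi⟩⟩ = g ⟨s, ⟨i, hi⟩⟩ q := by
    intro s i
    induction i with
    | zero =>
      intro hi
      refine Eventually.of_forall fun q => ?_
      have := hYf s
      rw [Str.first] at this
      simp [stack, gapExp, gapOrd_zero, hi, this]
    | succ i ih =>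
      intro hi
      filter_upwards [ih (by omega), hYdiff ⟨s, ⟨i + 1, hi⟩⟩ (Nat.succ_pos i)] with q h1 h2
      have h3 := diffPrev_stack ν q (fun u => Y u q) ⟨s, ⟨i + 1, hi⟩⟩
      simp only [diffPrev, headCoord, Nat.succ_pos, if_true, Nat.add_sub_cancel] at h2 h3
      rw [← h2, h1] at h3
      exact sub_left_inj.mp h3
  have hxs : ∀ t, ∀ᶠ q in 𝓝[≠] (0 : ℂ),
      x t q = q ^ rootOrd t * stack ν q (fun u => Y u q) t := by
    intro t
    filter_upwards [hxg t, hstack t.1 t.2 t.2.2] with q h1 h2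
    rw [h1, ← h2]
  have hF : ∀ t θ, meromorphicOrderAt (fun q => normF ν θ t q (fun u => g u q)) 0 = 0 →
      normF ν θ t 0 (fun u => Y u.1.first 0) ≠ 0 := by
    intro t θ h
    rw [(analyticAt_normF ν hg θ t).meromorphicOrderAt_eq_zero_iff] at h
    simpa only [hYf, ← hgz] using h
  have hG : ∀ t θ, meromorphicOrderAt (fun q => normG θ t q (fun u => g u q)) 0 = 0 →
      normG θ t 0 (fun u => Y u.1.first 0) ≠ 0 := by
    intro t θ h
    rw [(analyticAt_normG hg θ t).meromorphicOrderAt_eq_zero_iff] at h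
    simpa only [hYf, ← hgz] using h
  have hcancel : ∀ a b : WithTop ℤ, a ≠ ⊤ → a + b = a → b = 0 := by
    intro a b ha h
    exact WithTop.add_left_cancel ha (h.trans (add_zero a).symm)
  refine ⟨Y, ⟨hYan, hY0, ?_, ?_, ?_⟩, hxs⟩
  · rintro t θ (rfl | rfl)
    · exact hF t 1 (hcancel _ _ WithTop.coe_ne_top
        ((order_Fplus ν hg hxg hX t).symm.trans (hx.ord_Fplus t)))
    · exact hF t (-1) (hcancel _ _ WithTop.coe_ne_top
        ((order_Fminus ν hg hxg hX t).symm.trans (hx.ord_Fminus t)))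
  · rintro t θ (rfl | rfl)
    · refine hG t 1 (hcancel _ _ (WithTop.add_ne_top.mpr ⟨WithTop.coe_ne_top,
        hx.zetaOrd_ne_top t.1 t.2.2⟩) ((order_Gplus hg hg0 hxg hX t).symm.trans (hx.ord_Gplus t)))
    · have h := hx.isString.ord_finite t
      rw [meromorphicOrderAt_mul (hx.meromorphicAt_Fplus _) (hx.meromorphicAt_Gminus _)] at h
      have h' := (WithTop.add_ne_top.mp h).2
      rw [hx.ord_Gminus t] at h'
      exact hG t (-1) (hcancel _ _ h'
        ((order_Gminus hg hg0 hxg hX t).symm.trans (hx.ord_Gminus t)))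
  · have hcont : ∀ t, ContinuousAt (fun q => reducedBethe ν (q, fun u => Y u q) t) 0 := fun t =>
      (analyticAt_of_contDiff (contDiff_pi.mp (contDiff_reducedBethe ν) t) hYan).continuousAt
    have h1 : ∀ t, ∀ᶠ q in 𝓝 (0 : ℂ), reducedBethe ν (q, fun u => Y u q) t = 0 := by
      intro t
      refine eventually_nhds_of_nhdsNE (hcont t) ?_
      filter_upwards [eventually_all.mpr hxs, self_mem_nhdsWithin, hx.isString.bethe.2 t]
        with q hq hq0 he
      exact (hX.bethe_iff_reducedBethe ν hgen x _ hq0 hq t).mp he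
    filter_upwards [eventually_all.mpr h1] with q hq
    exact funext hq

end IsGenericStringSolution

namespace Regular
variable (hX : X.Regular) {ν N : X.Pattern}
  (hgen : ∀ (s : Str N) (i : ℕ), 0 < i → i < s.len → 0 < gapOrd ν N s i)
  (hdet : (sceMatrix ν N).det ≠ 0)
include hX hgen hdet

theorem isInvertible_fderiv (Y : Root N → ℂ) (hY0 : ∀ t, Y t ≠ 0)
    (hL : ∀ t, normL ν t 0 (fun u => Y u.1.first) ≠ 0)
    (hR : ∀ t, normR ν t 0 (fun u => Y u.1.first) ≠ 0)
    (hY : reducedBethe ν (0, Y) = 0) :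
    (fderiv ℂ (reducedBethe ν) ((0 : ℂ), Y) ∘L .inr ℂ ℂ (Root N → ℂ)).IsInvertible := by
  set f := fderiv ℂ (reducedBethe ν) ((0 : ℂ), Y) ∘L .inr ℂ ℂ (Root N → ℂ) with hf
  have hinj : Function.Injective (f : (Root N → ℂ) →ₗ[ℂ] (Root N → ℂ)) := by
    rw [← LinearMap.ker_eq_bot, LinearMap.ker_eq_bot']
    intro v hv
    refine hX.jacobian_ker ν hgen hdet Y v hY0 hL hR hY ?_
    have h1 : HasDerivAt (fun τ : ℂ => ((0 : ℂ), Y + τ • v)) ((0 : ℂ), v) 0 := by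
      refine (hasDerivAt_const _ _).prodMk ?_
      simpa using ((hasDerivAt_id (0 : ℂ)).smul_const v).const_add Y
    have h2 : HasFDerivAt (reducedBethe ν) (fderiv ℂ (reducedBethe ν) ((0 : ℂ), Y))
        ((0 : ℂ), Y + (0 : ℂ) • v) := by
      rw [zero_smul, add_zero]
      exact ((contDiff_reducedBethe ν (n := 1)).differentiable one_ne_zero _).hasFDerivAt
    have h3 := h2.comp_hasDerivAt (0 : ℂ) h1
    exact h3.congr_deriv hv
  refine ⟨(LinearEquiv.ofInjectiveEndo _ hinj).toContinuousLinearEquiv, ?_⟩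
  ext1 v
  rfl

theorem exists_analytic (Y : Root N → ℂ) (hY0 : ∀ t, Y t ≠ 0)
    (hL : ∀ t, normL ν t 0 (fun u => Y u.1.first) ≠ 0)
    (hR : ∀ t, normR ν t 0 (fun u => Y u.1.first) ≠ 0)
    (hY : reducedBethe ν (0, Y) = 0) :
    ∃ Ψ : Root N → ℂ → ℂ, (∀ t, AnalyticAt ℂ (Ψ t) 0) ∧ (∀ t, Ψ t 0 = Y t) ∧
      (∀ᶠ q in 𝓝 (0 : ℂ), reducedBethe ν (q, fun t => Ψ t q) = 0) ∧
      ∀ Z : Root N → ℂ → ℂ, (∀ t, ContinuousAt (Z t) 0) → (∀ t, Z t 0 = Y t) →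
        (∀ᶠ q in 𝓝 (0 : ℂ), reducedBethe ν (q, fun t => Z t q) = 0) →
        ∀ᶠ q in 𝓝 (0 : ℂ), ∀ t, Z t q = Ψ t q := by
  have hinv := hX.isInvertible_fderiv hgen hdet Y hY0 hL hR hY
  have hcd : ContDiffAt ℂ ⊤ (reducedBethe ν) ((0 : ℂ), Y) := (contDiff_reducedBethe ν).contDiffAt
  have hne : (⊤ : WithTop ℕ∞) ≠ 0 := WithTop.top_ne_zero
  refine ⟨fun t q => hcd.implicitFunction hne hinv q t, ?_, ?_, ?_, ?_⟩
  · exact analyticAt_pi_iff.mp (hcd.contDiffAt_implicitFunction hne hinv).analyticAt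
  · intro t
    exact congrFun (hcd.implicitFunction_apply_self hne hinv) t
  · filter_upwards [hcd.eventually_apply_implicitFunction hne hinv] with q hq
    exact hq.trans hY
  · intro Z hZ hZ0 hZeq
    have hev := hcd.eventually_apply_eq_iff_implicitFunction hne hinv
    have hcont : ContinuousAt (fun q : ℂ => (q, fun t => Z t q)) 0 :=
      continuousAt_id.prodMk (continuousAt_pi.mpr hZ)
    have hlim : Tendsto (fun q : ℂ => (q, fun t => Z t q)) (𝓝 0) (𝓝 ((0 : ℂ), Y)) := by
      have h := hcont.tendsto
      rwa [show (fun t => Z t 0) = Y from funext hZ0] at h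
    filter_upwards [hlim.eventually hev, hZeq] with q h1 h2 t
    exact (congrFun (h1.mp (h2.trans hY.symm)) t).symm

omit hdet in
theorem centers_isGenericSCESolution {Y : Root N → ℂ → ℂ} (hY : IsReducedSolution ν Y) :
    IsGenericSCESolution ν N fun s => Y s.first 0 := by
  have hz : ∀ s : Str N, Y s.first 0 ≠ 0 := fun s => hY.ne_zero _
  exact
    { sce := (hX.isSCESolution_iff ν (fun s => Y s.first 0) hz hY.normL_ne).mpr
        ((reducedBethe_zero_iff ν hgen (fun t => Y t 0) hY.normL_ne).mp hY.eq.self_of_nhds).2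
      ne_one := hX.ne_one_of_normF ν (z := fun s => Y s.first 0) hz
        fun t => hY.normF_ne t 1 (Or.inl rfl)
      ne := hX.ne_of_normG (z := fun s => Y s.first 0) hz
        fun t => hY.normG_ne t 1 (Or.inl rfl) }

theorem eventuallyEq_of_centers {Y Z : Root N → ℂ → ℂ} (hY : IsReducedSolution ν Y)
    (hZ : IsReducedSolution ν Z) (h : ∀ s : Str N, Y s.first 0 = Z s.first 0) :
    ∀ᶠ q in 𝓝 (0 : ℂ), ∀ t, Y t q = Z t q := by
  have hYi := eq_initial ν hgen (fun t => Y t 0) hY.normL_ne hY.eq.self_of_nhds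
  have hZi := eq_initial ν hgen (fun t => Z t 0) hZ.normL_ne hZ.eq.self_of_nhds
  rw [← funext h, ← hYi] at hZi
  obtain ⟨Ψ, -, -, -, hu⟩ := hX.exists_analytic hgen hdet (fun t => Y t 0) hY.ne_zero
    hY.normL_ne hY.normR_ne hY.eq.self_of_nhds
  filter_upwards [hu Y (fun t => (hY.analytic t).continuousAt) (fun _ => rfl) hY.eq,
    hu Z (fun t => (hZ.analytic t).continuousAt) (congrFun hZi) hZ.eq] with q h1 h2 t
  rw [h1, h2]

theorem exists_isReducedSolution_of_sce {z : Str N → ℂ} (hz : IsGenericSCESolution ν N z) :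
    ∃ Y : Root N → ℂ → ℂ, IsReducedSolution ν Y ∧ ∀ s : Str N, Y s.first 0 = z s := by
  have hF := fun (t : Root N) (θ : ℤ) (hθ : θ = 1 ∨ θ = -1) =>
    hX.normF_zero_ne_zero ν hz.sce.1 hz.ne_one hθ t
  have hG := fun (t : Root N) (θ : ℤ) (hθ : θ = 1 ∨ θ = -1) =>
    hX.normG_zero_ne_zero hz.sce.1 hz.ne hθ t
  have hL : ∀ t : Root N, normL ν t 0 (fun u => z u.1) ≠ 0 := fun t =>
    mul_ne_zero (hF t 1 (Or.inl rfl)) (hG t (-1) (Or.inr rfl))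
  have hR : ∀ t : Root N, normR ν t 0 (fun u => z u.1) ≠ 0 := fun t =>
    mul_ne_zero (hF t (-1) (Or.inr rfl)) (hG t 1 (Or.inl rfl))
  have h0 : ∀ t, initial ν z t ≠ 0 := by
    intro t
    unfold initial
    split_ifs
    · refine Finset.prod_ne_zero_iff.mpr fun j _ => ?_
      unfold ratio
      split_ifs
      exacts [div_ne_zero (hR _) (hL _), one_ne_zero]
    · exact hz.sce.1 _
  obtain ⟨Ψ, h1, h2, h3, -⟩ := hX.exists_analytic hgen hdet (initial ν z) h0
    (by simpa only [initial_first] using hL) (by simpa only [initial_first] using hR)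
    (hX.reducedBethe_initial ν hgen z hL hz.sce)
  have h4 : ∀ s : Str N, Ψ s.first 0 = z s := fun s => by rw [h2, initial_first]
  refine ⟨Ψ, ⟨h1, fun t => by rw [h2]; exact h0 t, ?_, ?_, h3⟩, h4⟩
  · simpa only [h4] using hF
  · simpa only [h4] using hG

theorem bijOn_centers :
    Set.BijOn centers (genericStringSolutions ν N) {z | IsGenericSCESolution ν N z} := by
  have hcenter : ∀ {g : Root N → Germ (𝓝[≠] (0 : ℂ)) ℂ} {x : Root N → ℂ → ℂ}
      {Y : Root N → ℂ → ℂ}, (∀ t, g t = (x t : Germ _ ℂ)) → IsReducedSolution ν Y →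
      (∀ t, ∀ᶠ q in 𝓝[≠] (0 : ℂ), x t q = q ^ rootOrd t * stack ν q (fun u => Y u q) t) →
      centers g = fun s => Y s.first 0 := by
    intro g x Y hgx hY hxY
    funext s
    unfold centers
    rw [hgx]
    exact (hY.isGenericStringSolution hX hgen hxY).2 s.first
  refine ⟨?_, ?_, ?_⟩
  · rintro g ⟨x, hx, hgx⟩
    obtain ⟨Y, hY, hxY⟩ := hx.exists_isReducedSolution hX hgen
    rw [Set.mem_ofPred_eq, hcenter hgx hY hxY]
    exact hX.centers_isGenericSCESolution hgen hY
  · rintro g ⟨x, hx, hgx⟩ g' ⟨x', hx', hgx'⟩ h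
    obtain ⟨Y, hY, hxY⟩ := hx.exists_isReducedSolution hX hgen
    obtain ⟨Y', hY', hxY'⟩ := hx'.exists_isReducedSolution hX hgen
    rw [hcenter hgx hY hxY, hcenter hgx' hY' hxY'] at h
    have hev := hX.eventuallyEq_of_centers hgen hdet hY hY' (congrFun h)
    funext t
    rw [hgx, hgx', Germ.coe_eq]
    filter_upwards [hxY t, hxY' t, hev.filter_mono nhdsWithin_le_nhds] with q h1 h2 h3
    rw [h1, h2, funext h3]
  · intro z hz
    obtain ⟨Y, hY, hYz⟩ := hX.exists_isReducedSolution_of_sce hgen hdet hz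
    set x : Root N → ℂ → ℂ := fun t q => q ^ rootOrd t * stack ν q (fun u => Y u q) t
    have hxY : ∀ t, ∀ᶠ q in 𝓝[≠] (0 : ℂ),
        x t q = q ^ rootOrd t * stack ν q (fun u => Y u q) t :=
      fun t => Eventually.of_forall fun q => rfl
    refine ⟨fun t => (x t : Germ _ ℂ),
      ⟨x, (hY.isGenericStringSolution hX hgen hxY).1, fun _ => rfl⟩, ?_⟩
    rw [hcenter (fun _ => rfl) hY hxY]
    exact funext hYz

end Regular
end Datum
end QBethe

theorem theorem2 (T : QBethe.AffineType) (ν N : T.datum.Pattern)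
    (hgen : QBethe.Datum.GenericityCondition ν N)
    (hdet : (QBethe.Datum.sceMatrix ν N).det ≠ 0) :
    Set.BijOn QBethe.Datum.centers
      (QBethe.Datum.genericStringSolutions ν N)
      {z | QBethe.Datum.IsGenericSCESolution ν N z} :=
  T.regular.bijOn_centers (fun s _ h0 hi => T.regular.gapOrd_pos hgen s h0 hi) hdet

end
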